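/- \textbf{Setting.} Let $\mathcal M=(N,\mathcal I)$ be a matroid on a ground set $N$ of $n\ge 2$ elements and let $f:2^N\to\mathbb R$ be nonnegative, normalized ($f(\emptyset)=0$) and submodular ($f(S)+f(T)\ge f(S\cup T)+f(S\cap T)$ for all $S,T\subseteq N$), not necessarily monotone. Let $\mathrm{OPT}=\max_{I\in\mathcal I}f(I)$. A randomized algorithm knows $N$ and $\varepsilon$, and accesses $f$ through a value oracle ($S\mapsto f(S)$) and $\mathcal M$ through a span oracle (given $S\subseteq N$ and $e\in N$, it tells whether $S+e$ has higher rank than $S$). Its oracle queries are organized in adaptive rounds: the queries of a round may depend only on the algorithm's coin tosses and on the answers received in strictly preceding rounds. Only queries are charged, and every round submits at most polynomially many (in $n$ and $1/\varepsilon$) queries. \textbf{Theorem.} There are universal constants $C,d$ such that for all $n\ge 2$ and all $\varepsilon\in(0,1)$ the following hold, where every algorithm submits at most $C(n/\varepsilon)^d$ queries in each round, and its guarantees hold for all $\mathcal M$ and $f$ as above. 1. There is a randomized algorithm that always outputs an independent set $I\in\mathcal I$, with $$\mathbb E[f(I)]\ \ge\ (1-\varepsilon)\,(3-2\sqrt2)\,\mathrm{OPT},$$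 and that uses at most $C\log^2 n/\varepsilon^2$ adaptive rounds in expectation. 2. There are an integer $1\le\ell\le C/\varepsilon$ and a randomized algorithm that always outputs $\ell$ independent sets $I_1,\dots,I_\ell\in\mathcal I$ and uses at most $C\log^2 n/\varepsilon^3$ adaptive rounds in expectation, such that if, for each $k\in\{1,\dots,\ell\}$ independently, $J_k$ contains each element of $I_k$ independently with probability $1/\ell$, then $$\mathbb E[f(J_1\cup\dots\cup J_\ell)]\ \ge\ (e^{-1}-\varepsilon)\,\mathrm{OPT},$$ the expectation being over both the algorithm and the sampling. 3. There is a randomized algorithm that uses at most $C\log^2 n/\varepsilon^3$ adaptive rounds in expectation and outputs a real number $V$ which is an $(e^{-1}-\varepsilon)$-approximation to $\mathrm{OPT}$: with probability at least $2/3$, $(e^{-1}-\varepsilon)\,\mathrm{OPT}\le V\le \mathrm{OPT}$. -/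

import Mathlib

open scoped ENNReal

/-- A real-valued set function on the subsets of `α` is submodular. -/
def IsSubmodular {α : Type*} [DecidableEq α] (f : Finset α → ℝ) : Prop :=
  ∀ S T : Finset α, f (S ∪ T) + f (S ∩ T) ≤ f S + f T

/-- `OPT`: the maximum of `f` over the independent sets of the matroid `M`. -/
noncomputable def optValue {α : Type*} [Fintype α] (M : Matroid α) (f : Finset α → ℝ) : ℝ :=
  open scoped Classical in
  (Finset.univ.filter fun I : Finset α => M.Indep (I : Set α)).sup'
    ⟨∅, by simp⟩ f

/-- The span oracle of `M`: for a set `S` and an element `e` it tells whether `S + e` has higher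
rank than `S`. -/
noncomputable def spanOracle {α : Type*} [DecidableEq α] (M : Matroid α)
    (S : Finset α) (e : α) : Bool :=
  open scoped Classical in
  decide (M.eRk (S : Set α) < M.eRk ((insert e S : Finset α) : Set α))

/-- A randomized algorithm with output in `β` that has access to a value oracle for a set function
on `α` and to a span oracle for a matroid on `α`, presented as its (well-founded) computation tree.
* `output b` halts with output `b`;
* `sample p next` draws `i` from the discrete distribution `p` and continues as `next i`;
* `round Q P next` is one adaptive round: it submits simultaneously the value queries `Q` and the
  span queries `P`, and continues as `next` applied to the answers to exactly these queries.
So the queries of a round depend only on the coin tosses and on the answers from strictly preceding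
rounds. Computation between rounds is not charged. -/
inductive OracleAlg (α : Type*) (β : Type*)
  | output (b : β) : OracleAlg α β
  | sample (p : PMF ℕ) (next : ℕ → OracleAlg α β) : OracleAlg α β
  | round (Q : Finset (Finset α)) (P : Finset (Finset α × α))
      (next : ({S // S ∈ Q} → ℝ) → ({q // q ∈ P} → Bool) → OracleAlg α β) : OracleAlg α β

namespace OracleAlg

/-- The joint law of the output and of the number of adaptive rounds used, when the value oracle
answers with `f` and the span oracle with the matroid `M`. -/
noncomputable def law {α β : Type*} [DecidableEq α] (M : Matroid α) (f : Finset α → ℝ) :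
    OracleAlg α β → PMF (β × ℕ)
  | output b => PMF.pure (b, 0)
  | sample p next => p.bind fun i => law M f (next i)
  | round _ _ next =>
      (law M f (next (fun S => f S.1) (fun q => spanOracle M q.1.1 q.1.2))).map
        fun x => (x.1, x.2 + 1)

/-- The law of the output. -/
noncomputable def outputLaw {α β : Type*} [DecidableEq α] (A : OracleAlg α β)
    (M : Matroid α) (f : Finset α → ℝ) : PMF β :=
  (A.law M f).map Prod.fst

/-- The expected number of adaptive rounds. -/
noncomputable def expectedRounds {α β : Type*} [DecidableEq α] (A : OracleAlg α β)
    (M : Matroid α) (f : Finset α → ℝ) : ℝ≥0∞ :=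
  ∑' x : β × ℕ, A.law M f x * (x.2 : ℝ≥0∞)

/-- No round of the algorithm submits more than `q` queries. -/
def QueriesPerRoundLE {α β : Type*} (q : ℝ) : OracleAlg α β → Prop
  | output _ => True
  | sample _ next => ∀ i, QueriesPerRoundLE q (next i)
  | round Q P next => ((Q.card + P.card : ℕ) : ℝ) ≤ q ∧
      ∀ v s, QueriesPerRoundLE q (next v s)

end OracleAlg

/-- The expectation of `X` under a discrete law on a finite type. -/
noncomputable def finExpect {β : Type*} [Fintype β] (p : PMF β) (X : β → ℝ) : ℝ :=
  ∑ b, (p b).toReal * X b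

/-- The probability that the random set which contains each element of `S` independently with
probability `p`, and nothing else, is equal to `J`. -/
noncomputable def sampleWeight {α : Type*} [DecidableEq α] (p : ℝ) (S J : Finset α) : ℝ :=
  if J ⊆ S then p ^ J.card * (1 - p) ^ (S \ J).card else 0

/-- `E[f(J₁ ∪ ⋯ ∪ J_ℓ)]`, where, independently for each `k`, the set `J_k` samples each element of
`I_k` independently with probability `1/ℓ`. -/
noncomputable def sampledUnionValue {α : Type*} [Fintype α] [DecidableEq α]
    (f : Finset α → ℝ) {l : ℕ} (I : Fin l → Finset α) : ℝ :=
  ∑ J : Fin l → Finset α,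
    (∏ k, sampleWeight (1 / (l : ℝ)) (I k) (J k)) * f (Finset.univ.biUnion J)

-- All three parts rest on one parallel form of greedy selection. Let u(A, x) be a table of marginal
-- values that decrease in A as long as they are nonnegative, and let μ be the current top value.
-- Call x live if u(A, x) ≥ (1 - δ)μ, order the N live elements at random, and query all prefixes of
-- the order in one round. Elements are processed one by one while more than (1 - δ)N elements are
-- live. Each of them enters the set A with weight μ, but only those still live at their turn are
-- accepted into Q. A random remaining element is live with probability at least 1 - δ, so the
-- accepted weight c and the rejected weight d satisfy (1 - δ) E d ≤ δ E c (`ev_greedy_le`). Such a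
-- step costs two rounds and multiplies the number of live elements by at most 1 - δ.
-- Logarithmically many steps lower the top value by the factor 1 - δ, and logarithmically many such
-- stages bring it down to a negligible threshold θ. The exchange argument is `surely_greedy`: if
-- every B ⊆ A blocks at most |B| elements of K, then c + d + |K|θ pays for the values of K.
--
-- For a single independent set, two solutions are grown at once on the ground set Bool × α, and an
-- element may join only one side. The processed sides A₀, A₁ are disjoint, so OPT = f(C) ≤ f(A₀ ∪
-- C) + f(A₁ ∪ C). The gains of both unions over f(A₀) + f(A₁) are paid by c + d, and f(A₀) + f(A₁)
-- ≤ f(Q₀) + f(Q₁) + d. As c is about f(Q₀) + f(Q₁), a random side has expected value close to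
-- OPT/4. This exceeds 3 - 2√2 by a margin, so the constant δ = 1/10 is enough and the number of
-- rounds does not depend on ε.
--
-- For the sampled union, ℓ phases build I₁, ..., I_ℓ, each by parallel greedy on F(I) = E f(J₁ ∪
-- ... ∪ J_ℓ) as a function of one set of the family. After k + 1 phases an element lies in the
-- union with probability at most 1 - (1 - 1/ℓ)^(k+1), so adding C to it leaves value at least (1 -
-- 1/ℓ)^(k+1) OPT (`le_sampledUnionValue_union`). The resulting recursion is that of measured
-- continuous greedy and yields 1/e after ℓ phases (`progress_step`). F is replaced by an empirical
-- mean over coin tables drawn once. Hoeffding's inequality and a union bound over all families make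
-- it accurate for every family the adaptive run can meet (`card_not_accurate_le`), and for fixed
-- coins it still has exactly decreasing marginals (`empirical_marginal_le`).
--
-- The value estimate V is the empirical value of the family found, minus its error bound. That V ≤
-- OPT requires F(I) ≤ OPT for independent I_k (`sampledUnionValue_le_optValue`). F is the
-- multilinear extension at a point dominated by an average of bases, and pipage rounding turns that
-- average into one base.

universe u v w

set_option linter.unusedSectionVars false

/-! ### Oracle algorithms with finite coin tosses, and their expectations. -/

/-- An oracle algorithm whose coin tosses are uniform on finite sets, presented as a tree. The
answers of a round are given to the continuation as total functions that vanish outside of the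
queries of that round. -/
inductive Strategy (α : Type u) (γ : Type v)
  | output (b : γ) : Strategy α γ
  | draw (k : ℕ) (next : Fin (k + 1) → Strategy α γ) : Strategy α γ
  | ask (Q : Finset (Finset α)) (P : Finset (Finset α × α))
      (next : (Finset α → ℝ) → (Finset α → α → Bool) → Strategy α γ) : Strategy α γ

namespace Strategy

/-- The restriction of `f` to `Q`, extended by zero. -/
def maskValue {α : Type u} [DecidableEq α] (Q : Finset (Finset α)) (f : Finset α → ℝ) :
    Finset α → ℝ :=
  fun S => if S ∈ Q then f S else 0

/-- The restriction of `s` to `P`, extended by `false`. -/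
def maskSpan {α : Type u} [DecidableEq α] (P : Finset (Finset α × α)) (s : Finset α → α → Bool) :
    Finset α → α → Bool :=
  fun S e => if (S, e) ∈ P then s S e else false

variable {α : Type u} [DecidableEq α] {γ : Type v} {γ' : Type w}

/-- The oracle algorithm described by a strategy. -/
noncomputable def toOracleAlg : Strategy α γ → OracleAlg α γ
  | output b => .output b
  | draw k next => .sample ((PMF.uniformOfFintype (Fin (k + 1))).map Fin.val)
      fun i => toOracleAlg (next (Fin.ofNat (k + 1) i))
  | ask Q P next => .round Q P fun v s =>
      toOracleAlg (next (fun S => if h : S ∈ Q then v ⟨S, h⟩ else 0)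
        fun S e => if h : (S, e) ∈ P then s ⟨(S, e), h⟩ else false)

/-- The expectation of `φ` applied to the output. -/
noncomputable def ev (f : Finset α → ℝ) (s : Finset α → α → Bool) :
    Strategy α γ → (γ → ℝ) → ℝ
  | output b, φ => φ b
  | draw k next, φ => (∑ i, ev f s (next i) φ) / (k + 1)
  | ask Q P next, φ => ev f s (next (maskValue Q f) (maskSpan P s)) φ

/-- All possible outputs have the property `p`. -/
def Surely (f : Finset α → ℝ) (s : Finset α → α → Bool) : Strategy α γ → (γ → Prop) → Prop
  | output b, p => p b
  | draw _ next, p => ∀ i, Surely f s (next i) p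
  | ask Q P next, p => Surely f s (next (maskValue Q f) (maskSpan P s)) p

/-- The number of rounds is at most `r`, whatever the answers. -/
def RoundsLE : Strategy α γ → ℕ → Prop
  | output _, _ => True
  | draw _ next, r => ∀ i, RoundsLE (next i) r
  | ask _ _ _, 0 => False
  | ask _ _ next, r + 1 => ∀ v s, RoundsLE (next v s) r

/-- No round submits more than `q` queries, whatever the answers. -/
def QueriesLE (q : ℝ) : Strategy α γ → Prop
  | output _ => True
  | draw _ next => ∀ i, QueriesLE q (next i)
  | ask Q P next => ((Q.card + P.card : ℕ) : ℝ) ≤ q ∧ ∀ v s, QueriesLE q (next v s)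

/-- Sequential composition. -/
def bind : Strategy α γ → (γ → Strategy α γ') → Strategy α γ'
  | output b, g => g b
  | draw k next, g => draw k fun i => bind (next i) g
  | ask Q P next, g => ask Q P fun v s => bind (next v s) g

variable {f : Finset α → ℝ} {s : Finset α → α → Bool}

lemma ev_bind (A : Strategy α γ) (g : γ → Strategy α γ') (φ : γ' → ℝ) :
    (A.bind g).ev f s φ = A.ev f s fun b => (g b).ev f s φ := by
  induction A with
  | output b => rfl
  | draw k next ih => simp [bind, ev, ih]
  | ask Q P next ih => simp [bind, ev, ih]

lemma surely_bind (A : Strategy α γ) (g : γ → Strategy α γ') (p : γ' → Prop) :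
    (A.bind g).Surely f s p ↔ A.Surely f s fun b => (g b).Surely f s p := by
  induction A with
  | output b => rfl
  | draw k next ih => simp [bind, Surely, ih]
  | ask Q P next ih => simp [bind, Surely, ih]

lemma Surely.mono {A : Strategy α γ} {p q : γ → Prop} (h : A.Surely f s p)
    (hpq : ∀ b, p b → q b) : A.Surely f s q := by
  induction A with
  | output b => exact hpq _ h
  | draw k next ih => exact fun i => ih i (h i)
  | ask Q P next ih => exact ih _ _ h

lemma surely_of_forall {A : Strategy α γ} {p : γ → Prop} (h : ∀ b, p b) : A.Surely f s p := by
  induction A with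
  | output b => exact h _
  | draw k next ih => exact fun i => ih i
  | ask Q P next ih => exact ih _ _

lemma Surely.and {A : Strategy α γ} {p q : γ → Prop} (hp : A.Surely f s p)
    (hq : A.Surely f s q) : A.Surely f s fun b => p b ∧ q b := by
  induction A with
  | output b => exact ⟨hp, hq⟩
  | draw k next ih => exact fun i => ih i (hp i) (hq i)
  | ask Q P next ih => exact ih _ _ hp hq

lemma Surely.bind {A : Strategy α γ} {g : γ → Strategy α γ'} {p : γ → Prop} {q : γ' → Prop}
    (h : A.Surely f s p) (hg : ∀ b, p b → (g b).Surely f s q) : (A.bind g).Surely f s q :=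
  (surely_bind A g q).2 (h.mono hg)

lemma ev_le_ev {A : Strategy α γ} {p : γ → Prop} {φ ψ : γ → ℝ} (h : A.Surely f s p)
    (hle : ∀ b, p b → φ b ≤ ψ b) : A.ev f s φ ≤ A.ev f s ψ := by
  induction A with
  | output b => exact hle _ h
  | draw k next ih =>
    simp only [ev]
    gcongr with i
    exact ih i (h i)
  | ask Q P next ih => exact ih _ _ h

lemma ev_mono {A : Strategy α γ} {φ ψ : γ → ℝ} (hle : ∀ b, φ b ≤ ψ b) :
    A.ev f s φ ≤ A.ev f s ψ :=
  ev_le_ev (p := fun _ => True) (surely_of_forall fun _ => trivial) fun b _ => hle b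

lemma ev_const (A : Strategy α γ) (c : ℝ) : A.ev f s (fun _ => c) = c := by
  induction A with
  | output b => rfl
  | draw k next ih =>
    simp only [ev, ih, Finset.sum_const, Finset.card_univ, Fintype.card_fin, nsmul_eq_mul]
    push_cast
    field_simp
  | ask Q P next ih => exact ih _ _

lemma ev_add (A : Strategy α γ) (φ ψ : γ → ℝ) :
    A.ev f s (fun b => φ b + ψ b) = A.ev f s φ + A.ev f s ψ := by
  induction A with
  | output b => rfl
  | draw k next ih => simp only [ev, ih, Finset.sum_add_distrib, add_div]
  | ask Q P next ih => exact ih _ _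

lemma ev_const_mul (A : Strategy α γ) (c : ℝ) (φ : γ → ℝ) :
    A.ev f s (fun b => c * φ b) = c * A.ev f s φ := by
  induction A with
  | output b => rfl
  | draw k next ih => simp only [ev, ih, ← Finset.mul_sum, mul_div_assoc]
  | ask Q P next ih => exact ih _ _

lemma ev_sum {ι : Type*} (t : Finset ι) (A : Strategy α γ) (φ : ι → γ → ℝ) :
    A.ev f s (fun b => ∑ i ∈ t, φ i b) = ∑ i ∈ t, A.ev f s (φ i) := by
  classical
  induction t using Finset.induction_on with
  | empty => simp [ev_const]
  | insert i t hi ih => simp only [Finset.sum_insert hi, ev_add, ih]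

lemma RoundsLE.mono {A : Strategy α γ} {r r' : ℕ} (h : A.RoundsLE r) (hr : r ≤ r') :
    A.RoundsLE r' := by
  induction A generalizing r r' with
  | output b => trivial
  | draw k next ih => exact fun i => ih i (h i) hr
  | ask Q P next ih =>
    cases r with
    | zero => exact h.elim
    | succ r =>
      obtain ⟨r', rfl⟩ : ∃ k, r' = k + 1 := ⟨r' - 1, by omega⟩
      exact fun v s => ih v s (h v s) (by omega)

lemma RoundsLE.bind {A : Strategy α γ} {g : γ → Strategy α γ'} {r r' : ℕ} (h : A.RoundsLE r)
    (hg : ∀ b, (g b).RoundsLE r') : (A.bind g).RoundsLE (r + r') := by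
  induction A generalizing r with
  | output b => exact (hg b).mono (by omega)
  | draw k next ih => exact fun i => ih i (h i)
  | ask Q P next ih =>
    cases r with
    | zero => exact h.elim
    | succ r =>
      rw [show r + 1 + r' = (r + r') + 1 by omega]
      exact fun v s => ih v s (h v s)

lemma QueriesLE.bind {A : Strategy α γ} {g : γ → Strategy α γ'} {q : ℝ} (h : A.QueriesLE q)
    (hg : ∀ b, (g b).QueriesLE q) : (A.bind g).QueriesLE q := by
  induction A with
  | output b => exact hg b
  | draw k next ih => exact fun i => ih i (h i)
  | ask Q P next ih => exact ⟨h.1, fun v s => ih v s (h.2 v s)⟩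

/-- A query bound must hold for arbitrary answers, whereas `Surely` refers to one oracle. For a
strategy without queries the oracle is irrelevant, so any `f` and `s` will do. This brings the
length of a random ordering into the query count. -/
lemma QueriesLE.bind_of_surely {A : Strategy α γ} {g : γ → Strategy α γ'} {q : ℝ}
    {p : γ → Prop} (h : A.RoundsLE 0) (hp : A.Surely f s p)
    (hg : ∀ b, p b → (g b).QueriesLE q) : (A.bind g).QueriesLE q := by
  induction A with
  | output b => exact hg b hp
  | draw k next ih => exact fun i => ih i (h i) (hp i)
  | ask Q P next ih => exact h.elim

lemma QueriesLE.mono {A : Strategy α γ} {q q' : ℝ} (h : A.QueriesLE q) (hq : q ≤ q') :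
    A.QueriesLE q' := by
  induction A with
  | output b => trivial
  | draw k next ih => exact fun i => ih i (h i)
  | ask Q P next ih => exact ⟨h.1.trans hq, fun v s => ih v s (h.2 v s)⟩

/-- A uniformly random element of a nonempty finite type. -/
noncomputable def uniform (ι : Type*) [Fintype ι] [Nonempty ι] : Strategy α ι :=
  draw (Fintype.card ι - 1) fun i => output ((Fintype.equivFin ι).symm
    (Fin.cast (Nat.sub_add_cancel Fintype.card_pos) i))

lemma ev_uniform (ι : Type*) [Fintype ι] [Nonempty ι] (φ : ι → ℝ) :
    (uniform ι : Strategy α ι).ev f s φ = (∑ i, φ i) / Fintype.card ι := by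
  simp only [uniform, ev]
  congr 1
  · exact Fintype.sum_equiv ((finCongr (Nat.sub_add_cancel Fintype.card_pos)).trans
      (Fintype.equivFin ι).symm) _ _ fun i => rfl
  · exact_mod_cast Nat.sub_add_cancel (Fintype.card_pos (α := ι))

lemma roundsLE_uniform (ι : Type*) [Fintype ι] [Nonempty ι] :
    (uniform ι : Strategy α ι).RoundsLE 0 := fun _ => trivial

lemma queriesLE_uniform (ι : Type*) [Fintype ι] [Nonempty ι] (q : ℝ) :
    (uniform ι : Strategy α ι).QueriesLE q := fun _ => trivial

lemma surely_uniform {ι : Type*} [Fintype ι] [Nonempty ι] {p : ι → Prop} (h : ∀ i, p i) :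
    (uniform ι : Strategy α ι).Surely f s p := fun _ => h _

lemma queriesPerRoundLE_toOracleAlg {A : Strategy α γ} {q : ℝ} (h : A.QueriesLE q) :
    A.toOracleAlg.QueriesPerRoundLE q := by
  induction A with
  | output b => trivial
  | draw k next ih => exact fun i => ih _ (h _)
  | ask Q P next ih => exact ⟨h.1, fun v s => ih _ _ (h.2 _ _)⟩

lemma law_toOracleAlg_ask (M : Matroid α) (f : Finset α → ℝ) (Q P)
    (next : (Finset α → ℝ) → (Finset α → α → Bool) → Strategy α γ) :
    (ask Q P next).toOracleAlg.law M f =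
      ((next (maskValue Q f) (maskSpan P (spanOracle M))).toOracleAlg.law M f).map
        fun x => (x.1, x.2 + 1) := by
  simp only [toOracleAlg, OracleAlg.law]
  congr 4

lemma law_toOracleAlg_draw (M : Matroid α) (f : Finset α → ℝ) (k)
    (next : Fin (k + 1) → Strategy α γ) :
    (draw k next).toOracleAlg.law M f =
      (PMF.uniformOfFintype (Fin (k + 1))).bind fun i => (next i).toOracleAlg.law M f := by
  simp only [toOracleAlg, OracleAlg.law, PMF.bind_map]
  congr 1
  funext i
  simp [Function.comp]

lemma snd_le_of_mem_support_law {A : Strategy α γ} {M : Matroid α} {f : Finset α → ℝ} {r : ℕ}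
    (h : A.RoundsLE r) : ∀ x ∈ (A.toOracleAlg.law M f).support, x.2 ≤ r := by
  induction A generalizing r with
  | output b => simp [toOracleAlg, OracleAlg.law]
  | draw k next ih =>
    intro x hx
    rw [law_toOracleAlg_draw, PMF.mem_support_bind_iff] at hx
    obtain ⟨i, -, hi⟩ := hx
    exact ih i (h i) x hi
  | ask Q P next ih =>
    cases r with
    | zero => exact h.elim
    | succ r =>
      intro x hx
      rw [law_toOracleAlg_ask, PMF.mem_support_map_iff] at hx
      obtain ⟨y, hy, rfl⟩ := hx
      exact Nat.succ_le_succ (ih _ _ (h _ _) y hy)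

lemma expectedRounds_toOracleAlg_le {A : Strategy α γ} (M : Matroid α) (f : Finset α → ℝ) {r : ℕ}
    (h : A.RoundsLE r) : A.toOracleAlg.expectedRounds M f ≤ r := by
  calc A.toOracleAlg.expectedRounds M f
      ≤ ∑' x : γ × ℕ, A.toOracleAlg.law M f x * (r : ℝ≥0∞) := by
        refine ENNReal.tsum_le_tsum fun x => ?_
        by_cases hx : x ∈ (A.toOracleAlg.law M f).support
        · gcongr
          exact snd_le_of_mem_support_law h x hx
        · rw [PMF.mem_support_iff, not_not] at hx
          simp [hx]
    _ = r := by rw [ENNReal.tsum_mul_right, PMF.tsum_coe, one_mul]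

lemma surely_of_mem_support_outputLaw {A : Strategy α γ} {M : Matroid α} {f : Finset α → ℝ}
    {p : γ → Prop} (h : A.Surely f (spanOracle M) p) :
    ∀ b ∈ (A.toOracleAlg.outputLaw M f).support, p b := by
  suffices h' : ∀ x ∈ (A.toOracleAlg.law M f).support, p x.1 by
    intro b hb
    rw [OracleAlg.outputLaw, PMF.mem_support_map_iff] at hb
    obtain ⟨x, hx, rfl⟩ := hb
    exact h' x hx
  induction A with
  | output b =>
    simp only [toOracleAlg, OracleAlg.law, PMF.support_pure, Set.mem_singleton_iff, forall_eq]
    exact h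
  | draw k next ih =>
    intro x hx
    rw [law_toOracleAlg_draw, PMF.mem_support_bind_iff] at hx
    obtain ⟨i, -, hi⟩ := hx
    exact ih i (h i) x hi
  | ask Q P next ih =>
    intro x hx
    rw [law_toOracleAlg_ask, PMF.mem_support_map_iff] at hx
    obtain ⟨y, hy, rfl⟩ := hx
    exact ih _ _ h y hy

-- With `finExpect_outputLaw` this is the bridge from `PMF` to finite averages: every later
-- probability or expectation is a value of `ev`.
open scoped Classical in
lemma toOuterMeasure_outputLaw (A : Strategy α γ) (M : Matroid α) (f : Finset α → ℝ)
    (t : Set γ) :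
    (A.toOracleAlg.outputLaw M f).toOuterMeasure t =
      ENNReal.ofReal (A.ev f (spanOracle M) fun b => if b ∈ t then 1 else 0) := by
  rw [OracleAlg.outputLaw, PMF.toOuterMeasure_map_apply]
  induction A with
  | output b =>
    simp only [toOracleAlg, OracleAlg.law, PMF.toOuterMeasure_pure_apply, ev, Set.mem_preimage]
    split_ifs <;> simp
  | draw k next ih =>
    rw [law_toOracleAlg_draw, PMF.toOuterMeasure_bind_apply, tsum_fintype]
    simp only [ih, PMF.uniformOfFintype_apply, Fintype.card_fin, ev]
    rw [← Finset.mul_sum, ← ENNReal.ofReal_sum_of_nonneg, div_eq_inv_mul,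
      ENNReal.ofReal_mul (by positivity), ENNReal.ofReal_inv_of_pos (by positivity)]
    · congr 2
      rw [← Nat.cast_succ, ENNReal.ofReal_natCast]
    · intro i _
      calc (0 : ℝ) = (next i).ev f (spanOracle M) fun _ => 0 := (ev_const _ _).symm
        _ ≤ _ := ev_mono fun b => by split_ifs <;> norm_num
  | ask Q P next ih =>
    rw [law_toOracleAlg_ask, PMF.toOuterMeasure_map_apply]
    exact ih _ _

lemma finExpect_outputLaw [Fintype γ] (A : Strategy α γ) (M : Matroid α) (f : Finset α → ℝ)
    (φ : γ → ℝ) :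
    finExpect (A.toOracleAlg.outputLaw M f) φ = A.ev f (spanOracle M) φ := by
  classical
  have h1 : ∀ b, (A.toOracleAlg.outputLaw M f b).toReal =
      A.ev f (spanOracle M) fun x => if x = b then 1 else 0 := by
    intro b
    rw [← PMF.toOuterMeasure_apply_singleton, toOuterMeasure_outputLaw, ENNReal.toReal_ofReal]
    · simp
    · calc (0 : ℝ) = A.ev f (spanOracle M) fun _ => 0 := (ev_const _ _).symm
        _ ≤ _ := ev_mono fun b => by split_ifs <;> norm_num
  simp only [finExpect, h1]
  have h2 : φ = fun x => ∑ b, φ b * if x = b then 1 else 0 := by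
    funext x
    simp
  conv_rhs => rw [h2]
  rw [ev_sum]
  refine Finset.sum_congr rfl fun b _ => ?_
  rw [ev_const_mul, mul_comm]

/-- Running a list of transitions of a state one after the other. -/
def chain {σ : Type*} : List (σ → Strategy α σ) → σ → Strategy α σ
  | [], a => output a
  | g :: gs, a => (g a).bind (chain gs)

lemma ev_chain_le {σ : Type*} {I : σ → Prop} {φ : σ → ℝ} {gs : List (σ → Strategy α σ)}
    (h : ∀ g ∈ gs, ∀ a, I a → (g a).Surely f s I)
    (hφ : ∀ g ∈ gs, ∀ a, I a → (g a).ev f s φ ≤ φ a) {a : σ} (ha : I a) :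
    (chain gs a).ev f s φ ≤ φ a := by
  induction gs generalizing a with
  | nil => exact le_rfl
  | cons g gs ih =>
    rw [chain, ev_bind]
    exact (ev_le_ev (h g (by simp) a ha) fun b hb => ih (fun g hg => h g (by simp [hg]))
      (fun g hg => hφ g (by simp [hg])) hb).trans (hφ g (by simp) a ha)

lemma roundsLE_chain {σ : Type*} {r : ℕ} {gs : List (σ → Strategy α σ)}
    (h : ∀ g ∈ gs, ∀ a, (g a).RoundsLE r) (a : σ) : (chain gs a).RoundsLE (gs.length * r) := by
  induction gs generalizing a with
  | nil => trivial
  | cons g gs ih =>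
    exact ((h g (by simp) a).bind fun b => ih (fun g hg => h g (by simp [hg])) b).mono
      (by rw [List.length_cons]; ring_nf; exact le_rfl)

lemma queriesLE_chain {σ : Type*} {q : ℝ} {gs : List (σ → Strategy α σ)}
    (h : ∀ g ∈ gs, ∀ a, (g a).QueriesLE q) (a : σ) : (chain gs a).QueriesLE q := by
  induction gs generalizing a with
  | nil => trivial
  | cons g gs ih =>
    exact (h g (by simp) a).bind fun b => ih (fun g hg => h g (by simp [hg])) b

end Strategy

/-! ### Parallel greedy selection on a table of decreasing values. -/

/-- A table of numbers `u S x`, one for each set `S` and element `x` of `β`, every entry of which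
can be computed from a few values of the function and a few answers of the span oracle on `α`. -/
structure Probe (α : Type u) (β : Type v) where
  /-- the table -/
  val : (Finset α → ℝ) → (Finset α → α → Bool) → Finset β → β → ℝ
  /-- the value queries needed for an entry -/
  valueQueries : Finset β → β → Finset (Finset α)
  /-- the span queries needed for an entry -/
  spanQueries : Finset β → β → Finset (Finset α × α)
  val_congr : ∀ {f f' : Finset α → ℝ} {s s' : Finset α → α → Bool} {S : Finset β} {x : β},
    (∀ T ∈ valueQueries S x, f T = f' T) → (∀ q ∈ spanQueries S x, s q.1 q.2 = s' q.1 q.2) →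
    val f s S x = val f' s' S x

/-- The state of the parallel greedy algorithm: the set `A` of all processed elements, the set `Q`
of the processed elements that were accepted, and the total weights `c` of the accepted and `d` of
the rejected elements. -/
structure GreedyState (β : Type v) where
  A : Finset β
  Q : Finset β
  c : ℝ
  d : ℝ

open scoped Classical in
/-- Process the element `a` with weight `μ`; it is accepted if `good` holds. -/
noncomputable def GreedyState.add {β : Type v} [DecidableEq β] (s : GreedyState β) (good : Prop)
    (μ : ℝ) (a : β) : GreedyState β :=
  if good then ⟨insert a s.A, insert a s.Q, s.c + μ, s.d⟩ else ⟨insert a s.A, s.Q, s.c, s.d + μ⟩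

namespace ParallelGreedy

open Strategy

section
variable {β : Type v} [DecidableEq β] (u : Finset β → β → ℝ)

/-- The elements of `D` whose value at `A` is at least `r`. -/
noncomputable def live (D : Finset β) (r : ℝ) (A : Finset β) : Finset β :=
  D.filter fun x => r ≤ u A x

/-- Process the elements of a list one by one, until at most `(1 - δ) N` live elements are left. -/
noncomputable def process (δ : ℝ) (D : Finset β) (μ : ℝ) (N : ℕ) :
    List β → GreedyState β → GreedyState β
  | [], s => s
  | a :: l, s =>
    if ((live u D ((1 - δ) * μ) s.A).card : ℝ) ≤ (1 - δ) * N then s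
    else process δ D μ N l (s.add ((1 - δ) * μ ≤ u s.A a) μ a)

/-- The maximum of `θ` and of all values at `A`. -/
noncomputable def topValue [Fintype β] (θ : ℝ) (A : Finset β) : ℝ :=
  Finset.univ.fold max θ (u A)

/-- The sets obtained from `A` by adding the prefixes of a list. -/
def prefixes : List β → Finset β → Finset (Finset β)
  | [], A => {A}
  | a :: l, A => insert A (prefixes l (insert a A))

lemma card_prefixes_le (l : List β) (A : Finset β) : (prefixes l A).card ≤ l.length + 1 := by
  induction l generalizing A with
  | nil => simp [prefixes]
  | cons a l ih => exact (Finset.card_insert_le _ _).trans (Nat.succ_le_succ (ih _))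

lemma self_mem_prefixes (l : List β) (A : Finset β) : A ∈ prefixes l A := by
  cases l <;> simp [prefixes]

lemma add_A (s : GreedyState β) (g : Prop) (μ : ℝ) (a : β) : (s.add g μ a).A = insert a s.A := by
  unfold GreedyState.add
  split_ifs <;> rfl

lemma add_c_add_d (s : GreedyState β) (g : Prop) (μ : ℝ) (a : β) :
    (s.add g μ a).c + (s.add g μ a).d = s.c + s.d + μ := by
  unfold GreedyState.add
  split_ifs
  · exact add_right_comm _ _ _
  · exact (add_assoc _ _ _).symm

/-- Rejected elements also enter `A`, so the sets met on the way are prefixes of the ordering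
whatever is accepted. Hence all needed entries can be asked for in a single round. -/
lemma process_congr {u u' : Finset β → β → ℝ} {δ : ℝ} {D : Finset β} {μ : ℝ} {N : ℕ}
    (l : List β) (s : GreedyState β) (h : ∀ S ∈ prefixes l s.A, u S = u' S) :
    process u δ D μ N l s = process u' δ D μ N l s := by
  induction l generalizing s with
  | nil => rfl
  | cons a l ih =>
    have hs : u s.A = u' s.A := h _ (self_mem_prefixes _ _)
    simp only [process, live, hs]
    congr 1
    refine ih _ fun S hS => h S ?_
    rw [add_A] at hS
    exact Finset.mem_insert_of_mem hS

variable {u}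

lemma le_topValue [Fintype β] (θ : ℝ) (A : Finset β) (x : β) : u A x ≤ topValue u θ A :=
  (Finset.le_fold_max _).2 (Or.inr ⟨x, Finset.mem_univ x, le_rfl⟩)

lemma base_le_topValue [Fintype β] (θ : ℝ) (A : Finset β) : θ ≤ topValue u θ A :=
  (Finset.le_fold_max _).2 (Or.inl le_rfl)

lemma topValue_le [Fintype β] {θ : ℝ} {A : Finset β} {c : ℝ} (hθ : θ ≤ c) (h : ∀ x, u A x ≤ c) :
    topValue u θ A ≤ c :=
  (Finset.fold_max_le _).2 ⟨hθ, fun x _ => h x⟩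

end

section
variable {α : Type u} [DecidableEq α] {β : Type v} [DecidableEq β]

/-- A uniformly random ordering of (at most `k` elements of) a finite set. -/
noncomputable def shuffle : ℕ → Finset β → Strategy α (List β)
  | 0, _ => output []
  | k + 1, X =>
    open scoped Classical in
    if h : X.Nonempty then
      haveI : Nonempty X := h.to_subtype
      (uniform X).bind fun a => (shuffle k (X.erase a)).bind fun l => output (a.1 :: l)
    else output []

variable {f : Finset α → ℝ} {s : Finset α → α → Bool}

lemma ev_shuffle {k : ℕ} {X : Finset β} (hX : X.Nonempty) (φ : List β → ℝ) :
    (shuffle (k + 1) X : Strategy α (List β)).ev f s φ =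
      (∑ a ∈ X, (shuffle k (X.erase a) : Strategy α (List β)).ev f s fun l => φ (a :: l)) /
        X.card := by
  have : Nonempty X := hX.to_subtype
  rw [shuffle, dif_pos hX, ev_bind, ev_uniform]
  simp only [ev_bind, ev]
  rw [Fintype.card_coe]
  congr 1
  exact Finset.sum_coe_sort X fun a =>
    (shuffle k (X.erase a) : Strategy α (List β)).ev f s fun l => φ (a :: l)

lemma surely_shuffle {k : ℕ} {X : Finset β} {p : List β → Prop}
    (h0 : X = ∅ → p []) (hX : ∀ a ∈ X, (shuffle k (X.erase a) : Strategy α (List β)).Surely f s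
      fun l => p (a :: l)) :
    (shuffle (k + 1) X : Strategy α (List β)).Surely f s p := by
  rw [shuffle]
  split_ifs with h
  · have : Nonempty X := h.to_subtype
    exact (surely_uniform (p := fun _ => True) fun _ => trivial).bind fun a _ =>
      (hX a.1 a.2).bind fun l hl => hl
  · exact h0 (Finset.not_nonempty_iff_eq_empty.1 h)

lemma roundsLE_shuffle (k : ℕ) (X : Finset β) :
    (shuffle k X : Strategy α (List β)).RoundsLE 0 := by
  induction k generalizing X with
  | zero => trivial
  | succ k ih =>
    rw [shuffle]
    split_ifs with h
    · have : Nonempty X := h.to_subtype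
      exact (roundsLE_uniform X).bind fun a => (ih _).bind (r' := 0)
        (g := fun l => output (a.1 :: l)) fun _ => trivial
    · trivial

lemma surely_length_shuffle (k : ℕ) (X : Finset β) :
    (shuffle k X : Strategy α (List β)).Surely f s fun l => l.length ≤ k := by
  induction k generalizing X with
  | zero => exact Nat.le_refl 0
  | succ k ih =>
    exact surely_shuffle (fun _ => Nat.zero_le _) fun a _ => (ih _).mono fun l hl =>
      Nat.succ_le_succ hl

variable {u : Finset β → β → ℝ} {δ μ : ℝ} {D : Finset β}

/-- Values decrease when the set grows, as long as they are nonnegative, and the values of elements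
of the set are negative. -/
structure IsDecreasing (u : Finset β → β → ℝ) : Prop where
  le_of_subset : ∀ {A B : Finset β} {x : β}, A ⊆ B → 0 ≤ u B x → u B x ≤ u A x
  neg_of_mem : ∀ {A : Finset β} {x : β}, x ∈ A → u A x < 0

lemma live_subset_live (hu : IsDecreasing u) {r : ℝ} (hr : 0 ≤ r) {A B : Finset β} (h : A ⊆ B) :
    live u D r B ⊆ live u D r A := by
  intro x hx
  simp only [live, Finset.mem_filter] at hx ⊢
  exact ⟨hx.1, hx.2.trans (hu.le_of_subset h (hr.trans hx.2))⟩

lemma live_insert_subset_erase (hu : IsDecreasing u) {r : ℝ} (hr : 0 ≤ r) {A X : Finset β} (a : β)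
    (h : live u D r A ⊆ X) : live u D r (insert a A) ⊆ X.erase a := by
  intro x hx
  refine Finset.mem_erase.2 ⟨?_, h (live_subset_live hu hr (Finset.subset_insert _ _) hx)⟩
  rintro rfl
  have h1 := (Finset.mem_filter.1 hx).2
  have h2 := hu.neg_of_mem (Finset.mem_insert_self x A)
  linarith

/-- In expectation, at most a `δ`-fraction of the processed weight is rejected. -/
lemma ev_shuffle_process_le (hu : IsDecreasing u) (hδ : δ ≤ 1) (hμ : 0 ≤ μ) {N k : ℕ}
    {X : Finset β} (hk : X.card ≤ k) (hN : X.card ≤ N) (hXD : X ⊆ D) (t : GreedyState β)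
    (hX : live u D ((1 - δ) * μ) t.A ⊆ X) :
    (shuffle k X : Strategy α (List β)).ev f s (fun l =>
      (1 - δ) * (process u δ D μ N l t).d - δ * (process u δ D μ N l t).c) ≤
      (1 - δ) * t.d - δ * t.c := by
  have hr : 0 ≤ (1 - δ) * μ := mul_nonneg (by linarith) hμ
  induction k generalizing X t with
  | zero => simp [shuffle, ev, process]
  | succ k ih =>
    rcases X.eq_empty_or_nonempty with rfl | hne
    · simp [shuffle, ev, process]
    have hcard : (0 : ℝ) < X.card := by exact_mod_cast hne.card_pos
    rw [ev_shuffle hne, div_le_iff₀ hcard]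
    by_cases hfew : ((live u D ((1 - δ) * μ) t.A).card : ℝ) ≤ (1 - δ) * N
    · simp only [process, if_pos hfew, ev_const, Finset.sum_const, nsmul_eq_mul]
      linarith
    simp only [process, if_neg hfew]
    push Not at hfew
    have hstep : ∀ a ∈ X, (shuffle k (X.erase a) : Strategy α (List β)).ev f s (fun l =>
        (1 - δ) * (process u δ D μ N l (t.add ((1 - δ) * μ ≤ u t.A a) μ a)).d -
          δ * (process u δ D μ N l (t.add ((1 - δ) * μ ≤ u t.A a) μ a)).c) ≤
        (1 - δ) * t.d - δ * t.c + (1 - δ) * μ - if (1 - δ) * μ ≤ u t.A a then μ else 0 := by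
      intro a ha
      have hc := Finset.card_erase_lt_of_mem ha
      refine (ih (by omega) (by omega) ((Finset.erase_subset _ _).trans hXD) _ ?_).trans ?_
      · rw [add_A]
        exact live_insert_subset_erase hu hr a hX
      · unfold GreedyState.add
        split_ifs <;> simp only <;> linarith
    -- More than (1 - δ)N ≥ (1 - δ)|X| elements are live and all of them lie in `X`, so the average
    -- over the next element of the accepted weight is at least (1 - δ)μ. This cancels the term (1 -
    -- δ)μ in `hstep`.
    refine (Finset.sum_le_sum hstep).trans ?_
    rw [Finset.sum_sub_distrib, Finset.sum_const, ← Finset.sum_filter, Finset.sum_const,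
      nsmul_eq_mul, nsmul_eq_mul]
    have hlive : X.filter (fun a => (1 - δ) * μ ≤ u t.A a) = live u D ((1 - δ) * μ) t.A := by
      ext a
      simp only [live, Finset.mem_filter]
      exact ⟨fun h => ⟨hXD h.1, h.2⟩, fun h => ⟨hX (Finset.mem_filter.2 h), h.2⟩⟩
    rw [hlive]
    have h1 : (1 - δ) * (X.card : ℝ) ≤ (1 - δ) * N :=
      mul_le_mul_of_nonneg_left (by exact_mod_cast hN) (by linarith)
    have h2 := mul_le_mul_of_nonneg_right (h1.trans hfew.le) hμ
    linarith

/-- Live elements always lie in the unprocessed remainder `X`. Either the stopping test succeeds, or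
the ordering is exhausted and no live element is left. -/
lemma surely_card_live_process (hu : IsDecreasing u) (hδ : δ ≤ 1) (hμ : 0 ≤ μ) {N k : ℕ}
    {X : Finset β} (hk : X.card ≤ k) (t : GreedyState β)
    (hX : live u D ((1 - δ) * μ) t.A ⊆ X) :
    (shuffle k X : Strategy α (List β)).Surely f s (fun l =>
      ((live u D ((1 - δ) * μ) (process u δ D μ N l t).A).card : ℝ) ≤ (1 - δ) * N) := by
  have hr : 0 ≤ (1 - δ) * μ := mul_nonneg (by linarith) hμ
  have h0 : ∀ {X : Finset β} {t : GreedyState β}, X = ∅ → live u D ((1 - δ) * μ) t.A ⊆ X →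
      ((live u D ((1 - δ) * μ) t.A).card : ℝ) ≤ (1 - δ) * N := by
    intro X t hX h
    rw [hX, Finset.subset_empty] at h
    rw [h]
    exact (by simpa using mul_nonneg (sub_nonneg.2 hδ) (Nat.cast_nonneg N))
  induction k generalizing X t with
  | zero => exact h0 (Finset.card_eq_zero.1 (by omega)) hX
  | succ k ih =>
    refine surely_shuffle (fun h => h0 h hX) fun a ha => ?_
    simp only [process]
    split_ifs with hfew
    · exact surely_of_forall fun _ => hfew
    · have hc := Finset.card_erase_lt_of_mem ha
      refine ih (by omega) _ ?_
      rw [add_A]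
      exact live_insert_subset_erase hu hr a hX

/-- The element `a` may be processed at `A` with weight `μ`: it had a value between `0` and `μ` at a
subset of `A` from which `A` was obtained by processing elements of a set `D` that contains `a`. -/
def Admissible (u : Finset β → β → ℝ) (Ds : List (Finset β)) (μ : ℝ) (A : Finset β) (a : β) :
    Prop :=
  a ∉ A ∧ ∃ D ∈ Ds, ∃ B ⊆ A, A \ B ⊆ D ∧ a ∈ D ∧ 0 ≤ u B a ∧ u B a ≤ μ

/-- The property `I` of states is preserved by processing an element with weight `μ`. -/
def Preserved (u : Finset β → β → ℝ) (δ : ℝ) (Ds : List (Finset β)) (μ : ℝ)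
    (I : GreedyState β → Prop) : Prop :=
  ∀ t a, Admissible u Ds μ t.A a → I t → I (t.add ((1 - δ) * μ ≤ u t.A a) μ a)

/-- The witness `B` of admissibility is the set at the start of the step, where all of `X` was
measured, and not the current set. It bounds the marginals of rejected elements too, whose current
value may be that of a blocked element. -/
lemma surely_process {Ds : List (Finset β)} {I : GreedyState β → Prop}
    (hI : Preserved u δ Ds μ I) (hD : D ∈ Ds) {N k : ℕ} {B X : Finset β}
    (hX : ∀ a ∈ X, a ∈ D ∧ 0 ≤ u B a ∧ u B a ≤ μ) (t : GreedyState β) (ht : I t) (hB : B ⊆ t.A)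
    (htB : t.A \ B ⊆ D) (hdis : Disjoint X t.A) :
    (shuffle k X : Strategy α (List β)).Surely f s (fun l => I (process u δ D μ N l t)) := by
  induction k generalizing X t with
  | zero => exact ht
  | succ k ih =>
    refine surely_shuffle (fun _ => ht) fun a ha => ?_
    simp only [process]
    split_ifs with hfew
    · exact surely_of_forall fun _ => ht
    · refine ih (fun b hb => hX b (Finset.mem_of_mem_erase hb)) _ (hI t a
        ⟨Finset.disjoint_left.1 hdis ha, D, hD, B, hB, htB, hX a ha⟩ ht) ?_ ?_ ?_
      · rw [add_A]
        exact hB.trans (Finset.subset_insert _ _)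
      · rw [add_A]
        intro x hx
        rw [Finset.mem_sdiff, Finset.mem_insert] at hx
        rcases hx.1 with rfl | h
        · exact (hX x ha).1
        · exact htB (Finset.mem_sdiff.2 ⟨h, hx.2⟩)
      · rw [add_A, Finset.disjoint_insert_right]
        exact ⟨Finset.notMem_erase a X, hdis.mono_left (Finset.erase_subset _ _)⟩

end

section
variable {α : Type u} [DecidableEq α] {β : Type v} [DecidableEq β] [Fintype β] (p : Probe α β)

/-- The table of a probe, computed from the answers to all queries for the sets of `L`. -/
def askProbe (L : Finset (Finset β)) : Strategy α (Finset β → β → ℝ) :=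
  ask (L.biUnion fun S => Finset.univ.biUnion (p.valueQueries S))
    (L.biUnion fun S => Finset.univ.biUnion (p.spanQueries S)) fun v s => output (p.val v s)

/-- One step: find the live elements, order them at random, and process a prefix of them. -/
noncomputable def step (δ : ℝ) (D : Finset β) (μ : ℝ) (t : GreedyState β) :
    Strategy α (GreedyState β) :=
  (askProbe p {t.A}).bind fun u =>
    (shuffle (live u D ((1 - δ) * μ) t.A).card (live u D ((1 - δ) * μ) t.A)).bind fun l =>
      (askProbe p (prefixes l t.A)).bind fun u' =>
        output (process u' δ D μ (live u D ((1 - δ) * μ) t.A).card l t)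

/-- One stage: `L` steps for each of the sets in `Ds`, with the current maximal value. -/
noncomputable def stage (δ θ : ℝ) (L : ℕ) (Ds : List (Finset β)) (t : GreedyState β) :
    Strategy α (GreedyState β) :=
  (askProbe p {t.A}).bind fun u =>
    chain (Ds.map fun D => chain (List.replicate L (step p δ D (topValue u θ t.A)))) t

/-- The parallel greedy algorithm: `T` stages. -/
noncomputable def greedy (δ θ : ℝ) (L T : ℕ) (Ds : List (Finset β)) :
    Strategy α (GreedyState β) :=
  chain (List.replicate T (stage p δ θ L Ds)) ⟨∅, ∅, 0, 0⟩

variable {p} {f : Finset α → ℝ} {s : Finset α → α → Bool}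

lemma val_mask {L : Finset (Finset β)} {S : Finset β} (hS : S ∈ L) :
    p.val (maskValue (L.biUnion fun S => Finset.univ.biUnion (p.valueQueries S)) f)
      (maskSpan (L.biUnion fun S => Finset.univ.biUnion (p.spanQueries S)) s) S = p.val f s S := by
  funext x
  refine p.val_congr (fun T hT => if_pos ?_) fun q hq => if_pos ?_
  · exact Finset.mem_biUnion.2 ⟨S, hS, Finset.mem_biUnion.2 ⟨x, Finset.mem_univ x, hT⟩⟩
  · exact Finset.mem_biUnion.2 ⟨S, hS, Finset.mem_biUnion.2 ⟨x, Finset.mem_univ x, hq⟩⟩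

/-- The effect of a step, in terms of the full table. -/
noncomputable def idealStep (u : Finset β → β → ℝ) (δ : ℝ) (D : Finset β) (μ : ℝ)
    (t : GreedyState β) : Strategy α (GreedyState β) :=
  (shuffle (live u D ((1 - δ) * μ) t.A).card (live u D ((1 - δ) * μ) t.A)).bind fun l =>
    output (process u δ D μ (live u D ((1 - δ) * μ) t.A).card l t)

lemma process_mask (δ : ℝ) (D : Finset β) (μ : ℝ) (N : ℕ) (l : List β) (t : GreedyState β) :
    process (p.val (maskValue ((prefixes l t.A).biUnion fun S =>
      Finset.univ.biUnion (p.valueQueries S)) f) (maskSpan ((prefixes l t.A).biUnion fun S =>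
      Finset.univ.biUnion (p.spanQueries S)) s)) δ D μ N l t = process (p.val f s) δ D μ N l t :=
  process_congr l t fun _ hS => val_mask hS

lemma live_mask (D : Finset β) (r : ℝ) (A : Finset β) :
    live (p.val (maskValue (({A} : Finset (Finset β)).biUnion fun S =>
      Finset.univ.biUnion (p.valueQueries S)) f) (maskSpan (({A} : Finset (Finset β)).biUnion
      fun S => Finset.univ.biUnion (p.spanQueries S)) s)) D r A = live (p.val f s) D r A := by
  simp only [live, val_mask (p := p) (f := f) (s := s) (Finset.mem_singleton_self A)]

lemma ev_step (δ : ℝ) (D : Finset β) (μ : ℝ) (t : GreedyState β) (φ : GreedyState β → ℝ) :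
    (step p δ D μ t).ev f s φ = (idealStep (p.val f s) δ D μ t).ev f s φ := by
  simp only [step, idealStep, askProbe, ev_bind, Strategy.ev, process_mask, live_mask]

lemma surely_step (δ : ℝ) (D : Finset β) (μ : ℝ) (t : GreedyState β) (I : GreedyState β → Prop) :
    (step p δ D μ t).Surely f s I ↔ (idealStep (p.val f s) δ D μ t).Surely f s I := by
  simp only [step, idealStep, askProbe, surely_bind, Strategy.Surely, process_mask, live_mask]

lemma topValue_mask (θ : ℝ) (A : Finset β) :
    topValue (p.val (maskValue (({A} : Finset (Finset β)).biUnion fun S =>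
      Finset.univ.biUnion (p.valueQueries S)) f) (maskSpan (({A} : Finset (Finset β)).biUnion
      fun S => Finset.univ.biUnion (p.spanQueries S)) s)) θ A = topValue (p.val f s) θ A := by
  simp only [topValue, val_mask (p := p) (f := f) (s := s) (Finset.mem_singleton_self A)]

lemma ev_stage (δ θ : ℝ) (L : ℕ) (Ds : List (Finset β)) (t : GreedyState β)
    (φ : GreedyState β → ℝ) :
    (stage p δ θ L Ds t).ev f s φ = (chain (Ds.map fun D => chain (List.replicate L
      (step p δ D (topValue (p.val f s) θ t.A)))) t).ev f s φ := by
  simp only [stage, askProbe, ev_bind, Strategy.ev, topValue_mask]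

lemma surely_stage (δ θ : ℝ) (L : ℕ) (Ds : List (Finset β)) (t : GreedyState β)
    (I : GreedyState β → Prop) :
    (stage p δ θ L Ds t).Surely f s I ↔ (chain (Ds.map fun D => chain (List.replicate L
      (step p δ D (topValue (p.val f s) θ t.A)))) t).Surely f s I := by
  simp only [stage, askProbe, surely_bind, Strategy.Surely, topValue_mask]

section
variable {δ θ μ : ℝ} {D : Finset β} {Ds : List (Finset β)} {I : GreedyState β → Prop}

lemma ev_step_le (hu : IsDecreasing (p.val f s)) (hδ : δ ≤ 1) (hμ : 0 ≤ μ) (D : Finset β)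
    (t : GreedyState β) :
    (step p δ D μ t).ev f s (fun t => (1 - δ) * t.d - δ * t.c) ≤ (1 - δ) * t.d - δ * t.c := by
  rw [ev_step, idealStep, ev_bind]
  exact ev_shuffle_process_le hu hδ hμ le_rfl le_rfl (Finset.filter_subset _ _) t subset_rfl

lemma surely_step_card (hu : IsDecreasing (p.val f s)) (hδ : δ ≤ 1) (hμ : 0 ≤ μ) (D : Finset β)
    (t : GreedyState β) :
    (step p δ D μ t).Surely f s fun t' => ((live (p.val f s) D ((1 - δ) * μ) t'.A).card : ℝ) ≤
      (1 - δ) * (live (p.val f s) D ((1 - δ) * μ) t.A).card := by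
  rw [surely_step, idealStep, surely_bind]
  exact surely_card_live_process hu hδ hμ le_rfl t subset_rfl

lemma surely_step_of_preserved (hu : IsDecreasing (p.val f s)) (hδ : δ ≤ 1) (hμ : 0 ≤ μ)
    (hI : Preserved (p.val f s) δ Ds μ I) (hD : D ∈ Ds) (t : GreedyState β)
    (htop : ∀ x, p.val f s t.A x ≤ μ) (ht : I t) : (step p δ D μ t).Surely f s I := by
  rw [surely_step, idealStep, surely_bind]
  have hr : 0 ≤ (1 - δ) * μ := mul_nonneg (by linarith) hμ
  refine surely_process hI hD (B := t.A) (fun a ha => ?_) t ht subset_rfl (by simp) ?_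
  · obtain ⟨h1, h2⟩ := Finset.mem_filter.1 ha
    exact ⟨h1, hr.trans h2, htop a⟩
  · refine Finset.disjoint_left.2 fun a ha ha' => ?_
    have := hu.neg_of_mem ha'
    have := (Finset.mem_filter.1 ha).2
    linarith

lemma preserved_and {J : GreedyState β → Prop} {u : Finset β → β → ℝ}
    (hI : Preserved u δ Ds μ I) (hJ : Preserved u δ Ds μ J) :
    Preserved u δ Ds μ fun t => I t ∧ J t :=
  fun t a h ht => ⟨hI t a h ht.1, hJ t a h ht.2⟩

/-- An admissible element is new, and all elements of a stage carry the same weight `μ`, accepted or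
not. -/
lemma preserved_weight (u : Finset β → β → ℝ) (t₀ : GreedyState β) :
    Preserved u δ Ds μ fun t => t₀.A ⊆ t.A ∧
      t.c + t.d = t₀.c + t₀.d + μ * (t.A.card - t₀.A.card) := by
  intro t a ha ht
  rw [add_A, add_c_add_d, Finset.card_insert_of_notMem ha.1, ht.2]
  refine ⟨ht.1.trans (Finset.subset_insert _ _), ?_⟩
  push_cast
  ring

lemma le_of_subset (hu : IsDecreasing (p.val f s)) (hμ : 0 ≤ μ) {A B : Finset β} (hAB : A ⊆ B)
    (h : ∀ x, p.val f s A x ≤ μ) (x : β) : p.val f s B x ≤ μ := by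
  rcases lt_or_ge (p.val f s B x) 0 with h0 | h0
  · linarith
  · exact (hu.le_of_subset hAB h0).trans (h x)

/-- `L` steps for the same set `D`. -/
lemma surely_steps (hu : IsDecreasing (p.val f s)) (hδ : δ ≤ 1) (hμ : 0 ≤ μ)
    (hI : Preserved (p.val f s) δ Ds μ I) (hD : D ∈ Ds) (L : ℕ) (t : GreedyState β)
    (htop : ∀ x, p.val f s t.A x ≤ μ) (ht : I t) :
    (chain (List.replicate L (step p δ D μ)) t).Surely f s fun t' => I t' ∧ t.A ⊆ t'.A ∧
      ((live (p.val f s) D ((1 - δ) * μ) t'.A).card : ℝ) ≤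
        (1 - δ) ^ L * (live (p.val f s) D ((1 - δ) * μ) t.A).card := by
  induction L generalizing t with
  | zero => exact ⟨ht, subset_rfl, by simp⟩
  | succ L ih =>
    rw [List.replicate_succ]
    have h1 := surely_step_of_preserved hu hδ hμ
      (preserved_and hI (preserved_weight (p.val f s) t)) hD t htop ⟨ht, subset_rfl, by simp⟩
    refine (h1.and (surely_step_card hu hδ hμ D t)).bind fun t' ht' => ?_
    refine (ih t' (le_of_subset hu hμ ht'.1.2.1 htop) ht'.1.1).mono fun t'' ht'' =>
      ⟨ht''.1, ht'.1.2.1.trans ht''.2.1, ht''.2.2.trans ?_⟩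
    rw [pow_succ, mul_assoc]
    exact mul_le_mul_of_nonneg_left ht'.2 (pow_nonneg (by linarith) _)

/-- Once the live part of a set is empty it stays empty while `A` grows, so the sets of the list can
be treated one after another. -/
lemma surely_stage_aux (hu : IsDecreasing (p.val f s)) (hδ : δ ≤ 1) (hμ : 0 ≤ μ)
    (hI : Preserved (p.val f s) δ Ds μ I) {L : ℕ} (hL : (1 - δ) ^ L * Fintype.card β < 1)
    (Es : List (Finset β)) (hEs : ∀ D ∈ Es, D ∈ Ds) (t : GreedyState β)
    (htop : ∀ x, p.val f s t.A x ≤ μ) (ht : I t) :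
    (chain (Es.map fun D => chain (List.replicate L (step p δ D μ))) t).Surely f s fun t' =>
      I t' ∧ t.A ⊆ t'.A ∧ ∀ D ∈ Es, live (p.val f s) D ((1 - δ) * μ) t'.A = ∅ := by
  induction Es generalizing t with
  | nil => exact ⟨ht, subset_rfl, by simp⟩
  | cons D Es ih =>
    rw [List.map_cons]
    refine (surely_steps hu hδ hμ hI (hEs D (by simp)) L t htop ht).bind fun t' ht' => ?_
    refine (ih (fun E hE => hEs E (by simp [hE])) t' (le_of_subset hu hμ ht'.2.1 htop)
      ht'.1).mono fun t'' ht'' => ⟨ht''.1, ht'.2.1.trans ht''.2.1, ?_⟩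
    -- After `L` steps the number of live elements is below 1.
    have h0 : live (p.val f s) D ((1 - δ) * μ) t'.A = ∅ := by
      rw [← Finset.card_eq_zero, ← Nat.lt_one_iff, ← Nat.cast_lt (α := ℝ), Nat.cast_one]
      refine (ht'.2.2.trans ?_).trans_lt hL
      refine mul_le_mul_of_nonneg_left ?_ (pow_nonneg (by linarith) _)
      exact_mod_cast Finset.card_le_univ _
    intro E hE
    rcases List.mem_cons.1 hE with rfl | hE
    · exact Finset.subset_empty.1 ((live_subset_live hu (mul_nonneg (by linarith) hμ)
        ht''.2.1).trans h0.subset)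
    · exact ht''.2.2 E hE

lemma surely_stage_spec (hu : IsDecreasing (p.val f s)) (hδ : δ ≤ 1) (hθ : 0 ≤ θ)
    (hI : ∀ μ, θ ≤ μ → Preserved (p.val f s) δ Ds μ I) {L : ℕ}
    (hL : (1 - δ) ^ L * Fintype.card β < 1) (hDs : ∀ x, ∃ D ∈ Ds, x ∈ D) (t : GreedyState β)
    (ht : I t) :
    (stage p δ θ L Ds t).Surely f s fun t' => I t' ∧ t.A ⊆ t'.A ∧
      t'.c + t'.d = t.c + t.d + topValue (p.val f s) θ t.A * (t'.A.card - t.A.card) ∧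
      ∀ x, p.val f s t'.A x < (1 - δ) * topValue (p.val f s) θ t.A := by
  rw [surely_stage]
  have hμ := base_le_topValue (u := p.val f s) θ t.A
  refine (surely_stage_aux hu hδ (hθ.trans hμ) (preserved_and (hI _ hμ)
    (preserved_weight (p.val f s) t)) hL Ds (fun D hD => hD) t (le_topValue θ t.A)
    ⟨ht, subset_rfl, by simp⟩).mono fun t' ht' => ⟨ht'.1.1, ht'.2.1, ht'.1.2.2, fun x => ?_⟩
  obtain ⟨D, hD, hx⟩ := hDs x
  by_contra! h
  have := ht'.2.2 D hD
  exact Finset.notMem_empty x (this ▸ Finset.mem_filter.2 ⟨hx, h⟩)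

lemma ev_stage_le (hu : IsDecreasing (p.val f s)) (hδ : δ ≤ 1) (hθ : 0 ≤ θ) (L : ℕ)
    (Ds : List (Finset β)) (t : GreedyState β) :
    (stage p δ θ L Ds t).ev f s (fun t => (1 - δ) * t.d - δ * t.c) ≤ (1 - δ) * t.d - δ * t.c := by
  have hμ := hθ.trans (base_le_topValue (u := p.val f s) θ t.A)
  rw [ev_stage]
  refine ev_chain_le (I := fun _ => True) (fun _ _ _ _ => surely_of_forall fun _ => trivial)
    (fun g hg a _ => ?_) trivial
  obtain ⟨D, -, rfl⟩ := List.mem_map.1 hg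
  refine ev_chain_le (I := fun _ => True) (fun _ _ _ _ => surely_of_forall fun _ => trivial)
    (fun g hg a _ => ?_) trivial
  rw [List.eq_of_mem_replicate hg]
  exact ev_step_le hu hδ hμ D a

/-- The quantity (1 - δ)d - δc is a supermartingale along the run, starting at 0. -/
theorem ev_greedy_le (hu : IsDecreasing (p.val f s)) (hδ : δ ≤ 1) (hθ : 0 ≤ θ) (L T : ℕ)
    (Ds : List (Finset β)) :
    (greedy p δ θ L T Ds).ev f s (fun t => (1 - δ) * t.d - δ * t.c) ≤ 0 := by
  refine (ev_chain_le (I := fun _ => True) (fun _ _ _ _ => surely_of_forall fun _ => trivial)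
    (fun g hg a _ => ?_) trivial).trans (by simp)
  rw [List.eq_of_mem_replicate hg]
  exact ev_stage_le hu hδ hθ L Ds a

open scoped Classical in
/-- The weight `w` pays for the elements blocked by `A` and for the slack of `A`. -/
def Covered (bl : Finset β → β → Prop) (u : Finset β → β → ℝ) (θ : ℝ) (A : Finset β) (w : ℝ) :
    Prop :=
  ∀ (K : Finset β) (h : β → ℝ), (∀ B ⊆ A, (K.filter (bl B)).card ≤ B.card) →
    (∀ B ⊆ A, ∀ x ∈ K, ¬ bl B x → h x ≤ topValue u θ B) →
    ∑ x ∈ K.filter (bl A), h x + topValue u θ A * (A.card - (K.filter (bl A)).card) ≤ w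

/-- Regard |A| minus the number of blocked elements of `K` as free slots, each worth the top value.
A stage pays the top value at `A` for each new slot. An element blocked during the stage was
unblocked at `A`, so its `h` is at most the price of the slot it takes, and the slots left over only
lose value. `K` and `h` stay quantified because the intended ones depend on the final set. -/
lemma Covered.step {bl : Finset β → β → Prop} {u : Finset β → β → ℝ}
    (hbl : ∀ {A B : Finset β} {x : β}, A ⊆ B → bl A x → bl B x) {A A' : Finset β} {w w' : ℝ}
    (h : Covered bl u θ A w) (hA : A ⊆ A') (hw : w' = w + topValue u θ A * (A'.card - A.card))
    (htop : topValue u θ A' ≤ topValue u θ A) : Covered bl u θ A' w' := by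
  classical
  intro K g hK hg
  have h1 := h K g (fun B hB => hK B (hB.trans hA)) fun B hB => hg B (hB.trans hA)
  have hsub : K.filter (bl A) ⊆ K.filter (bl A') := fun x hx => by
    rw [Finset.mem_filter] at hx ⊢
    exact ⟨hx.1, hbl hA hx.2⟩
  have h2 : ∑ x ∈ K.filter (bl A') \ K.filter (bl A), g x ≤
      (((K.filter (bl A')).card : ℝ) - (K.filter (bl A)).card) * topValue u θ A := by
    rw [← Nat.cast_sub (Finset.card_le_card hsub), ← Finset.card_sdiff_of_subset hsub,
      ← nsmul_eq_mul]
    refine Finset.sum_le_card_nsmul _ _ _ fun x hx => ?_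
    rw [Finset.mem_sdiff, Finset.mem_filter, Finset.mem_filter] at hx
    exact hg A hA x hx.1.1 fun hb => hx.2 ⟨hx.1.1, hb⟩
  have h3 : ∑ x ∈ K.filter (bl A'), g x = ∑ x ∈ K.filter (bl A') \ K.filter (bl A), g x +
      ∑ x ∈ K.filter (bl A), g x := (Finset.sum_sdiff hsub).symm
  have h4 : ((K.filter (bl A')).card : ℝ) ≤ A'.card := by exact_mod_cast hK A' subset_rfl
  have h5 := mul_le_mul_of_nonneg_right htop (sub_nonneg.2 h4)
  rw [h3, hw]
  linarith

/-- What the parallel greedy algorithm achieves, apart from the fraction of rejected elements. -/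
theorem surely_greedy (hu : IsDecreasing (p.val f s)) (hδ0 : 0 ≤ δ) (hδ : δ ≤ 1) (hθ : 0 ≤ θ)
    {bl : Finset β → β → Prop} (hbl : ∀ {A B : Finset β} {x : β}, A ⊆ B → bl A x → bl B x)
    (hI : ∀ μ, θ ≤ μ → Preserved (p.val f s) δ Ds μ I) (hI0 : I ⟨∅, ∅, 0, 0⟩) {L T : ℕ}
    (hL : (1 - δ) ^ L * Fintype.card β < 1) (hDs : ∀ x, ∃ D ∈ Ds, x ∈ D)
    (hT : Fintype.card β ≤ T ∨ (1 - δ) ^ T * topValue (p.val f s) θ ∅ ≤ θ) :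
    (greedy p δ θ L T Ds).Surely f s fun t => I t ∧
      ∀ (K : Finset β) (h : β → ℝ),
        (∀ B ⊆ t.A, ∀ K' ⊆ K, (∀ x ∈ K', bl B x) → K'.card ≤ B.card) →
        (∀ B ⊆ t.A, ∀ x ∈ K, ¬ bl B x → h x ≤ topValue (p.val f s) θ B) →
        ∑ x ∈ K, h x ≤ t.c + t.d + K.card * θ := by
  classical
  set u := p.val f s with hudef
  -- Here `k` counts completed stages. The last clause says that every stage starting above `θ`
  -- processes at least one element, so `T = card β` stages suffice no matter how small `θ` is.
  have hmain : ∀ (T k : ℕ) (t : GreedyState β), I t → Covered bl u θ t.A (t.c + t.d) →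
      topValue u θ t.A ≤ max θ ((1 - δ) ^ k * topValue u θ ∅) →
      (topValue u θ t.A ≤ θ ∨ k ≤ t.A.card) →
      (chain (List.replicate T (stage p δ θ L Ds)) t).Surely f s fun t => I t ∧
        Covered bl u θ t.A (t.c + t.d) ∧
        topValue u θ t.A ≤ max θ ((1 - δ) ^ (k + T) * topValue u θ ∅) ∧
        (topValue u θ t.A ≤ θ ∨ k + T ≤ t.A.card) := by
    intro T
    induction T with
    | zero => exact fun k t h1 h2 h3 h4 => ⟨h1, h2, h3, h4⟩
    | succ T ih =>
      intro k t h1 h2 h3 h4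
      rw [List.replicate_succ]
      refine (surely_stage_spec hu hδ hθ hI hL hDs t h1).bind fun t' ht' => ?_
      obtain ⟨k1, k2, k3, k4⟩ := ht'
      have hθμ := base_le_topValue (u := u) θ t.A
      have hμ0 := hθ.trans hθμ
      have htop1 : topValue u θ t'.A ≤ max θ ((1 - δ) * topValue u θ t.A) :=
        topValue_le (le_max_left _ _) fun x => (k4 x).le.trans (le_max_right _ _)
      have hle : (1 - δ) * topValue u θ t.A ≤ topValue u θ t.A :=
        mul_le_of_le_one_left hμ0 (by linarith)
      rw [show k + (T + 1) = k + 1 + T by ring]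
      refine ih (k + 1) t' k1 (h2.step (bl := bl) (@hbl) k2 k3 (htop1.trans (max_le hθμ hle))) ?_ ?_
      · refine htop1.trans (max_le (le_max_left _ _) ?_)
        refine (mul_le_mul_of_nonneg_left h3 (by linarith)).trans ?_
        rw [mul_max_of_nonneg _ _ (by linarith), pow_succ', mul_assoc]
        exact max_le_max (mul_le_of_le_one_left hθ (by linarith)) le_rfl
      · by_cases hcase : topValue u θ t.A ≤ θ
        · exact Or.inl (htop1.trans (max_le le_rfl (hle.trans hcase)))
        · refine Or.inr ?_
          have hk := h4.resolve_left hcase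
          push Not at hcase
          obtain h | ⟨x, -, hx⟩ := (Finset.lt_fold_max _).1 hcase
          · exact (lt_irrefl _ h).elim
          have hmax : ∃ x, topValue u θ t.A ≤ u t.A x := by
            by_contra! hcon
            have : topValue u θ t.A < topValue u θ t.A :=
              (Finset.fold_max_lt _).2 ⟨hcase, fun y _ => hcon y⟩
            exact lt_irrefl _ this
          obtain ⟨y, hy⟩ := hmax
          -- The element `y` attaining the top value has dropped strictly below it, so the set has
          -- changed.
          have hne : t.A ≠ t'.A := by
            intro h
            have := k4 y
            rw [← h] at this
            linarith
          have := Finset.card_lt_card (k2.ssubset_of_ne hne)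
          omega
  have hcov0 : Covered bl u θ ∅ (0 + 0) := by
    intro K g hK _
    have h0 : K.filter (bl ∅) = ∅ := Finset.card_eq_zero.1 (Nat.le_zero.1 (hK ∅ subset_rfl))
    simp [h0]
  refine (hmain T 0 _ hI0 hcov0 (by simp) (Or.inr (Nat.zero_le _))).mono fun t ht => ?_
  obtain ⟨h1, h2, h3, h4⟩ := ht
  refine ⟨h1, fun K g hK hg => ?_⟩
  have htop : topValue u θ t.A ≤ θ := by
    rcases hT with hT | hT
    · rcases h4 with h4 | h4
      · exact h4
      · have huniv : t.A = Finset.univ :=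
          (Finset.card_eq_iff_eq_univ _).1 (le_antisymm (Finset.card_le_univ _) (by omega))
        refine topValue_le le_rfl fun x => (hu.neg_of_mem ?_).le.trans hθ
        simp [huniv]
    · refine h3.trans (max_le le_rfl ?_)
      rwa [zero_add]
  have hK' : ∀ B ⊆ t.A, (K.filter (bl B)).card ≤ B.card := fun B hB =>
    hK B hB _ (Finset.filter_subset _ _) fun x hx => (Finset.mem_filter.1 hx).2
  have h5 := h2 K g hK' hg
  have h6 : 0 ≤ topValue u θ t.A * (t.A.card - (K.filter (bl t.A)).card) :=
    mul_nonneg (hθ.trans (base_le_topValue θ t.A))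
      (sub_nonneg.2 (by exact_mod_cast hK' t.A subset_rfl))
  have h7 : ∑ x ∈ K.filter (fun x => ¬ bl t.A x), g x ≤ K.card * θ := by
    refine (Finset.sum_le_card_nsmul _ _ θ fun x hx => ?_).trans ?_
    · rw [Finset.mem_filter] at hx
      exact (hg t.A subset_rfl x hx.1 hx.2).trans htop
    · rw [nsmul_eq_mul]
      exact mul_le_mul_of_nonneg_right (by exact_mod_cast Finset.card_filter_le _ _) hθ
  rw [← Finset.sum_filter_add_sum_filter_not K (bl t.A)]
  linarith

end

lemma roundsLE_askProbe (L : Finset (Finset β)) : (askProbe p L).RoundsLE 1 :=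
  fun _ _ => trivial

lemma roundsLE_step (δ : ℝ) (D : Finset β) (μ : ℝ) (t : GreedyState β) :
    (step p δ D μ t).RoundsLE 2 := by
  refine (roundsLE_askProbe _).bind (r' := 1) fun _ => (roundsLE_shuffle _ _).bind (r' := 1)
    fun _ => (roundsLE_askProbe _).bind (r' := 0) fun _ => ?_
  trivial

lemma roundsLE_stage (δ θ : ℝ) (L : ℕ) (Ds : List (Finset β)) (t : GreedyState β) :
    (stage p δ θ L Ds t).RoundsLE (1 + Ds.length * (L * 2)) := by
  refine (roundsLE_askProbe _).bind fun u => ?_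
  rw [← List.length_map (as := Ds)]
  refine roundsLE_chain (fun g hg a => ?_) t
  obtain ⟨D, -, rfl⟩ := List.mem_map.1 hg
  have := roundsLE_chain (gs := List.replicate L (step p δ D (topValue u θ t.A))) (r := 2)
    (fun g hg a => by rw [List.eq_of_mem_replicate hg]; exact roundsLE_step _ _ _ _) a
  rwa [List.length_replicate] at this

theorem roundsLE_greedy (δ θ : ℝ) (L T : ℕ) (Ds : List (Finset β)) :
    (greedy p δ θ L T Ds).RoundsLE (T * (1 + Ds.length * (L * 2))) := by
  have := roundsLE_chain (gs := List.replicate T (stage p δ θ L Ds))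
    (fun g hg a => by rw [List.eq_of_mem_replicate hg]; exact roundsLE_stage δ θ L Ds _)
    (⟨∅, ∅, 0, 0⟩ : GreedyState β)
  rwa [List.length_replicate] at this

lemma queriesLE_askProbe {q : ℕ}
    (hq : ∀ S x, (p.valueQueries S x).card + (p.spanQueries S x).card ≤ q)
    {L : Finset (Finset β)} (hL : L.card ≤ Fintype.card β + 1) :
    (askProbe p L).QueriesLE ((Fintype.card β + 1) * (Fintype.card β * q) : ℕ) := by
  refine ⟨?_, fun _ _ => trivial⟩
  norm_cast
  calc _ ≤ ∑ S ∈ L, ∑ x : β, (p.valueQueries S x).card +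
          ∑ S ∈ L, ∑ x : β, (p.spanQueries S x).card :=
        add_le_add
          (Finset.card_biUnion_le.trans (Finset.sum_le_sum fun S _ => Finset.card_biUnion_le))
          (Finset.card_biUnion_le.trans (Finset.sum_le_sum fun S _ => Finset.card_biUnion_le))
    _ = ∑ S ∈ L, ∑ x : β, ((p.valueQueries S x).card + (p.spanQueries S x).card) := by
        simp only [Finset.sum_add_distrib]
    _ ≤ ∑ S ∈ L, ∑ x : β, q := Finset.sum_le_sum fun S _ => Finset.sum_le_sum fun x _ => hq S x
    _ = L.card * (Fintype.card β * q) := by simp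
    _ ≤ _ := Nat.mul_le_mul_right _ hL

theorem queriesLE_greedy {q : ℕ}
    (hq : ∀ S x, (p.valueQueries S x).card + (p.spanQueries S x).card ≤ q)
    (δ θ : ℝ) (L T : ℕ) (Ds : List (Finset β)) :
    (greedy p δ θ L T Ds).QueriesLE ((Fintype.card β + 1) * (Fintype.card β * q) : ℕ) := by
  refine queriesLE_chain (fun g hg t => ?_) _
  rw [List.eq_of_mem_replicate hg]
  refine (queriesLE_askProbe hq (by simp)).bind fun u => queriesLE_chain (fun g hg t' => ?_) _
  obtain ⟨D, -, rfl⟩ := List.mem_map.1 hg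
  refine queriesLE_chain (fun g hg t'' => ?_) _
  rw [List.eq_of_mem_replicate hg]
  refine (queriesLE_askProbe hq (by simp)).bind fun u' => ?_
  refine QueriesLE.bind_of_surely (f := fun _ => 0) (s := fun _ _ => false)
    (roundsLE_shuffle _ _) (surely_length_shuffle _ _) fun l hl => ?_
  refine (queriesLE_askProbe hq ?_).bind fun _ => trivial
  have h1 := card_prefixes_le l t''.A
  have h2 := Finset.card_le_univ (live u' D ((1 - δ) * topValue u θ t.A) t''.A)
  omega

end

end ParallelGreedy

/-! ### Submodular functions, the span oracle, and the scale of the optimum. -/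

section
variable {α : Type u} [DecidableEq α]

lemma IsSubmodular.marginal_le {f : Finset α → ℝ} (hf : IsSubmodular f) {S T : Finset α} {x : α}
    (hST : S ⊆ T) (hx : x ∉ T) : f (insert x T) - f T ≤ f (insert x S) - f S := by
  have h := hf (insert x S) T
  rw [Finset.insert_union, Finset.union_eq_right.2 hST, Finset.insert_inter_of_notMem hx,
    Finset.inter_eq_left.2 hST] at h
  linarith

lemma IsSubmodular.union_le {f : Finset α → ℝ} (hf : IsSubmodular f) (S T : Finset α) :
    f (S ∪ T) ≤ f S + ∑ x ∈ T, (f (insert x S) - f S) := by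
  induction T using Finset.induction_on with
  | empty => simp
  | insert x T hx ih =>
    rw [Finset.sum_insert hx, Finset.union_insert]
    by_cases hxS : x ∈ S ∪ T
    · have : x ∈ S := (Finset.mem_union.1 hxS).resolve_right hx
      rw [Finset.insert_eq_of_mem hxS, Finset.insert_eq_of_mem this]
      linarith
    · have := hf.marginal_le (Finset.subset_union_left (s₁ := S) (s₂ := T)) hxS
      linarith

lemma IsSubmodular.le_sum_singleton {f : Finset α → ℝ} (hf : IsSubmodular f) (h0 : f ∅ = 0)
    (S : Finset α) : f S ≤ ∑ x ∈ S, f {x} := by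
  simpa [h0] using hf.union_le ∅ S

lemma spanOracle_eq_false_iff [Finite α] {M : Matroid α} (hM : M.E = Set.univ) {S : Finset α}
    {e : α} : spanOracle M S e = false ↔ e ∈ M.closure (S : Set α) := by
  rw [spanOracle, decide_eq_false_iff_not, not_lt, Finset.coe_insert]
  constructor
  · intro h
    by_contra he
    rw [Matroid.eRk_insert_eq_add_one ⟨hM ▸ Set.mem_univ e, he⟩] at h
    have hfin : M.eRk (S : Set α) ≠ ⊤ :=
      ((M.eRk_le_encard _).trans_lt (Set.toFinite _).encard_lt_top).ne
    exact absurd h (not_le.2 ((ENat.lt_add_one_iff hfin).2 le_rfl))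
  · intro he
    rw [← M.eRk_closure_eq (insert e (S : Set α)), M.closure_insert_eq_of_mem_closure he,
      M.eRk_closure_eq]

lemma spanOracle_eq_true_iff [Finite α] {M : Matroid α} (hM : M.E = Set.univ) {S : Finset α}
    {e : α} : spanOracle M S e = true ↔ e ∉ M.closure (S : Set α) := by
  rw [← spanOracle_eq_false_iff hM, Bool.not_eq_false]

lemma Matroid.mem_closure_of_mem_of_ground {M : Matroid α} (hM : M.E = Set.univ) {S : Finset α}
    {e : α} (he : e ∈ S) : e ∈ M.closure (S : Set α) :=
  M.subset_closure (S : Set α) (hM ▸ Set.subset_univ _) he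

lemma Matroid.closure_mono_coe (M : Matroid α) {S T : Finset α} (h : S ⊆ T) :
    M.closure (S : Set α) ⊆ M.closure (T : Set α) :=
  M.closure_subset_closure (Finset.coe_subset.2 h)

lemma Matroid.indep_insert_of_notMem_closure {M : Matroid α} (hM : M.E = Set.univ)
    {Q A : Finset α} {e : α} (hQ : M.Indep (Q : Set α)) (hQA : Q ⊆ A)
    (he : e ∉ M.closure (A : Set α)) : M.Indep ((insert e Q : Finset α) : Set α) := by
  rw [Finset.coe_insert]
  exact ((hQ.notMem_closure_iff (hM ▸ Set.mem_univ e)).1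
    fun h => he (M.closure_mono_coe hQA h)).1

lemma Matroid.card_le_of_subset_closure {M : Matroid α} {K B : Finset α}
    (hK : M.Indep (K : Set α)) (hKB : ∀ x ∈ K, x ∈ M.closure (B : Set α)) : K.card ≤ B.card := by
  have h := (hK.encard_le_eRk_of_subset fun x hx => hKB x hx).trans
    ((M.eRk_closure_eq _).le.trans (M.eRk_le_encard _))
  rwa [Set.encard_coe_eq_coe_finsetCard, Set.encard_coe_eq_coe_finsetCard, Nat.cast_le] at h

variable [Fintype α]

lemma le_optValue {M : Matroid α} {I : Finset α} (hI : M.Indep (I : Set α)) (f : Finset α → ℝ) :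
    f I ≤ optValue M f := by
  classical
  exact Finset.le_sup' f (by simpa using hI)

lemma exists_eq_optValue (M : Matroid α) (f : Finset α → ℝ) :
    ∃ C : Finset α, M.Indep (C : Set α) ∧ f C = optValue M f := by
  classical
  obtain ⟨C, hC, h⟩ := Finset.exists_mem_eq_sup' (s := Finset.univ.filter
    fun I : Finset α => M.Indep (I : Set α)) ⟨∅, by simp⟩ f
  exact ⟨C, by simpa using hC, h.symm⟩

/-- The largest value of a singleton of positive rank. -/
def maxSingleton (f : Finset α → ℝ) (s : Finset α → α → Bool) : ℝ :=
  Finset.univ.fold max 0 fun e => if s ∅ e = true then f {e} else 0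

lemma maxSingleton_nonneg (f : Finset α → ℝ) (s : Finset α → α → Bool) :
    0 ≤ maxSingleton f s :=
  (Finset.le_fold_max _).2 (Or.inl le_rfl)

lemma le_maxSingleton {f : Finset α → ℝ} {s : Finset α → α → Bool} {e : α} (he : s ∅ e = true) :
    f {e} ≤ maxSingleton f s :=
  (Finset.le_fold_max _).2 (Or.inr ⟨e, Finset.mem_univ e, by rw [if_pos he]⟩)

/-- The maximum runs only over non-loops, which are independent as singletons. The value of a loop
bears no relation to the optimum. -/
lemma maxSingleton_le_optValue {M : Matroid α} (hM : M.E = Set.univ) {f : Finset α → ℝ}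
    (h0 : f ∅ = 0) : maxSingleton f (spanOracle M) ≤ optValue M f := by
  have hopt : 0 ≤ optValue M f := h0 ▸ le_optValue (I := ∅) (by simp) f
  refine (Finset.fold_max_le _).2 ⟨hopt, fun e _ => ?_⟩
  split_ifs with he
  · refine le_optValue ?_ f
    have := Matroid.indep_insert_of_notMem_closure hM (Q := ∅) (A := ∅) (by simp) subset_rfl
      ((spanOracle_eq_true_iff hM).1 he)
    simpa using this
  · exact hopt

open Strategy in
/-- One round that computes `maxSingleton`. -/
def askScale : Strategy α ℝ :=
  ask (Finset.univ.image fun e => {e}) (Finset.univ.image fun e : α => ((∅ : Finset α), e)) fun v s =>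
    output (maxSingleton v s)

lemma maxSingleton_mask (f : Finset α → ℝ) (s : Finset α → α → Bool) :
    maxSingleton (Strategy.maskValue (Finset.univ.image fun e => {e}) f)
      (Strategy.maskSpan (Finset.univ.image fun e : α => ((∅ : Finset α), e)) s) = maxSingleton f s := by
  unfold maxSingleton Strategy.maskValue Strategy.maskSpan
  congr 1
  funext e
  rw [if_pos (Finset.mem_image_of_mem _ (Finset.mem_univ e)),
    if_pos (Finset.mem_image_of_mem _ (Finset.mem_univ e))]

lemma ev_askScale_bind {γ : Type*} (g : ℝ → Strategy α γ) (f : Finset α → ℝ)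
    (s : Finset α → α → Bool) (φ : γ → ℝ) :
    (askScale.bind g).ev f s φ = (g (maxSingleton f s)).ev f s φ := by
  simp only [askScale, Strategy.bind, Strategy.ev, maxSingleton_mask]

lemma surely_askScale_bind {γ : Type*} (g : ℝ → Strategy α γ) (f : Finset α → ℝ)
    (s : Finset α → α → Bool) (p : γ → Prop) :
    (askScale.bind g).Surely f s p ↔ (g (maxSingleton f s)).Surely f s p := by
  simp only [askScale, Strategy.bind, Strategy.Surely, maxSingleton_mask]

lemma roundsLE_askScale : (askScale : Strategy α ℝ).RoundsLE 1 := fun _ _ => trivial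

lemma queriesLE_askScale {q : ℝ} (hq : 2 * (Fintype.card α : ℝ) ≤ q) :
    (askScale : Strategy α ℝ).QueriesLE q := by
  refine ⟨le_trans ?_ hq, fun _ _ => trivial⟩
  have h1 := Finset.card_image_le (s := (Finset.univ : Finset α)) (f := fun e : α => ({e} : Finset α))
  have h2 := Finset.card_image_le (s := (Finset.univ : Finset α))
    (f := fun e : α => ((∅ : Finset α), e))
  rw [Finset.card_univ] at h1 h2
  have : ((Finset.univ.image fun e : α => ({e} : Finset α)).card +
      (Finset.univ.image fun e : α => ((∅ : Finset α), e)).card : ℕ) ≤ 2 * Fintype.card α := by omega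
  exact_mod_cast this

end

/-! ### A single independent set: greedy on two disjoint sides. -/

namespace TwoSided
open ParallelGreedy

section
variable {α : Type u} [Fintype α] [DecidableEq α]

/-- The part of `S` on the side `j`. -/
def side (j : Bool) (S : Finset (Bool × α)) : Finset α :=
  Finset.univ.filter fun e => (j, e) ∈ S

@[simp] lemma mem_side {j : Bool} {S : Finset (Bool × α)} {e : α} : e ∈ side j S ↔ (j, e) ∈ S := by
  simp [side]

lemma side_mono (j : Bool) {S T : Finset (Bool × α)} (h : S ⊆ T) : side j S ⊆ side j T :=
  fun e he => by simpa using h (by simpa using he)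

lemma side_insert_self (j : Bool) (e : α) (S : Finset (Bool × α)) :
    side j (insert (j, e) S) = insert e (side j S) := by
  ext
  simp

lemma side_insert_not (j : Bool) (e : α) (S : Finset (Bool × α)) :
    side (!j) (insert (j, e) S) = side (!j) S := by
  ext
  simp

lemma card_side_add_card_side (S : Finset (Bool × α)) :
    (side false S).card + (side true S).card = S.card := by
  have h : S = (side false S).image (fun e => (false, e)) ∪
      (side true S).image (fun e => (true, e)) := by
    ext ⟨j, e⟩
    cases j <;> simp
  conv_rhs => rw [h]
  rw [Finset.card_union_of_disjoint, Finset.card_image_of_injective, Finset.card_image_of_injective]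
  · exact Prod.mk_right_injective _
  · exact Prod.mk_right_injective _
  · rw [Finset.disjoint_left]
    intro x hx hx'
    rw [Finset.mem_image] at hx hx'
    obtain ⟨a, -, rfl⟩ := hx
    obtain ⟨b, -, hb⟩ := hx'
    simp at hb

/-- The marginal value of `(j, e)`: adding `e` to side `j`, unless `e` is spanned there or belongs
to the other side. -/
def probe (α : Type u) [Fintype α] [DecidableEq α] : Probe α (Bool × α) where
  val f s S x := if s (side x.1 S) x.2 = false ∨ (!x.1, x.2) ∈ S then -1
    else f (insert x.2 (side x.1 S)) - f (side x.1 S)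
  valueQueries S x := {insert x.2 (side x.1 S), side x.1 S}
  spanQueries S x := {(side x.1 S, x.2)}
  val_congr := by
    intro f f' s s' S x hf hs
    have h1 := hf (insert x.2 (side x.1 S)) (by simp)
    have h2 := hf (side x.1 S) (by simp)
    have h3 := hs (side x.1 S, x.2) (by simp)
    simp only at h3
    rw [h1, h2, h3]

/-- The element `(j, e)` cannot be added any more. -/
def Blocked (M : Matroid α) (S : Finset (Bool × α)) (x : Bool × α) : Prop :=
  x.2 ∈ M.closure (side x.1 S : Set α) ∨ (!x.1, x.2) ∈ S

/-- The sum of the values of the two sides. -/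
def total (f : Finset α → ℝ) (S : Finset (Bool × α)) : ℝ := f (side false S) + f (side true S)

variable {M : Matroid α} {f : Finset α → ℝ}

lemma blocked_mono {A B : Finset (Bool × α)} {x : Bool × α} (h : A ⊆ B) (hx : Blocked M A x) :
    Blocked M B x :=
  hx.imp (fun h' => M.closure_mono_coe (side_mono x.1 h) h') fun h' => h h'

lemma val_of_blocked (hM : M.E = Set.univ) {S : Finset (Bool × α)} {x : Bool × α}
    (h : Blocked M S x) : (probe α).val f (spanOracle M) S x = -1 :=
  if_pos (h.imp_left (spanOracle_eq_false_iff hM).2)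

lemma val_of_not_blocked (hM : M.E = Set.univ) {S : Finset (Bool × α)} {x : Bool × α}
    (h : ¬ Blocked M S x) : (probe α).val f (spanOracle M) S x =
      f (insert x.2 (side x.1 S)) - f (side x.1 S) :=
  if_neg fun h' => h (h'.imp_left (spanOracle_eq_false_iff hM).1)

lemma not_blocked_of_nonneg (hM : M.E = Set.univ) {S : Finset (Bool × α)} {x : Bool × α}
    (h : 0 ≤ (probe α).val f (spanOracle M) S x) : ¬ Blocked M S x := by
  intro hb
  rw [val_of_blocked hM hb] at h
  linarith

lemma blocked_of_mem (hM : M.E = Set.univ) {S : Finset (Bool × α)} {x : Bool × α} (h : x ∈ S) :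
    Blocked M S x :=
  Or.inl (Matroid.mem_closure_of_mem_of_ground hM (by simpa using h))

/-- A blocked pair has value -1 even if its marginal was smaller before, so only nonnegative values
are monotone. Nonnegativity rules out that the pair is blocked at the larger set. -/
lemma isDecreasing_val (hM : M.E = Set.univ) (hf : IsSubmodular f) :
    IsDecreasing ((probe α).val f (spanOracle M)) where
  le_of_subset {A B x} h h0 := by
    have hB := not_blocked_of_nonneg hM h0
    have hA : ¬ Blocked M A x := fun h' => hB (blocked_mono h h')
    rw [val_of_not_blocked hM hB, val_of_not_blocked hM hA]
    exact hf.marginal_le (side_mono _ h) fun hx => hB (blocked_of_mem hM (by simpa using hx))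
  neg_of_mem {A x} h := by
    rw [val_of_blocked hM (blocked_of_mem hM h)]
    norm_num

lemma total_insert (f : Finset α → ℝ) (S : Finset (Bool × α)) (x : Bool × α) :
    total f (insert x S) - total f S = f (insert x.2 (side x.1 S)) - f (side x.1 S) := by
  obtain ⟨j, e⟩ := x
  have h1 := side_insert_self j e S
  have h2 := side_insert_not j e S
  cases j
  · simp only [total, h1, Bool.not_false] at *
    rw [h2]
    ring
  · simp only [total, h1, Bool.not_true] at *
    rw [h2]
    ring

/-- The two sides, as sets of elements. -/
def sides (α : Type u) [Fintype α] [DecidableEq α] : List (Finset (Bool × α)) :=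
  [Finset.univ.filter fun x => x.1 = false, Finset.univ.filter fun x => x.1 = true]

/-- The invariants of the two-sided greedy algorithm. -/
structure Invariant (M : Matroid α) (f : Finset α → ℝ) (δ : ℝ) (t : GreedyState (Bool × α)) :
    Prop where
  subset : t.Q ⊆ t.A
  disjoint : ∀ j e, (j, e) ∈ t.A → (!j, e) ∉ t.A
  indep : ∀ j, M.Indep (side j t.Q : Set α)
  le_total : (1 - δ) * t.c ≤ total f t.Q
  total_le : total f t.A ≤ total f t.Q + t.d

/-- An accepted element gains at least as much at `Q` as at `A`. A rejected one raises only `total f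
t.A`, by at most `μ` according to its value at the earlier set `B`, and `d` grows by `μ`. -/
lemma preserved_invariant (hM : M.E = Set.univ) (hf : IsSubmodular f) {δ μ : ℝ} (hδ : δ ≤ 1)
    (hμ : 0 ≤ μ) :
    Preserved ((probe α).val f (spanOracle M)) δ (sides α) μ (Invariant M f δ) := by
  rintro t ⟨j, e⟩ ⟨haA, D, hD, B, hBA, hABD, haD, h0, hle⟩ ht
  have hbB := not_blocked_of_nonneg hM h0
  rw [val_of_not_blocked hM hbB] at hle
  have hD' : ∀ x ∈ D, x.1 = j := by
    simp only [sides, List.mem_cons, List.not_mem_nil, or_false] at hD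
    rcases hD with rfl | rfl <;> simp_all
  -- The opposite copy is not in `B`, where it would block the pair, and it cannot have come since,
  -- because only elements of side `j` have. For this reason the two sides are processed as separate
  -- sets.
  have hopp : (!j, e) ∉ t.A := by
    intro h
    by_cases hB : (!j, e) ∈ B
    · exact hbB (Or.inr hB)
    · have := hD' _ (hABD (Finset.mem_sdiff.2 ⟨h, hB⟩))
      simp at this
  have hmarg : total f (insert (j, e) t.A) - total f t.A ≤ μ := by
    rw [total_insert]
    exact (hf.marginal_le (side_mono j hBA) (by simpa using haA)).trans hle
  have hQ : total f (insert (j, e) t.A) - total f t.A ≤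
      total f (insert (j, e) t.Q) - total f t.Q := by
    rw [total_insert, total_insert]
    exact hf.marginal_le (side_mono j ht.subset) (by simpa using haA)
  have hdisj : ∀ j' e', (j', e') ∈ insert (j, e) t.A → (!j', e') ∉ insert (j, e) t.A := by
    intro j' e' h h'
    rw [Finset.mem_insert, Prod.mk.injEq] at h h'
    rcases h with ⟨rfl, rfl⟩ | h
    · rcases h' with ⟨h', -⟩ | h'
      · simp at h'
      · exact hopp h'
    · rcases h' with ⟨h', rfl⟩ | h'
      · subst h'
        simp only [Bool.not_not] at hopp
        exact hopp h
      · exact ht.disjoint _ _ h h'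
  unfold GreedyState.add
  split_ifs with hgood
  · have hnb : ¬ Blocked M t.A (j, e) :=
      not_blocked_of_nonneg hM ((mul_nonneg (by linarith) hμ).trans hgood)
    rw [val_of_not_blocked hM hnb] at hgood
    have ht1 := ht.le_total
    have ht2 := ht.total_le
    have h3 := total_insert f t.A (j, e)
    refine ⟨Finset.insert_subset_insert _ ht.subset, hdisj, fun j' => ?_, ?_, ?_⟩
    · by_cases hj : j' = j
      · subst hj
        rw [side_insert_self]
        exact Matroid.indep_insert_of_notMem_closure hM (ht.indep _) (side_mono _ ht.subset)
          fun h => hnb (Or.inl h)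
      · obtain rfl : j' = !j := by cases j <;> cases j' <;> simp_all
        rw [side_insert_not]
        exact ht.indep _
    · simp only
      linarith
    · simp only
      linarith
  · have ht2 := ht.total_le
    refine ⟨ht.subset.trans (Finset.subset_insert _ _), hdisj, ht.indep, ht.le_total, ?_⟩
    simp only
    linarith

lemma invariant_empty (h0 : f ∅ = 0) (δ : ℝ) :
    Invariant M f δ ⟨∅, ∅, 0, 0⟩ := by
  have : ∀ j, side j (∅ : Finset (Bool × α)) = ∅ := fun j => by ext; simp
  constructor <;> simp [total, h0, this]

/-- For disjoint `A` and `B` the sets A ∪ C and B ∪ C meet exactly in `C`. -/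
lemma optValue_le_of_disjoint (hf : IsSubmodular f) (hnn : ∀ S, 0 ≤ f S) {A B : Finset α}
    (hAB : Disjoint A B) (C : Finset α) : f C ≤ f (A ∪ C) + f (B ∪ C) := by
  have h := hf (A ∪ C) (B ∪ C)
  rw [← Finset.inter_union_distrib_right, Finset.disjoint_iff_inter_eq_empty.1 hAB,
    Finset.empty_union] at h
  linarith [hnn (A ∪ C ∪ (B ∪ C))]

/-- On side j, the elements of K_j spanned by B_j together with B_j ∩ C form an independent set in
the span of B_j, so they number at most |B_j|. The other elements of K_j lie in C and on the
opposite side of B. Summing over j, the terms |B₀ ∩ C| and |B₁ ∩ C| cancel. -/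
lemma card_blocked_le (hM : M.E = Set.univ) {A B K : Finset (Bool × α)} {C : Finset α}
    (hC : M.Indep (C : Set α)) (hBA : B ⊆ A) (hK : ∀ x ∈ K, x.2 ∈ C ∧ x ∉ A ∧ Blocked M B x) :
    K.card ≤ B.card := by
  classical
  have key : ∀ j, (side j K).card + (side j B ∩ C).card ≤
      (side j B).card + (side (!j) B ∩ C).card := by
    intro j
    set K₁ := (side j K).filter fun e => e ∈ M.closure (side j B : Set α) with hK₁
    have h1 : (K₁ ∪ (side j B ∩ C)).card ≤ (side j B).card := by
      refine Matroid.card_le_of_subset_closure (M := M) (hC.subset ?_) ?_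
      · intro e he
        simp only [Finset.coe_union, Set.mem_union, Finset.mem_coe, Finset.mem_inter, hK₁,
          Finset.mem_filter, mem_side] at he
        rcases he with he | he
        · exact (hK _ he.1).1
        · exact he.2
      · intro e he
        simp only [Finset.mem_union, Finset.mem_inter, hK₁, Finset.mem_filter] at he
        rcases he with he | he
        · exact he.2
        · exact Matroid.mem_closure_of_mem_of_ground hM he.1
    rw [Finset.card_union_of_disjoint] at h1
    · have h2 : (side j K).card ≤ K₁.card + (side (!j) B ∩ C).card := by
        refine (Finset.card_le_card fun e he => ?_).trans (Finset.card_union_le _ _)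
        have := hK (j, e) (by simpa using he)
        rcases this.2.2 with h | h
        · exact Finset.mem_union_left _ (Finset.mem_filter.2 ⟨he, h⟩)
        · exact Finset.mem_union_right _ (Finset.mem_inter.2 ⟨by simpa using h, this.1⟩)
      omega
    · rw [Finset.disjoint_left]
      intro e he he'
      have h1 := (Finset.mem_filter.1 he).1
      have h2 := (Finset.mem_inter.1 he').1
      rw [mem_side] at h1 h2
      exact (hK _ h1).2.1 (hBA h2)
  have h1 := key false
  have h2 := key true
  have h3 := card_side_add_card_side K
  have h4 := card_side_add_card_side B
  simp only [Bool.not_false, Bool.not_true] at h1 h2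
  omega

/-- The two-sided greedy algorithm. -/
noncomputable def run (α : Type u) [Fintype α] [DecidableEq α] (δ : ℝ) (L T : ℕ) (θ : ℝ) :
    Strategy α (GreedyState (Bool × α)) :=
  greedy (probe α) δ θ L T (sides α)

lemma mem_sides (x : Bool × α) : ∃ D ∈ sides α, x ∈ D := by
  obtain ⟨j, e⟩ := x
  cases j <;> simp [sides]

/-- With `C` optimal, `surely_greedy` is applied to the pairs (j, e) with e in `C` that were not
processed, their values being the marginals at the final set. The weight c + d pays for both unions
with `C`, and the second d comes from comparing `total` at `A` and at `Q`. -/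
lemma surely_run (hM : M.E = Set.univ) (hf : IsSubmodular f) (h0 : f ∅ = 0) (hnn : ∀ S, 0 ≤ f S)
    {δ θ : ℝ} (hδ0 : 0 ≤ δ) (hδ : δ ≤ 1) (hθ : 0 ≤ θ) {L T : ℕ}
    (hL : (1 - δ) ^ L * Fintype.card (Bool × α) < 1)
    (hT : (1 - δ) ^ T * max θ (maxSingleton f (spanOracle M)) ≤ θ) :
    (run α δ L T θ).Surely f (spanOracle M) fun t =>
      (∀ j, M.Indep (side j t.Q : Set α)) ∧ (1 - δ) * t.c ≤ total f t.Q ∧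
      optValue M f ≤ t.c + 2 * t.d + total f t.Q + 2 * Fintype.card α * θ := by
  have htop : topValue ((probe α).val f (spanOracle M)) θ ∅ ≤
      max θ (maxSingleton f (spanOracle M)) := by
    refine topValue_le (le_max_left _ _) fun x => le_trans ?_ (le_max_right _ _)
    by_cases hb : Blocked M ∅ x
    · rw [val_of_blocked hM hb]
      linarith [maxSingleton_nonneg f (spanOracle M)]
    · rw [val_of_not_blocked hM hb]
      have hs : side x.1 (∅ : Finset (Bool × α)) = ∅ := by ext; simp
      rw [hs, h0, sub_zero]
      refine le_maxSingleton ((spanOracle_eq_true_iff hM).2 fun h => hb (Or.inl ?_))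
      rwa [hs]
  refine (surely_greedy (isDecreasing_val hM hf) hδ0 hδ hθ (bl := Blocked M)
    (fun h => blocked_mono h)
    (fun μ hμ => preserved_invariant hM hf hδ (hθ.trans hμ)) (invariant_empty h0 δ) hL mem_sides
    (Or.inr ((mul_le_mul_of_nonneg_left htop (pow_nonneg (by linarith) _)).trans hT))).mono
    fun t ht => ?_
  obtain ⟨hI, hsum⟩ := ht
  obtain ⟨C, hC, hCopt⟩ := exists_eq_optValue M f
  refine ⟨hI.indep, hI.le_total, ?_⟩
  have h1 := hsum (Finset.univ.filter fun x => x.2 ∈ C ∧ x ∉ t.A)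
    (fun x => f (insert x.2 (side x.1 t.A)) - f (side x.1 t.A)) ?_ ?_
  rotate_left
  · intro B hB K hK hbl
    refine card_blocked_le hM hC hB fun x hx => ?_
    have := (Finset.mem_filter.1 (hK hx)).2
    exact ⟨this.1, this.2, hbl x hx⟩
  · intro B hB x hx hbl
    have hx' := (Finset.mem_filter.1 hx).2.2
    refine le_trans ?_ (le_topValue θ B x)
    rw [val_of_not_blocked hM hbl]
    exact hf.marginal_le (side_mono _ hB) (by simpa using hx')
  have h2 : ∀ j, f (side j t.A ∪ C) - f (side j t.A) ≤ ∑ e ∈ C.filter (fun e => (j, e) ∉ t.A),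
      (f (insert e (side j t.A)) - f (side j t.A)) := by
    intro j
    have := hf.union_le (side j t.A) (C.filter fun e => (j, e) ∉ t.A)
    have hU : side j t.A ∪ C.filter (fun e => (j, e) ∉ t.A) = side j t.A ∪ C := by
      ext e
      simp only [Finset.mem_union, mem_side, Finset.mem_filter]
      tauto
    rw [hU] at this
    linarith
  have h3 : ∑ x ∈ Finset.univ.filter (fun x : Bool × α => x.2 ∈ C ∧ x ∉ t.A),
      (f (insert x.2 (side x.1 t.A)) - f (side x.1 t.A)) =
      ∑ j : Bool, ∑ e ∈ C.filter (fun e => (j, e) ∉ t.A),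
        (f (insert e (side j t.A)) - f (side j t.A)) := by
    rw [Finset.sum_filter, Fintype.sum_prod_type]
    refine Finset.sum_congr rfl fun j _ => ?_
    rw [← Finset.sum_filter]
    refine Finset.sum_congr ?_ fun _ _ => rfl
    ext e
    simp
  have h4 : ((Finset.univ.filter fun x : Bool × α => x.2 ∈ C ∧ x ∉ t.A).card : ℝ) ≤
      2 * Fintype.card α := by
    have := Finset.card_le_univ (Finset.univ.filter fun x : Bool × α => x.2 ∈ C ∧ x ∉ t.A)
    rw [Fintype.card_prod, Fintype.card_bool] at this
    exact_mod_cast this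
  have h5 := mul_le_mul_of_nonneg_right h4 hθ
  have h6 : Disjoint (side false t.A) (side true t.A) := by
    rw [Finset.disjoint_left]
    intro e he he'
    rw [mem_side] at he he'
    exact hI.disjoint _ _ he he'
  have h7 := optValue_le_of_disjoint hf hnn h6 C
  have h8 := hI.total_le
  rw [h3, Fintype.sum_bool] at h1
  have h9 := h2 true
  have h10 := h2 false
  simp only [total] at h8 ⊢
  rw [← hCopt]
  linarith

lemma card_queries_le (S : Finset (Bool × α)) (x : Bool × α) :
    ((probe α).valueQueries S x).card + ((probe α).spanQueries S x).card ≤ 3 := by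
  have : ((probe α).valueQueries S x).card ≤ 2 := Finset.card_le_two
  have h2 : ((probe α).spanQueries S x).card = 1 := Finset.card_singleton _
  omega

open Strategy in
/-- The algorithm for a single independent set: run the two-sided greedy algorithm and return the
accepted elements of a random side. -/
noncomputable def algorithm (α : Type u) [Fintype α] [DecidableEq α] (L T : ℕ) :
    Strategy α (Finset α) :=
  askScale.bind fun v => (run α (1 / 10) L T (v / (20 * Fintype.card α))).bind fun t =>
    (uniform Bool).bind fun j => output (side j t.Q)

theorem algorithm_spec (hM : M.E = Set.univ) (hf : IsSubmodular f) (h0 : f ∅ = 0)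
    (hnn : ∀ S, 0 ≤ f S) (hn : 0 < Fintype.card α) {L T : ℕ}
    (hL : (9 / 10 : ℝ) ^ L * (2 * Fintype.card α) < 1)
    (hT : (9 / 10 : ℝ) ^ T * (20 * Fintype.card α) ≤ 1) :
    ((algorithm α L T).Surely f (spanOracle M) fun I => M.Indep (I : Set α)) ∧
      19 / 100 * optValue M f ≤ (algorithm α L T).ev f (spanOracle M) f := by
  set v := maxSingleton f (spanOracle M) with hv
  have hn' : (0 : ℝ) < Fintype.card α := by exact_mod_cast hn
  have hn1 : (1 : ℝ) ≤ Fintype.card α := by exact_mod_cast hn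
  have hv0 : 0 ≤ v := maxSingleton_nonneg _ _
  have hvopt : v ≤ optValue M f := maxSingleton_le_optValue hM h0
  have hθ : 0 ≤ v / (20 * Fintype.card α) := by positivity
  have hs := surely_run hM hf h0 hnn (δ := 1 / 10) (θ := v / (20 * Fintype.card α)) (L := L)
    (T := T) (by norm_num) (by norm_num) hθ (by
      rw [Fintype.card_prod, Fintype.card_bool]
      norm_num
      linarith) (by
      rw [max_eq_right, le_div_iff₀ (by positivity)]
      · norm_num
        nlinarith
      · exact div_le_self hv0 (by linarith))
  have he := ev_greedy_le (p := probe α) (f := f) (s := spanOracle M) (isDecreasing_val hM hf)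
    (δ := 1 / 10) (by norm_num) hθ L T (sides α)
  refine ⟨?_, ?_⟩
  · rw [algorithm, surely_askScale_bind]
    exact hs.bind fun t ht => (Strategy.surely_uniform ht.1).bind fun j hj => hj
  · rw [algorithm, ev_askScale_bind, Strategy.ev_bind]
    simp only [Strategy.ev_bind, Strategy.ev_uniform, Strategy.ev, Fintype.sum_bool,
      Fintype.card_bool]
    -- The threshold costs 2nθ = v/10 ≤ OPT/10. Subtracting 20/9 times the supermartingale turns c +
    -- 2d into (11/9)c, and c ≤ (10/9) total, so (11/9)(10/9) + 1 = 191/81 times the total remains,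
    -- which is 382/81 times the mean of the sides. Finally (81/382)(9/10) > 19/100.
    have h1 : (run α (1 / 10) L T (v / (20 * Fintype.card α))).ev f (spanOracle M) (fun _ =>
        9 / 10 * optValue M f) ≤ (run α (1 / 10) L T (v / (20 * Fintype.card α))).ev f
        (spanOracle M) (fun t => 382 / 81 * ((f (side true t.Q) + f (side false t.Q)) / (2 : ℕ)) +
          20 / 9 * ((1 - 1 / 10) * t.d - 1 / 10 * t.c)) := by
      refine Strategy.ev_le_ev hs fun t ht => ?_
      obtain ⟨-, h2, h3⟩ := ht
      have h4 : 2 * Fintype.card α * (v / (20 * Fintype.card α)) = v / 10 := by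
        field_simp
        ring
      rw [h4] at h3
      simp only [total] at h2 h3
      push_cast
      linarith
    rw [Strategy.ev_const, Strategy.ev_add, Strategy.ev_const_mul, Strategy.ev_const_mul] at h1
    have h2 : (run α (1 / 10) L T (v / (20 * Fintype.card α))).ev f (spanOracle M)
      (fun t => (1 - 1 / 10) * t.d - 1 / 10 * t.c) ≤ 0 := he
    have h5 : 0 ≤ optValue M f := hv0.trans hvopt
    linarith

lemma roundsLE_algorithm (L T : ℕ) :
    (algorithm α L T).RoundsLE (1 + T * (1 + 2 * (L * 2))) := by
  refine roundsLE_askScale.bind fun v => ?_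
  exact (roundsLE_greedy _ _ L T (sides α)).bind (r' := 0) fun t =>
    (Strategy.roundsLE_uniform Bool).bind (r' := 0) (g := fun j => Strategy.output (side j t.Q))
      fun _ => trivial

lemma queriesLE_algorithm (L T : ℕ) :
    (algorithm α L T).QueriesLE
      ((2 * Fintype.card α + 1) * (2 * Fintype.card α * 3) : ℕ) := by
  refine (queriesLE_askScale ?_).bind fun v => ?_
  · norm_cast
    nlinarith [Nat.zero_le (Fintype.card α)]
  · have := queriesLE_greedy (p := probe α) (card_queries_le) (1 / 10)
      (v / (20 * Fintype.card α)) L T (sides α)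
    rw [Fintype.card_prod, Fintype.card_bool] at this
    exact this.bind fun t => (Strategy.queriesLE_uniform Bool _).bind fun _ => trivial

end

end TwoSided

/-! ### Values of sampled unions of a family of sets. -/

section
variable {α : Type u} [DecidableEq α]

lemma IsSubmodular.comp_insert {f : Finset α → ℝ} (hf : IsSubmodular f) (z : α) :
    IsSubmodular fun S => f (insert z S) := by
  intro S T
  have h := hf (insert z S) (insert z T)
  rwa [← Finset.insert_union_distrib, ← Finset.insert_inter_distrib] at h

lemma IsSubmodular.comp_union {f : Finset α → ℝ} (hf : IsSubmodular f) (C : Finset α) :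
    IsSubmodular fun S => f (S ∪ C) := by
  intro S T
  have h := hf (S ∪ C) (T ∪ C)
  rwa [← Finset.union_union_distrib_right, ← Finset.inter_union_distrib_right] at h

lemma IsSubmodular.comp_sdiff {f : Finset α → ℝ} (hf : IsSubmodular f) (R : Finset α) :
    IsSubmodular fun S => f (S \ R) := by
  intro S T
  have h := hf (S \ R) (T \ R)
  have e1 : S \ R ∪ T \ R = (S ∪ T) \ R := by
    ext
    simp only [Finset.mem_union, Finset.mem_sdiff]
    tauto
  have e2 : S \ R ∩ (T \ R) = (S ∩ T) \ R := by
    ext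
    simp only [Finset.mem_inter, Finset.mem_sdiff]
    tauto
  rwa [e1, e2] at h

/-- Marginal values do not increase when another element is added. -/
lemma IsSubmodular.marginal_insert_le {f : Finset α → ℝ} (hf : IsSubmodular f) {x z : α}
    (hxz : x ≠ z) (S : Finset α) :
    f (insert x (insert z S)) - f (insert z S) ≤ f (insert x S) - f S := by
  by_cases hx : x ∈ S
  · rw [Finset.insert_eq_of_mem hx, Finset.insert_eq_of_mem (Finset.mem_insert_of_mem hx)]
    simp
  · exact hf.marginal_le (Finset.subset_insert _ _) (by simp [hxz, hx])

/-- Families of finite sets can be reached from smaller families by adding single elements. -/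
lemma family_induction {ι : Type*} [Fintype ι] [DecidableEq ι] {P : (ι → Finset α) → Prop}
    {Q A : ι → Finset α} (hQA : ∀ k, Q k ⊆ A k) (hQ : P Q)
    (hstep : ∀ I j z, (∀ k, Q k ⊆ I k) → (∀ k, I k ⊆ A k) → z ∉ I j → z ∈ A j → P I →
      P (Function.update I j (insert z (I j)))) : P A := by
  suffices h : ∀ n, ∀ I : ι → Finset α, ∑ k, (A k \ I k).card = n → (∀ k, Q k ⊆ I k) →
      (∀ k, I k ⊆ A k) → P I → P A from h _ Q rfl (fun _ => subset_rfl) hQA hQ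
  intro n
  induction n with
  | zero =>
    intro I hn _ hIA hI
    have : I = A := by
      funext k
      have := (Finset.sum_eq_zero_iff.1 hn) k (Finset.mem_univ k)
      exact (hIA k).antisymm (Finset.sdiff_eq_empty_iff_subset.1 (Finset.card_eq_zero.1 this))
    exact this ▸ hI
  | succ n ih =>
    intro I hn hQI hIA hI
    obtain ⟨j, -, hj⟩ : ∃ j ∈ Finset.univ, (A j \ I j).card ≠ 0 :=
      Finset.exists_ne_zero_of_sum_ne_zero (by omega)
    obtain ⟨z, hz⟩ := Finset.card_pos.1 (Nat.pos_of_ne_zero hj)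
    rw [Finset.mem_sdiff] at hz
    refine ih _ ?_ ?_ ?_ (hstep I j z hQI hIA hz.2 hz.1 hI)
    · have h1 : ∑ k, (A k \ I k).card = (A j \ I j).card +
          ∑ k ∈ Finset.univ.erase j, (A k \ I k).card :=
        (Finset.add_sum_erase _ _ (Finset.mem_univ j)).symm
      rw [← Finset.add_sum_erase _ _ (Finset.mem_univ j), Function.update_self,
        Finset.sdiff_insert, Finset.card_erase_of_mem (Finset.mem_sdiff.2 hz)]
      have h2 : ∑ k ∈ Finset.univ.erase j,
          (A k \ Function.update I j (insert z (I j)) k).card =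
          ∑ k ∈ Finset.univ.erase j, (A k \ I k).card :=
        Finset.sum_congr rfl fun k hk => by
          rw [Function.update_of_ne (Finset.ne_of_mem_erase hk)]
      omega
    · intro k
      by_cases hk : k = j
      · subst hk
        rw [Function.update_self]
        exact (hQI k).trans (Finset.subset_insert _ _)
      · rw [Function.update_of_ne hk]
        exact hQI k
    · intro k
      by_cases hk : k = j
      · subst hk
        rw [Function.update_self]
        exact Finset.insert_subset hz.1 (hIA k)
      · rw [Function.update_of_ne hk]
        exact hIA k

lemma sampleWeight_insert {p : ℝ} {S X : Finset α} {z : α} (hz : z ∉ S) :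
    sampleWeight p (insert z S) X =
      if z ∈ X then p * sampleWeight p S (X.erase z) else (1 - p) * sampleWeight p S X := by
  unfold sampleWeight
  by_cases hzX : z ∈ X
  · rw [if_pos hzX]
    by_cases h : X ⊆ insert z S
    · have h' : X.erase z ⊆ S := by rwa [← Finset.subset_insert_iff]
      have hc : insert z S \ X = S \ X.erase z := by
        ext e
        simp only [Finset.mem_sdiff, Finset.mem_insert, Finset.mem_erase]
        grind
      rw [if_pos h, if_pos h', hc, ← Finset.card_erase_add_one hzX, pow_succ]
      ring
    · rw [if_neg h, if_neg (by rwa [← Finset.subset_insert_iff]), mul_zero]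
  · rw [if_neg hzX]
    by_cases h : X ⊆ S
    · rw [if_pos h, if_pos (h.trans (Finset.subset_insert _ _)),
        Finset.insert_sdiff_of_notMem _ hzX,
        Finset.card_insert_of_notMem (fun h' => hz (Finset.mem_sdiff.1 h').1), pow_succ]
      ring
    · rw [if_neg h, if_neg (by rwa [Finset.subset_insert_iff_of_notMem hzX]), mul_zero]

lemma sampleWeight_eq_zero {p : ℝ} {S X : Finset α} (h : ¬ X ⊆ S) : sampleWeight p S X = 0 :=
  if_neg h

lemma sampleWeight_nonneg {p : ℝ} (hp0 : 0 ≤ p) (hp1 : p ≤ 1) (S X : Finset α) :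
    0 ≤ sampleWeight p S X := by
  unfold sampleWeight
  split_ifs
  · exact mul_nonneg (pow_nonneg hp0 _) (pow_nonneg (by linarith) _)
  · exact le_rfl

end

section
variable {α : Type u} [Fintype α] [DecidableEq α] {l : ℕ}

lemma one_div_natCast_nonneg_le_one (l : ℕ) : (0 : ℝ) ≤ 1 / (l : ℝ) ∧ 1 / (l : ℝ) ≤ 1 := by
  refine ⟨by positivity, ?_⟩
  rcases Nat.eq_zero_or_pos l with rfl | h
  · simp
  · rw [div_le_one (by exact_mod_cast h)]
    exact_mod_cast h

lemma sampledUnionValue_mono {φ ψ : Finset α → ℝ} (h : ∀ S, φ S ≤ ψ S) (I : Fin l → Finset α) :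
    sampledUnionValue φ I ≤ sampledUnionValue ψ I := by
  have hp := one_div_natCast_nonneg_le_one l
  exact Finset.sum_le_sum fun J _ => mul_le_mul_of_nonneg_left (h _)
    (Finset.prod_nonneg fun k _ => sampleWeight_nonneg hp.1 hp.2 _ _)

lemma sampledUnionValue_add (φ ψ : Finset α → ℝ) (I : Fin l → Finset α) :
    sampledUnionValue (fun S => φ S + ψ S) I = sampledUnionValue φ I + sampledUnionValue ψ I := by
  simp only [sampledUnionValue, mul_add, Finset.sum_add_distrib]

lemma sampledUnionValue_sub (φ ψ : Finset α → ℝ) (I : Fin l → Finset α) :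
    sampledUnionValue (fun S => φ S - ψ S) I = sampledUnionValue φ I - sampledUnionValue ψ I := by
  simp only [sampledUnionValue, mul_sub, Finset.sum_sub_distrib]

lemma sampledUnionValue_sum {κ : Type*} (t : Finset κ) (φ : κ → Finset α → ℝ)
    (I : Fin l → Finset α) :
    sampledUnionValue (fun S => ∑ i ∈ t, φ i S) I = ∑ i ∈ t, sampledUnionValue (φ i) I := by
  simp only [sampledUnionValue, Finset.mul_sum]
  exact Finset.sum_comm

lemma sampledUnionValue_empty (φ : Finset α → ℝ) :
    sampledUnionValue φ (fun _ : Fin l => ∅) = φ ∅ := by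
  rw [sampledUnionValue, Finset.sum_eq_single (fun _ => ∅)]
  · have : (Finset.univ : Finset (Fin l)).biUnion (fun _ => (∅ : Finset α)) = ∅ := by
      ext
      simp
    rw [this]
    simp [sampleWeight]
  · intro J _ hJ
    obtain ⟨k, hk⟩ := Function.ne_iff.1 hJ
    rw [Finset.prod_eq_zero (Finset.mem_univ k), zero_mul]
    exact sampleWeight_eq_zero fun h => hk (Finset.subset_empty.1 h)
  · simp

/-- Condition on whether the `j`-th sample contains `z`. -/
lemma sampledUnionValue_insert (φ : Finset α → ℝ) {I : Fin l → Finset α} {j : Fin l} {z : α}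
    (hz : z ∉ I j) :
    sampledUnionValue φ (Function.update I j (insert z (I j))) =
      (1 - 1 / (l : ℝ)) * sampledUnionValue φ I +
        1 / (l : ℝ) * sampledUnionValue (fun S => φ (insert z S)) I := by
  set p := 1 / (l : ℝ) with hp
  have hprod : ∀ J : Fin l → Finset α,
      ∏ k, sampleWeight p (Function.update I j (insert z (I j)) k) (J k) =
      sampleWeight p (insert z (I j)) (J j) *
        ∏ k ∈ Finset.univ.erase j, sampleWeight p (I k) (J k) := by
    intro J
    rw [← Finset.mul_prod_erase _ _ (Finset.mem_univ j), Function.update_self]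
    congr 1
    exact Finset.prod_congr rfl fun k hk => by
      rw [Function.update_of_ne (Finset.ne_of_mem_erase hk)]
  have hprod' : ∀ J : Fin l → Finset α, ∏ k, sampleWeight p (I k) (J k) =
      sampleWeight p (I j) (J j) * ∏ k ∈ Finset.univ.erase j, sampleWeight p (I k) (J k) :=
    fun J => (Finset.mul_prod_erase _ _ (Finset.mem_univ j)).symm
  have hzero : ∀ χ : Finset α → ℝ, sampledUnionValue χ I =
      ∑ J ∈ Finset.univ.filter (fun J : Fin l → Finset α => z ∉ J j),
        (sampleWeight p (I j) (J j) * ∏ k ∈ Finset.univ.erase j, sampleWeight p (I k) (J k)) *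
          χ (Finset.univ.biUnion J) := by
    intro χ
    rw [sampledUnionValue, Finset.sum_filter]
    refine Finset.sum_congr rfl fun J _ => ?_
    rw [hprod']
    by_cases h : z ∈ J j
    · rw [sampleWeight_eq_zero fun h' => hz (h' h), if_neg (not_not.2 h)]
      ring
    · rw [if_pos h]
  rw [hzero, hzero, sampledUnionValue,
    ← Finset.sum_filter_add_sum_filter_not Finset.univ fun J : Fin l → Finset α => z ∈ J j,
    add_comm, Finset.mul_sum, Finset.mul_sum]
  congr 1
  · refine Finset.sum_congr rfl fun J hJ => ?_
    rw [hprod, sampleWeight_insert hz, if_neg (Finset.mem_filter.1 hJ).2]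
    ring
  · refine Finset.sum_nbij' (fun J => Function.update J j ((J j).erase z))
      (fun J => Function.update J j (insert z (J j))) ?_ ?_ ?_ ?_ ?_
    · intro J _
      simp
    · intro J _
      simp
    · intro J hJ
      have := (Finset.mem_filter.1 hJ).2
      simp [Finset.insert_erase this]
    · intro J hJ
      have := (Finset.mem_filter.1 hJ).2
      simp [Finset.erase_insert this]
    · intro J hJ
      have hJ' := (Finset.mem_filter.1 hJ).2
      rw [hprod, sampleWeight_insert hz, if_pos hJ', Function.update_self]
      have h1 : ∏ k ∈ Finset.univ.erase j,
          sampleWeight p (I k) (Function.update J j ((J j).erase z) k) =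
          ∏ k ∈ Finset.univ.erase j, sampleWeight p (I k) (J k) :=
        Finset.prod_congr rfl fun k hk => by
          rw [Function.update_of_ne (Finset.ne_of_mem_erase hk)]
      have h2 : insert z (Finset.univ.biUnion (Function.update J j ((J j).erase z))) =
          Finset.univ.biUnion J := by
        ext e
        simp only [Finset.mem_insert, Finset.mem_biUnion, Finset.mem_univ, true_and]
        constructor
        · rintro (rfl | ⟨k, hk⟩)
          · exact ⟨j, hJ'⟩
          · by_cases h : k = j
            · subst h
              rw [Function.update_self] at hk
              exact ⟨k, Finset.mem_of_mem_erase hk⟩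
            · rw [Function.update_of_ne h] at hk
              exact ⟨k, hk⟩
        · rintro ⟨k, hk⟩
          by_cases he : e = z
          · exact Or.inl he
          · refine Or.inr ⟨k, ?_⟩
            by_cases h : k = j
            · subst h
              rw [Function.update_self]
              exact Finset.mem_erase.2 ⟨he, hk⟩
            · rwa [Function.update_of_ne h]
      rw [h1, h2]
      ring

/-- The expected marginal value of `x` for the sampled union. -/
noncomputable def sampledMarginal (f : Finset α → ℝ) (I : Fin l → Finset α) (x : α) : ℝ :=
  sampledUnionValue (fun S => f (insert x S)) I - sampledUnionValue f I

lemma sampledUnionValue_insert_sub (f : Finset α → ℝ) {I : Fin l → Finset α} {j : Fin l} {x : α}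
    (hx : x ∉ I j) :
    sampledUnionValue f (Function.update I j (insert x (I j))) - sampledUnionValue f I =
      1 / (l : ℝ) * sampledMarginal f I x := by
  rw [sampledUnionValue_insert f hx, sampledMarginal]
  ring

/-- Adding some z ≠ x to the family mixes the marginal of `x` with a smaller one. Adding `x` itself
multiplies it by 1 - 1/l, which is a decrease only for nonnegative marginals. As the factor is
positive for l ≥ 2, nonnegativity passes down to the smaller families. -/
lemma sampledMarginal_anti {f : Finset α → ℝ} (hf : IsSubmodular f) (hl : 2 ≤ l)
    {Q A : Fin l → Finset α} (hQA : ∀ k, Q k ⊆ A k) {x : α} (h0 : 0 ≤ sampledMarginal f A x) :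
    sampledMarginal f A x ≤ sampledMarginal f Q x := by
  have hp0 : (0 : ℝ) ≤ 1 / (l : ℝ) := by positivity
  have hl' : (2 : ℝ) ≤ l := by exact_mod_cast hl
  have hp1 : 1 / (l : ℝ) < 1 := by
    rw [div_lt_one (by linarith)]
    linarith
  revert h0
  refine family_induction (P := fun I => 0 ≤ sampledMarginal f I x →
    sampledMarginal f I x ≤ sampledMarginal f Q x) hQA (fun _ => le_rfl) ?_
  intro I j z _ _ hz _ ih h0
  have hI : sampledMarginal f (Function.update I j (insert z (I j))) x =
      (1 - 1 / (l : ℝ)) * sampledMarginal f I x + 1 / (l : ℝ) *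
        sampledUnionValue (fun S => f (insert x (insert z S)) - f (insert z S)) I := by
    rw [sampledMarginal, sampledUnionValue_insert _ hz, sampledUnionValue_insert _ hz,
      sampledMarginal, sampledUnionValue_sub]
    ring
  rw [hI] at h0 ⊢
  by_cases hxz : x = z
  · subst hxz
    have : sampledUnionValue (fun S => f (insert x (insert x S)) - f (insert x S)) I = 0 := by
      simp [sampledUnionValue]
    rw [this, mul_zero, add_zero] at h0 ⊢
    have h1 : 0 ≤ sampledMarginal f I x := nonneg_of_mul_nonneg_right h0 (by linarith)
    exact (mul_le_of_le_one_left h1 (by linarith)).trans (ih h1)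
  · have h1 : sampledUnionValue (fun S => f (insert x (insert z S)) - f (insert z S)) I ≤
        sampledMarginal f I x := by
      rw [sampledMarginal, ← sampledUnionValue_sub]
      exact sampledUnionValue_mono (fun S => hf.marginal_insert_le hxz S) I
    have h2 := mul_le_mul_of_nonneg_left h1 hp0
    have h3 : (1 - 1 / (l : ℝ)) * sampledMarginal f I x + 1 / (l : ℝ) *
        sampledUnionValue (fun S => f (insert x (insert z S)) - f (insert z S)) I ≤
        sampledMarginal f I x := by linarith
    exact h3.trans (ih (h0.trans h3))

/-- This is the sampling bound E g(A(p)) ≥ (1 - p) g(∅) + p g(A), on top of the union of the other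
samples. The induction applies it to `g` and to `g` with `z` inserted. -/
lemma le_sampledUnionValue_update {g : Finset α → ℝ} (hg : IsSubmodular g)
    {I : Fin l → Finset α} {j : Fin l} (hj : I j = ∅) (A : Finset α) :
    (1 - 1 / (l : ℝ)) * sampledUnionValue g I +
      1 / (l : ℝ) * sampledUnionValue (fun S => g (S ∪ A)) I ≤
      sampledUnionValue g (Function.update I j A) := by
  have hp := one_div_natCast_nonneg_le_one l
  set p := 1 / (l : ℝ) with hpdef
  induction A using Finset.induction_on generalizing g with
  | empty =>
    rw [show Function.update I j ∅ = I by rw [← hj, Function.update_eq_self]]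
    simp only [Finset.union_empty]
    linarith
  | insert z A hz ih =>
    have h1 := ih hg
    have h2 := ih (hg.comp_insert z)
    have h3 : sampledUnionValue g (Function.update I j (insert z A)) =
        (1 - p) * sampledUnionValue g (Function.update I j A) +
          p * sampledUnionValue (fun S => g (insert z S)) (Function.update I j A) := by
      have := sampledUnionValue_insert g (I := Function.update I j A) (j := j) (z := z)
        (by simpa using hz)
      rwa [Function.update_self, Function.update_idem] at this
    have h4 : sampledUnionValue g I + sampledUnionValue (fun S => g (S ∪ insert z A)) I ≤
        sampledUnionValue (fun S => g (S ∪ A)) I +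
          sampledUnionValue (fun S => g (insert z S)) I := by
      rw [← sampledUnionValue_add, ← sampledUnionValue_add]
      refine sampledUnionValue_mono (fun S => ?_) I
      have := hg (S ∪ A) (insert z S)
      have e1 : S ∪ A ∪ insert z S = S ∪ insert z A := by
        ext
        simp only [Finset.mem_union, Finset.mem_insert]
        tauto
      have e2 : (S ∪ A) ∩ insert z S = S := by
        ext e
        simp only [Finset.mem_union, Finset.mem_insert, Finset.mem_inter]
        constructor
        · rintro ⟨h | h, rfl | h'⟩
          · exact h
          · exact h
          · exact absurd h hz
          · exact h'
        · exact fun h => ⟨Or.inl h, Or.inr h⟩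
      rw [e1, e2] at this
      linarith
    have h5 : sampledUnionValue (fun S => g (insert z (S ∪ A))) I =
        sampledUnionValue (fun S => g (S ∪ insert z A)) I := by
      simp only [Finset.union_insert]
    rw [h5] at h2
    rw [h3]
    -- The combination (1 - p) `h1` + p `h2` differs from the goal by p(1 - p) times the two sides
    -- of `h4`.
    have h6 := mul_le_mul_of_nonneg_left h1 (sub_nonneg.2 hp.2)
    have h7 := mul_le_mul_of_nonneg_left h2 hp.1
    have h8 := mul_le_mul_of_nonneg_left h4 (mul_nonneg hp.1 (sub_nonneg.2 hp.2))
    linarith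

/-- If the sets after the `k`-th one are empty, then every element belongs to the sampled union with
probability at most `1 - (1 - 1 / l) ^ k`, whence a lower bound for its union with `C`. -/
lemma le_sampledUnionValue_union {f : Finset α → ℝ} (hf : IsSubmodular f) (hnn : ∀ S, 0 ≤ f S)
    (C : Finset α) (I : Fin l → Finset α) (k : ℕ) (hI : ∀ i : Fin l, k ≤ i → I i = ∅) :
    (1 - 1 / (l : ℝ)) ^ k * f C ≤ sampledUnionValue (fun S => f (S ∪ C)) I := by
  have hp := one_div_natCast_nonneg_le_one l
  induction k generalizing I with
  | zero =>
    rw [show I = fun _ => ∅ from funext fun i => hI i (Nat.zero_le _), sampledUnionValue_empty]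
    simp
  | succ k ih =>
    by_cases hk : k < l
    · have h1 := le_sampledUnionValue_update (hf.comp_union C)
        (I := Function.update I ⟨k, hk⟩ ∅) (j := ⟨k, hk⟩) (by simp) (I ⟨k, hk⟩)
      rw [Function.update_idem, Function.update_eq_self] at h1
      have h2 := ih (Function.update I ⟨k, hk⟩ ∅) fun i hi => by
        by_cases h : i = ⟨k, hk⟩
        · rw [h, Function.update_self]
        · rw [Function.update_of_ne h]
          refine hI i ?_
          have : (i : ℕ) ≠ k := fun h' => h (Fin.ext h')
          omega
      -- The second term of `h1` is discarded by nonnegativity, so each nonempty set costs one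
      -- factor 1 - 1/l.
      have h3 : 0 ≤ sampledUnionValue (fun S => f (S ∪ I ⟨k, hk⟩ ∪ C))
          (Function.update I ⟨k, hk⟩ ∅) := by
        have := sampledUnionValue_mono (φ := fun _ => 0)
          (fun S => hnn (S ∪ I ⟨k, hk⟩ ∪ C)) (Function.update I ⟨k, hk⟩ ∅)
        simpa [sampledUnionValue] using this
      have h4 := mul_le_mul_of_nonneg_left h2 (sub_nonneg.2 hp.2)
      have h5 := mul_nonneg hp.1 h3
      rw [pow_succ']
      linarith
    · have h2 := ih I fun i hi => absurd i.2 (by omega)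
      refine le_trans ?_ h2
      refine mul_le_mul_of_nonneg_right ?_ (hnn C)
      exact pow_le_pow_of_le_one (sub_nonneg.2 hp.2) (by linarith) (Nat.le_succ k)

lemma le_sum_sampledMarginal {f : Finset α → ℝ} (hf : IsSubmodular f) (C : Finset α)
    (I : Fin l → Finset α) :
    sampledUnionValue (fun S => f (S ∪ C)) I - sampledUnionValue f I ≤
      ∑ x ∈ C, sampledMarginal f I x := by
  have h := sampledUnionValue_mono (fun S => hf.union_le S C) I
  rw [sampledUnionValue_add, sampledUnionValue_sum] at h
  simp only [sampledUnionValue_sub] at h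
  simp only [sampledMarginal]
  linarith

/-! ### The multilinear extension, pipage rounding, and the bound by the optimum. -/

/-- The multilinear extension of a set function. -/
noncomputable def mlExt (f : Finset α → ℝ) (y : α → ℝ) : ℝ :=
  ∑ S : Finset α, ((∏ e ∈ S, y e) * ∏ e ∈ Sᶜ, (1 - y e)) * f S

lemma mlExt_eq_sum_filter (f : Finset α → ℝ) (y : α → ℝ) (z : α) (t : ℝ) :
    mlExt f (Function.update y z t) = ∑ S ∈ Finset.univ.filter (fun S : Finset α => z ∉ S),
      ((∏ e ∈ S, y e) * ∏ e ∈ Sᶜ.erase z, (1 - y e)) * ((1 - t) * f S + t * f (insert z S)) := by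
  have h1 : ∀ S : Finset α, z ∉ S → ∏ e ∈ S, Function.update y z t e = ∏ e ∈ S, y e :=
    fun S hS => Finset.prod_congr rfl fun e he => by
      rw [Function.update_of_ne]
      rintro rfl
      exact hS he
  have h2 : ∀ S : Finset α, z ∉ S → ∏ e ∈ S, (1 - Function.update y z t e) = ∏ e ∈ S, (1 - y e) :=
    fun S hS => Finset.prod_congr rfl fun e he => by
      rw [Function.update_of_ne]
      rintro rfl
      exact hS he
  rw [mlExt, ← Finset.sum_filter_add_sum_filter_not Finset.univ fun S : Finset α => z ∉ S]
  simp only [mul_add, Finset.sum_add_distrib]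
  congr 1
  · refine Finset.sum_congr rfl fun S hS => ?_
    have hS' := (Finset.mem_filter.1 hS).2
    rw [h1 S hS', ← Finset.mul_prod_erase Sᶜ _ (Finset.mem_compl.2 hS'), Function.update_self,
      h2 _ (Finset.notMem_erase _ _)]
    ring
  · refine Finset.sum_nbij' (fun S => S.erase z) (fun S => insert z S) ?_ ?_ ?_ ?_ ?_
    · intro S _
      simp
    · intro S _
      simp
    · intro S hS
      exact Finset.insert_erase (not_not.1 (Finset.mem_filter.1 hS).2)
    · intro S hS
      exact Finset.erase_insert (Finset.mem_filter.1 hS).2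
    · intro S hS
      have hS' := not_not.1 (Finset.mem_filter.1 hS).2
      have hc : (S.erase z)ᶜ.erase z = Sᶜ := by
        ext e
        simp only [Finset.mem_erase, Finset.mem_compl]
        grind
      rw [← Finset.mul_prod_erase S _ hS', Function.update_self, h1 _ (Finset.notMem_erase _ _),
        h2 _ (by simpa using hS'), Finset.insert_erase hS', hc]
      ring

lemma mlExt_update (f : Finset α → ℝ) (y : α → ℝ) (z : α) (t : ℝ) :
    mlExt f (Function.update y z t) = (1 - t) * mlExt (fun S => f (S.erase z)) y +
      t * mlExt (fun S => f (insert z S)) y := by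
  have h : ∀ g : Finset α → ℝ, mlExt g y = mlExt g (Function.update y z (y z)) := fun g => by
    rw [Function.update_eq_self]
  rw [h, h (fun S => f (insert z S)), mlExt_eq_sum_filter, mlExt_eq_sum_filter,
    mlExt_eq_sum_filter, Finset.mul_sum, Finset.mul_sum, ← Finset.sum_add_distrib]
  refine Finset.sum_congr rfl fun S hS => ?_
  have hS' := (Finset.mem_filter.1 hS).2
  simp only [Finset.insert_idem, Finset.erase_insert hS', Finset.erase_eq_of_notMem hS']
  ring

lemma mlExt_split (f : Finset α → ℝ) (y : α → ℝ) (z : α) :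
    mlExt f y = (1 - y z) * mlExt (fun S => f (S.erase z)) y +
      y z * mlExt (fun S => f (insert z S)) y := by
  rw [← mlExt_update, Function.update_eq_self]

lemma mlExt_mono {f g : Finset α → ℝ} (h : ∀ S, f S ≤ g S) {y : α → ℝ} (hy0 : ∀ e, 0 ≤ y e)
    (hy1 : ∀ e, y e ≤ 1) : mlExt f y ≤ mlExt g y :=
  Finset.sum_le_sum fun S _ => mul_le_mul_of_nonneg_left (h S)
    (mul_nonneg (Finset.prod_nonneg fun e _ => hy0 e)
      (Finset.prod_nonneg fun e _ => sub_nonneg.2 (hy1 e)))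

lemma mlExt_add (f g : Finset α → ℝ) (y : α → ℝ) :
    mlExt (fun S => f S + g S) y = mlExt f y + mlExt g y := by
  simp only [mlExt, mul_add, Finset.sum_add_distrib]

lemma mlExt_indicator (f : Finset α → ℝ) (B : Finset α) :
    mlExt f (fun e => if e ∈ B then 1 else 0) = f B := by
  rw [mlExt, Finset.sum_eq_single B]
  · rw [Finset.prod_congr rfl fun e he => if_pos he, Finset.prod_congr (s₁ := Bᶜ) rfl fun e he => by
      rw [if_neg (Finset.mem_compl.1 he), sub_zero]]
    simp
  · intro S _ hS
    have : ∃ e, ¬ (e ∈ S ↔ e ∈ B) := by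
      by_contra! h
      exact hS (Finset.ext h)
    obtain ⟨e, he⟩ := this
    by_cases heS : e ∈ S
    · rw [Finset.prod_eq_zero heS (if_neg (by tauto))]
      ring
    · rw [Finset.prod_eq_zero (i := e) (s := Sᶜ) (Finset.mem_compl.2 heS)]
      · ring
      · rw [if_pos (by tauto)]
        ring
  · simp

/-- The number of sets of the family that contain `e`. -/
def coverCount (I : Fin l → Finset α) (e : α) : ℕ :=
  (Finset.univ.filter fun k => e ∈ I k).card

lemma coverCount_update (I : Fin l → Finset α) {j : Fin l} {z : α} (hz : z ∉ I j) :
    coverCount (Function.update I j (insert z (I j))) =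
      Function.update (coverCount I) z (coverCount I z + 1) := by
  funext e
  by_cases he : e = z
  · subst he
    rw [Function.update_self, coverCount, coverCount,
      ← Finset.card_insert_of_notMem (a := j) (by simpa using hz)]
    congr 1
    ext k
    by_cases hk : k = j <;> simp [hk]
  · rw [Function.update_of_ne he, coverCount, coverCount]
    congr 1
    ext k
    by_cases hk : k = j
    · subst hk
      simp [he]
    · simp [hk]

/-- An element avoids the union exactly if each of the `coverCount` samples that could contain it
misses it, and distinct elements behave independently. -/
lemma sampledUnionValue_eq_mlExt (f : Finset α → ℝ) (I : Fin l → Finset α) :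
    sampledUnionValue f I = mlExt f fun e => 1 - (1 - 1 / (l : ℝ)) ^ coverCount I e := by
  refine family_induction (P := fun I => ∀ f : Finset α → ℝ, sampledUnionValue f I =
    mlExt f fun e => 1 - (1 - 1 / (l : ℝ)) ^ coverCount I e) (Q := fun _ => ∅) (A := I)
    (fun _ => Finset.empty_subset _) ?_ ?_ f
  · intro f
    have := mlExt_indicator f ∅
    simp only [Finset.notMem_empty, if_false] at this
    rw [sampledUnionValue_empty]
    simp [coverCount, this]
  · intro I j z _ _ hz _ ih f
    have h1 : (fun e => 1 - (1 - 1 / (l : ℝ)) ^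
        coverCount (Function.update I j (insert z (I j))) e) =
        Function.update (fun e => 1 - (1 - 1 / (l : ℝ)) ^ coverCount I e) z
          (1 - (1 - 1 / (l : ℝ)) ^ (coverCount I z + 1)) := by
      funext e
      rw [coverCount_update I hz]
      by_cases he : e = z
      · subst he
        simp
      · simp [he]
    rw [h1, mlExt_update, sampledUnionValue_insert f hz, ih, ih,
      mlExt_split f _ z, mlExt_split (fun S => f (insert z S)) _ z]
    have h2 : (fun S : Finset α => f (insert z (S.erase z))) = fun S => f (insert z S) := by
      funext S
      congr 1
      ext e
      by_cases he : e = z <;> simp [he]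
    simp only [Finset.insert_idem, h2]
    ring

/-- Every coordinate can be replaced by a larger value or by zero. -/
lemma exists_le_mlExt_sdiff (f : Finset α → ℝ) {x y : α → ℝ} (hy0 : ∀ e, 0 ≤ y e)
    (hyx : ∀ e, y e ≤ x e) : ∃ R : Finset α, mlExt f y ≤ mlExt (fun S => f (S \ R)) x := by
  suffices h : ∀ s : Finset α, ∃ R : Finset α, mlExt f y ≤
      mlExt (fun S => f (S \ R)) fun e => if e ∈ s then x e else y e by
    simpa using h Finset.univ
  intro s
  induction s using Finset.induction_on with
  | empty => exact ⟨∅, by simp⟩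
  | insert z s hz ih =>
    obtain ⟨R, hR⟩ := ih
    set w : α → ℝ := fun e => if e ∈ s then x e else y e with hw
    have hupd : (fun e => if e ∈ insert z s then x e else y e) = Function.update w z (x z) := by
      funext e
      by_cases he : e = z
      · subst he
        simp
      · simp [he, hw]
    have hwz : w z = y z := if_neg hz
    rw [mlExt_split (fun S => f (S \ R)) w z, hwz] at hR
    rw [hupd]
    -- The extension is affine in the coordinate `z`. If it increases, the coordinate is raised to
    -- `x z`. Otherwise it is lowered to 0, which is expressed by deleting `z` from all sets.
    rcases le_total (mlExt (fun S => f (S.erase z \ R)) w) (mlExt (fun S => f (insert z S \ R)) w)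
      with h | h
    · refine ⟨R, hR.trans ?_⟩
      rw [mlExt_update]
      nlinarith [hyx z]
    · refine ⟨insert z R, hR.trans ?_⟩
      have e1 : (fun S : Finset α => f (S \ insert z R)) = fun S => f (S.erase z \ R) := by
        funext S
        rw [Finset.sdiff_insert, Finset.erase_sdiff_comm]
      rw [e1, mlExt_update]
      have e2 : (fun S : Finset α => f ((insert z S).erase z \ R)) =
          fun S => f (S.erase z \ R) := by
        funext S
        rw [Finset.erase_insert_eq_erase]
      simp only [Finset.erase_idem, e2]
      nlinarith [hy0 z]

/-- The multilinear extension of a submodular function is convex along differences of unit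
vectors. -/
lemma mlExt_convex {f : Finset α → ℝ} (hf : IsSubmodular f) {x : α → ℝ} (hx0 : ∀ e, 0 ≤ x e)
    (hx1 : ∀ e, x e ≤ 1) {z z' : α} (q : ℝ) :
    2 * mlExt f x ≤ mlExt f (Function.update (Function.update x z (x z + q)) z' (x z' - q)) +
      mlExt f (Function.update (Function.update x z (x z - q)) z' (x z' + q)) := by
  have h : ∀ s t, mlExt f (Function.update (Function.update x z s) z' t) =
      (1 - t) * ((1 - s) * mlExt (fun S => f ((S.erase z).erase z')) x +
        s * mlExt (fun S => f ((insert z S).erase z')) x) +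
      t * ((1 - s) * mlExt (fun S => f (insert z' (S.erase z))) x +
        s * mlExt (fun S => f (insert z' (insert z S))) x) := by
    intro s t
    rw [mlExt_update, mlExt_update, mlExt_update]
  have h0 : mlExt f x = mlExt f (Function.update (Function.update x z (x z)) z' (x z')) := by
    rw [Function.update_eq_self, Function.update_eq_self]
  -- Submodularity makes the mixed second difference in `z`, `z'` nonpositive. Along opposite
  -- changes ±q of the two coordinates it enters with the factor -q².
  have key : mlExt (fun S => f ((S.erase z).erase z')) x +
      mlExt (fun S => f (insert z' (insert z S))) x ≤
      mlExt (fun S => f ((insert z S).erase z')) x +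
        mlExt (fun S => f (insert z' (S.erase z))) x := by
    rw [← mlExt_add, ← mlExt_add]
    refine mlExt_mono (fun S => ?_) hx0 hx1
    have h1 := hf ((insert z S).erase z') (insert z' (S.erase z))
    have e1 : (insert z S).erase z' ∪ insert z' (S.erase z) = insert z' (insert z S) := by
      ext e
      simp only [Finset.mem_union, Finset.mem_erase, Finset.mem_insert]
      grind
    have e2 : (insert z S).erase z' ∩ insert z' (S.erase z) = (S.erase z).erase z' := by
      ext e
      simp only [Finset.mem_inter, Finset.mem_erase, Finset.mem_insert]
      grind
    rw [e1, e2] at h1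
    linarith
  rw [h0, h, h, h]
  nlinarith [mul_le_mul_of_nonneg_left key (sq_nonneg q)]

/-- Symmetric exchange for bases. -/
lemma Matroid.IsBase.exists_symm_exchange {M : Matroid α} {B B' : Set α} (hB : M.IsBase B)
    (hB' : M.IsBase B') {e : α} (he : e ∈ B) (he' : e ∉ B') :
    ∃ e' ∈ B', e' ∉ B ∧ M.IsBase (insert e' (B \ {e})) ∧ M.IsBase (insert e (B' \ {e'})) := by
  have heE := hB.subset_ground he
  have hcirc := hB'.fundCircuit_isCircuit heE he'
  have hnot : e ∉ M.closure (B \ {e}) := hB.indep.notMem_closure_sdiff_of_mem he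
  -- If the rest of the fundamental circuit of `e` lay in the closure of B \ {e}, so would `e`.
  obtain ⟨e', he'C, hne, hcl⟩ : ∃ e' ∈ M.fundCircuit e B', e' ≠ e ∧ e' ∉ M.closure (B \ {e}) := by
    by_contra! hcon
    refine hnot ?_
    have h1 := hcirc.mem_closure_sdiff_singleton_of_mem (M.mem_fundCircuit e B')
    refine M.closure_subset_closure_of_subset_closure (fun x hx => ?_) h1
    exact hcon x hx.1 hx.2
  have he'B' : e' ∈ B' := ((M.fundCircuit_subset_insert e B') he'C).resolve_left hne
  have he'E := hB'.subset_ground he'B'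
  have he'B : e' ∉ B := fun h => hcl (M.subset_closure (B \ {e})
    (Set.sdiff_subset.trans hB.subset_ground) ⟨h, hne⟩)
  refine ⟨e', he'B', he'B, hB.exchange_base_of_notMem_closure he hcl he'E, ?_⟩
  rw [Set.insert_sdiff_singleton_comm hne.symm]
  refine hB'.exchange_isBase_of_indep' he'B' he' ?_
  exact (hB'.indep.mem_fundCircuit_iff (hB'.closure_eq ▸ heE) he').1 he'C

/-- Pipage rounding of the average of a family of bases. -/
lemma exists_isBase_mlExt_le {M : Matroid α} {f : Finset α → ℝ} (hf : IsSubmodular f) (hl : 0 < l)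
    (B : Fin l → Finset α) (hB : ∀ k, M.IsBase (B k : Set α)) :
    ∃ D : Finset α, M.IsBase (D : Set α) ∧
      mlExt f (fun e => (coverCount B e : ℝ) / l) ≤ f D := by
  classical
  have hl' : (0 : ℝ) < l := by exact_mod_cast hl
  set F : (Fin l → Finset α) → ℝ := fun B => mlExt f (fun e => (coverCount B e : ℝ) / l) with hF
  set 𝒞 := Finset.univ.filter fun B : Fin l → Finset α => ∀ k, M.IsBase (B k : Set α) with h𝒞
  obtain ⟨B₁, hB₁, hmax⟩ := Finset.exists_max_image 𝒞 F ⟨B, by simpa [h𝒞] using hB⟩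
  set k₀ : Fin l := ⟨0, hl⟩
  -- Among the families of maximal value, one closest to being constant is chosen. It is then shown
  -- to be constant.
  obtain ⟨B₂, hB₂, hmin⟩ := Finset.exists_min_image (𝒞.filter fun B => F B₁ ≤ F B)
    (fun B => ∑ k, (B k₀ \ B k).card) ⟨B₁, Finset.mem_filter.2 ⟨hB₁, le_rfl⟩⟩
  rw [Finset.mem_filter] at hB₂
  have hb : ∀ k, M.IsBase (B₂ k : Set α) := (Finset.mem_filter.1 hB₂.1).2
  have hall : ∀ k, B₂ k = B₂ k₀ := by
    by_contra! hcon
    obtain ⟨k, hk⟩ := hcon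
    have hk0 : k ≠ k₀ := fun h => hk (h ▸ rfl)
    have hns : ¬ (B₂ k₀ ⊆ B₂ k) := fun h => hk
      (Finset.coe_injective ((hb k₀).eq_of_subset_isBase (hb k) (Finset.coe_subset.2 h)).symm)
    obtain ⟨e, he, he'⟩ := Finset.not_subset.1 hns
    obtain ⟨e', h1, h2, h3, h4⟩ := (hb k₀).exists_symm_exchange (hb k)
      (e := e) (by simpa using he) (by simpa using he')
    simp only [Finset.mem_coe] at h1 h2
    have hne : e ≠ e' := fun h => he' (h ▸ h1)
    set N' := insert e' ((B₂ k₀).erase e) with hN'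
    set N'' := insert e ((B₂ k).erase e') with hN''
    have hc' : Function.update B₂ k₀ N' ∈ 𝒞 := by
      refine Finset.mem_filter.2 ⟨Finset.mem_univ _, fun i => ?_⟩
      by_cases hi : i = k₀
      · rw [hi, Function.update_self]
        simpa [hN'] using h3
      · rw [Function.update_of_ne hi]
        exact hb i
    have hc'' : Function.update B₂ k N'' ∈ 𝒞 := by
      refine Finset.mem_filter.2 ⟨Finset.mem_univ _, fun i => ?_⟩
      by_cases hi : i = k
      · rw [hi, Function.update_self]
        simpa [hN''] using h4
      · rw [Function.update_of_ne hi]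
        exact hb i
    have hmult : ∀ (i : Fin l) (a b : α), a ∈ B₂ i → b ∉ B₂ i →
        (fun c => (coverCount (Function.update B₂ i (insert b ((B₂ i).erase a))) c : ℝ) / l) =
        Function.update (Function.update (fun c => (coverCount B₂ c : ℝ) / l) b
          ((coverCount B₂ b : ℝ) / l + 1 / l)) a ((coverCount B₂ a : ℝ) / l - 1 / l) := by
      intro i a b ha hbi
      have hab : a ≠ b := fun h => hbi (h ▸ ha)
      set J := Function.update B₂ i ((B₂ i).erase a) with hJ
      have hJi : J i = (B₂ i).erase a := Function.update_self _ _ _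
      have m1 := coverCount_update J (j := i) (z := b) (by simp [hJi, hbi])
      have m2 := coverCount_update J (j := i) (z := a) (by simp [hJi])
      rw [hJi, hJ, Function.update_idem, ← hJ] at m1
      rw [hJi, hJ, Function.update_idem, ← hJ, Finset.insert_erase ha,
        Function.update_eq_self] at m2
      funext c
      rw [m1, m2]
      by_cases hca : c = a
      · subst hca
        rw [Function.update_of_ne hab, Function.update_self, Function.update_self]
        push_cast
        ring
      · by_cases hcb : c = b
        · subst hcb
          rw [Function.update_self, Function.update_of_ne hca, Function.update_self,
            Function.update_of_ne hca]
          push_cast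
          ring
        · rw [Function.update_of_ne hcb, Function.update_of_ne hca, Function.update_of_ne hcb,
            Function.update_of_ne hca]
    have hx0 : ∀ c, 0 ≤ (coverCount B₂ c : ℝ) / l := fun c => by positivity
    have hx1 : ∀ c, (coverCount B₂ c : ℝ) / l ≤ 1 := fun c => by
      rw [div_le_one hl']
      have := Finset.card_le_univ (Finset.univ.filter fun k => c ∈ B₂ k)
      rw [Fintype.card_fin] at this
      exact_mod_cast this
    have hconv := mlExt_convex (z := e) (z' := e') hf hx0 hx1 (1 / (l : ℝ))
    have hF' : F (Function.update B₂ k₀ N') = mlExt f (Function.update (Function.update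
        (fun c => (coverCount B₂ c : ℝ) / l) e ((coverCount B₂ e : ℝ) / l - 1 / l)) e'
        ((coverCount B₂ e' : ℝ) / l + 1 / l)) := by
      rw [hF]
      simp only
      rw [hN', hmult k₀ e e' he h2, Function.update_comm hne]
    have hF'' : F (Function.update B₂ k N'') = mlExt f (Function.update (Function.update
        (fun c => (coverCount B₂ c : ℝ) / l) e ((coverCount B₂ e : ℝ) / l + 1 / l)) e'
        ((coverCount B₂ e' : ℝ) / l - 1 / l)) := by
      rw [hF]
      simp only
      rw [hN'', hmult k e' e h1 he']
    -- Exchanging `e` and `e'` in `B₂ k₀` or in `B₂ k` moves the average by opposite vectors. By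
    -- convexity and maximality, the exchange in `B₂ k` keeps the value maximal, and it brings `B₂
    -- k` closer to `B₂ k₀`.
    rw [← hF', ← hF''] at hconv
    have g1 := hmax _ hc'
    have g2 : F B₁ ≤ F B₂ := hB₂.2
    have g3 : F B₁ ≤ F (Function.update B₂ k N'') := by
      have : 2 * F B₂ ≤ F (Function.update B₂ k N'') + F (Function.update B₂ k₀ N') := hconv
      linarith
    have g4 := hmin _ (Finset.mem_filter.2 ⟨hc'', g3⟩)
    refine absurd g4 (not_le.2 (Finset.sum_lt_sum (fun i _ => ?_) ⟨k, Finset.mem_univ k, ?_⟩))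
    · rw [Function.update_of_ne hk0.symm]
      by_cases hi : i = k
      · subst hi
        rw [Function.update_self]
        refine Finset.card_le_card fun c hc => ?_
        simp only [hN'', Finset.mem_sdiff, Finset.mem_insert, Finset.mem_erase] at hc ⊢
        refine ⟨hc.1, fun h => hc.2 (Or.inr ⟨?_, h⟩)⟩
        rintro rfl
        exact h2 hc.1
      · rw [Function.update_of_ne hi]
    · rw [Function.update_of_ne hk0.symm, Function.update_self]
      refine Finset.card_lt_card (Finset.ssubset_iff_subset_ne.2 ⟨fun c hc => ?_, fun h => ?_⟩)
      · simp only [hN'', Finset.mem_sdiff, Finset.mem_insert, Finset.mem_erase] at hc ⊢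
        refine ⟨hc.1, fun h => hc.2 (Or.inr ⟨?_, h⟩)⟩
        rintro rfl
        exact h2 hc.1
      · have : e ∈ B₂ k₀ \ B₂ k := Finset.mem_sdiff.2 ⟨he, he'⟩
        rw [← h] at this
        simp [hN''] at this
  refine ⟨B₂ k₀, hb k₀, ?_⟩
  have hind : (fun e => (coverCount B₂ e : ℝ) / l) = fun e => if e ∈ B₂ k₀ then 1 else 0 := by
    funext e
    simp only [coverCount]
    simp only [hall]
    split_ifs with h
    · simp [h, hl'.ne']
    · simp [h]
  calc F B ≤ F B₁ := hmax B (by simpa [h𝒞] using hB)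
    _ ≤ F B₂ := hB₂.2
    _ = f (B₂ k₀) := by rw [hF]; simp only; rw [hind, mlExt_indicator]

/-- The sampled union of independent sets does not exceed the optimum in expectation. -/
theorem sampledUnionValue_le_optValue {M : Matroid α} {f : Finset α → ℝ} (hf : IsSubmodular f)
    (hl : 0 < l) (I : Fin l → Finset α) (hI : ∀ k, M.Indep (I k : Set α)) :
    sampledUnionValue f I ≤ optValue M f := by
  have hl' : (0 : ℝ) < l := by exact_mod_cast hl
  have hp := one_div_natCast_nonneg_le_one l
  choose B hB hIB using fun k => (hI k).exists_isBase_superset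
  have hBfin : ∀ k, ∃ D : Finset α, (D : Set α) = B k := fun k =>
    ⟨(Set.toFinite (B k)).toFinset, by simp⟩
  choose D hD using hBfin
  rw [sampledUnionValue_eq_mlExt]
  -- By Bernoulli's inequality 1 - (1 - 1/l)^c ≤ c/l, so the average of bases containing the sets
  -- dominates the point. As `f` need not be monotone, the passage to a larger point goes through
  -- the deletion of some `R`.
  obtain ⟨R, hR⟩ := exists_le_mlExt_sdiff f (y := fun e => 1 - (1 - 1 / (l : ℝ)) ^ coverCount I e)
    (x := fun e => (coverCount D e : ℝ) / l)
    (fun e => sub_nonneg.2 (pow_le_one₀ (sub_nonneg.2 hp.2) (by linarith)))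
    (fun e => by
      have h1 := one_add_mul_le_pow (a := -(1 / (l : ℝ))) (by linarith) (coverCount I e)
      have h2 : (coverCount I e : ℝ) ≤ coverCount D e := by
        have : coverCount I e ≤ coverCount D e := Finset.card_le_card fun k hk => by
          simp only [Finset.mem_filter, Finset.mem_univ, true_and] at hk ⊢
          have := hIB k hk
          rwa [← hD] at this
        exact_mod_cast this
      have h3 : (coverCount I e : ℝ) / l ≤ coverCount D e / l := by gcongr
      rw [← sub_eq_add_neg] at h1
      have h4 : (coverCount I e : ℝ) / l = coverCount I e * (1 / l) := by ring
      linarith)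
  obtain ⟨E, hE, hle⟩ := exists_isBase_mlExt_le (M := M) (hf.comp_sdiff R) hl D
    fun k => by rw [hD]; exact hB k
  refine hR.trans (hle.trans (le_optValue (hE.indep.subset ?_) f))
  exact Finset.coe_subset.2 Finset.sdiff_subset

end

/-! ### Concentration: empirical estimates that are accurate on all families. -/

section
variable {Ω : Type*} [Fintype Ω]

lemma exp_mul_le_cosh_add (κ : ℝ) {x : ℝ} (h1 : -1 ≤ x) (h2 : x ≤ 1) :
    Real.exp (κ * x) ≤ Real.cosh κ + x * Real.sinh κ := by
  have h := convexOn_exp.2 (Set.mem_univ κ) (Set.mem_univ (-κ))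
    (show 0 ≤ (1 + x) / 2 by linarith) (show 0 ≤ (1 - x) / 2 by linarith) (by ring)
  simp only [smul_eq_mul] at h
  rw [show (1 + x) / 2 * κ + (1 - x) / 2 * -κ = κ * x by ring] at h
  rw [Real.cosh_eq, Real.sinh_eq]
  linarith

open scoped Classical in
/-- Hoeffding's inequality for the mean of independent uniform samples. -/
lemma card_le_of_mean_zero {X : Ω → ℝ} (h1 : ∀ a, -1 ≤ X a) (h2 : ∀ a, X a ≤ 1)
    (h0 : ∑ a, X a = 0) {κ : ℝ} (hκ : 0 ≤ κ) (m : ℕ) :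
    ((Finset.univ.filter fun ω : Fin m → Ω => m * κ ≤ ∑ i, X (ω i)).card : ℝ) ≤
      Fintype.card (Fin m → Ω) * Real.exp (-(m * κ ^ 2 / 2)) := by
  have hsum : ∑ a, Real.exp (κ * X a) ≤ Fintype.card Ω * Real.exp (κ ^ 2 / 2) := by
    calc ∑ a, Real.exp (κ * X a) ≤ ∑ a, (Real.cosh κ + X a * Real.sinh κ) :=
          Finset.sum_le_sum fun a _ => exp_mul_le_cosh_add κ (h1 a) (h2 a)
      _ = Fintype.card Ω * Real.cosh κ := by
          rw [Finset.sum_add_distrib, ← Finset.sum_mul, h0]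
          simp
      _ ≤ _ := mul_le_mul_of_nonneg_left (Real.cosh_le_exp_half_sq κ) (Nat.cast_nonneg _)
  -- For deviation mκ the exponential parameter κ is the best one: the exponent is mκ²/2 - mκ².
  have hmgf : ∑ ω : Fin m → Ω, Real.exp (κ * ∑ i, X (ω i)) ≤
      Fintype.card (Fin m → Ω) * Real.exp (m * κ ^ 2 / 2) := by
    calc ∑ ω : Fin m → Ω, Real.exp (κ * ∑ i, X (ω i))
        = (∑ a, Real.exp (κ * X a)) ^ m := by
          rw [Fintype.sum_pow]
          exact Finset.sum_congr rfl fun ω _ => by rw [Finset.mul_sum, Real.exp_sum]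
      _ ≤ (Fintype.card Ω * Real.exp (κ ^ 2 / 2)) ^ m :=
          pow_le_pow_left₀ (Finset.sum_nonneg fun a _ => (Real.exp_pos _).le) hsum m
      _ = _ := by
          rw [mul_pow, ← Real.exp_nat_mul, Fintype.card_pi_const]
          push_cast
          ring_nf
  have hmarkov : ((Finset.univ.filter fun ω : Fin m → Ω => m * κ ≤ ∑ i, X (ω i)).card : ℝ) *
      Real.exp (m * κ ^ 2) ≤ ∑ ω : Fin m → Ω, Real.exp (κ * ∑ i, X (ω i)) := by
    rw [← nsmul_eq_mul]
    refine (Finset.card_nsmul_le_sum _ (fun ω => Real.exp (κ * ∑ i, X (ω i))) _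
      fun ω hω => ?_).trans (Finset.sum_le_sum_of_subset_of_nonneg (Finset.filter_subset _ _)
        fun _ _ _ => (Real.exp_pos _).le)
    refine Real.exp_le_exp.2 ?_
    have := mul_le_mul_of_nonneg_left (Finset.mem_filter.1 hω).2 hκ
    linarith
  have h := hmarkov.trans hmgf
  rw [← le_div_iff₀ (Real.exp_pos _), mul_div_assoc, ← Real.exp_sub] at h
  rwa [show (m : ℝ) * κ ^ 2 / 2 - m * κ ^ 2 = -(m * κ ^ 2 / 2) by ring] at h

end

section
variable {α : Type u} [Fintype α] [DecidableEq α] {l : ℕ}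

/-- The union of the samples determined by a table of coins: the `k`-th sample consists of the
elements `e` of `I k` whose coin `(k, e)` shows zero. -/
def coinUnion (I : Fin l → Finset α) (ω : Fin l × α → Fin l) : Finset α :=
  Finset.univ.filter fun e => ∃ k, e ∈ I k ∧ (ω (k, e)).val = 0

lemma coinUnion_empty (ω : Fin l × α → Fin l) : coinUnion (fun _ => ∅) ω = ∅ := by
  simp [coinUnion]

lemma coinUnion_insert (I : Fin l → Finset α) (j : Fin l) (z : α) (ω : Fin l × α → Fin l) :
    coinUnion (Function.update I j (insert z (I j))) ω =
      if (ω (j, z)).val = 0 then insert z (coinUnion I ω) else coinUnion I ω := by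
  have h : ∀ e, (∃ k, e ∈ Function.update I j (insert z (I j)) k ∧ (ω (k, e)).val = 0) ↔
      (e = z ∧ (ω (j, z)).val = 0) ∨ ∃ k, e ∈ I k ∧ (ω (k, e)).val = 0 := by
    intro e
    constructor
    · rintro ⟨k, hk, hω⟩
      by_cases h : k = j
      · subst h
        rw [Function.update_self, Finset.mem_insert] at hk
        rcases hk with rfl | hk
        · exact Or.inl ⟨rfl, hω⟩
        · exact Or.inr ⟨k, hk, hω⟩
      · rw [Function.update_of_ne h] at hk
        exact Or.inr ⟨k, hk, hω⟩
    · rintro (⟨rfl, hω⟩ | ⟨k, hk, hω⟩)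
      · exact ⟨j, by simp, hω⟩
      · refine ⟨k, ?_, hω⟩
        by_cases h : k = j
        · subst h
          simp [hk]
        · rwa [Function.update_of_ne h]
  ext e
  simp only [coinUnion, Finset.mem_filter, Finset.mem_univ, true_and, h]
  split_ifs with h0
  · simp [h0]
  · simp [h0]

lemma coinUnion_subset {I : Fin l → Finset α} {N : Finset α} (h : ∀ k, I k ⊆ N)
    (ω : Fin l × α → Fin l) : coinUnion I ω ⊆ N := by
  intro e he
  obtain ⟨k, hk, -⟩ := (Finset.mem_filter.1 he).2
  exact h k hk

lemma coinUnion_mono {I I' : Fin l → Finset α} (h : ∀ k, I k ⊆ I' k)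
    (ω : Fin l × α → Fin l) : coinUnion I ω ⊆ coinUnion I' ω := by
  intro e he
  simp only [coinUnion, Finset.mem_filter, Finset.mem_univ, true_and] at he ⊢
  obtain ⟨k, hk, hω⟩ := he
  exact ⟨k, h k hk, hω⟩

open scoped Classical in
/-- A coordinate of a uniform table is independent of functions that do not depend on it. -/
lemma sum_filter_coin {ι : Type*} [Fintype ι] [DecidableEq ι] (hl : 0 < l) (i : ι)
    (g : (ι → Fin l) → ℝ) (hg : ∀ ω c, g (Function.update ω i c) = g ω) :
    ∑ ω ∈ Finset.univ.filter (fun ω : ι → Fin l => (ω i).val = 0), g ω =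
      1 / (l : ℝ) * ∑ ω, g ω := by
  have hl' : (l : ℝ) ≠ 0 := by exact_mod_cast hl.ne'
  have h1 : ∑ ω, g ω = ∑ c : Fin l, ∑ ω ∈ Finset.univ.filter (fun ω : ι → Fin l => ω i = c), g ω :=
    (Finset.sum_fiberwise Finset.univ (fun ω : ι → Fin l => ω i) g).symm
  have h2 : ∀ c : Fin l, ∑ ω ∈ Finset.univ.filter (fun ω : ι → Fin l => ω i = c), g ω =
      ∑ ω ∈ Finset.univ.filter (fun ω : ι → Fin l => (ω i).val = 0), g ω := by
    intro c
    refine Finset.sum_bij' (fun ω _ => Function.update ω i ⟨0, hl⟩)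
      (fun ω _ => Function.update ω i c) ?_ ?_ ?_ ?_ ?_
    · intro ω _
      simp
    · intro ω _
      simp
    · intro ω hω
      have := (Finset.mem_filter.1 hω).2
      simp [← this]
    · intro ω hω
      have h : ω i = ⟨0, hl⟩ := Fin.ext (Finset.mem_filter.1 hω).2
      simp [← h]
    · intro ω _
      exact (hg ω _).symm
  rw [h1, Finset.sum_congr rfl fun c _ => h2 c]
  simp [hl']

/-- A coin uniform on `Fin l` shows zero with probability 1/l, so averaging over the coin tables
gives the sampled union exactly, with the same tables for every family. -/
lemma sum_coinUnion (hl : 0 < l) (φ : Finset α → ℝ) (I : Fin l → Finset α) :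
    ∑ ω : Fin l × α → Fin l, φ (coinUnion I ω) =
      Fintype.card (Fin l × α → Fin l) * sampledUnionValue φ I := by
  classical
  refine family_induction (P := fun I => ∀ φ : Finset α → ℝ,
    ∑ ω : Fin l × α → Fin l, φ (coinUnion I ω) =
      Fintype.card (Fin l × α → Fin l) * sampledUnionValue φ I) (Q := fun _ => ∅) (A := I)
    (fun _ => Finset.empty_subset _) ?_ ?_ φ
  · intro φ
    simp only [coinUnion_empty, sampledUnionValue_empty, Finset.sum_const, Finset.card_univ,
      nsmul_eq_mul]
  · intro I j z _ _ hz _ ih φ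
    have hind : ∀ ω c, coinUnion I (Function.update ω (j, z) c) = coinUnion I ω := by
      intro ω c
      ext e
      simp only [coinUnion, Finset.mem_filter, Finset.mem_univ, true_and]
      refine exists_congr fun k => and_congr_right fun hk => ?_
      rw [Function.update_of_ne]
      rintro h
      rw [Prod.mk.injEq] at h
      exact hz (h.1 ▸ h.2 ▸ hk)
    have h1 : ∀ ω, φ (coinUnion (Function.update I j (insert z (I j))) ω) = φ (coinUnion I ω) +
        if (ω (j, z)).val = 0 then φ (insert z (coinUnion I ω)) - φ (coinUnion I ω) else 0 := by
      intro ω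
      rw [coinUnion_insert]
      split_ifs <;> ring
    rw [Finset.sum_congr rfl fun ω _ => h1 ω, Finset.sum_add_distrib, ← Finset.sum_filter,
      sum_filter_coin hl (j, z) (fun ω => φ (insert z (coinUnion I ω)) - φ (coinUnion I ω))
        (fun ω c => by simp only [hind]), Finset.sum_sub_distrib, ih φ,
      ih fun S => φ (insert z S), sampledUnionValue_insert φ hz]
    ring

/-- The empirical estimate of the value of the sampled union. -/
noncomputable def empiricalValue (f : Finset α → ℝ) {m : ℕ} (ω : Fin m → Fin l × α → Fin l)
    (I : Fin l → Finset α) : ℝ :=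
  (∑ i, f (coinUnion I (ω i))) / m

/-- The coin tables `ω` for which the empirical estimate is accurate up to `η` on all families of
subsets of `N`. -/
def Accurate (f : Finset α → ℝ) (N : Finset α) (η : ℝ) {m : ℕ}
    (ω : Fin m → Fin l × α → Fin l) : Prop :=
  ∀ I : Fin l → Finset α, (∀ k, I k ⊆ N) →
    |empiricalValue f ω I - sampledUnionValue f I| ≤ η

-- Hoeffding's inequality for one family, in both directions, and a union bound over at most 2^(nl)
-- families. Uniformity is essential, since the families to be evaluated are chosen with knowledge
-- of the coins.
open scoped Classical in
theorem card_not_accurate_le (hl : 0 < l) {f : Finset α → ℝ} {N : Finset α} {b κ : ℝ}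
    (hf0 : ∀ S ⊆ N, 0 ≤ f S) (hfb : ∀ S ⊆ N, f S ≤ b) (hκ : 0 ≤ κ) {m : ℕ} (hm : 0 < m) :
    ((Finset.univ.filter fun ω : Fin m → Fin l × α → Fin l =>
      ¬ Accurate f N (κ * b) ω).card : ℝ) ≤
      2 * 2 ^ (Fintype.card α * l) * Real.exp (-(m * κ ^ 2 / 2)) *
        Fintype.card (Fin m → Fin l × α → Fin l) := by
  have hm' : (0 : ℝ) < m := by exact_mod_cast hm
  have hΩ : Nonempty (Fin l × α → Fin l) := ⟨fun _ => ⟨0, hl⟩⟩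
  have hΩ' : (0 : ℝ) < Fintype.card (Fin l × α → Fin l) := by exact_mod_cast Fintype.card_pos
  have hb0 : 0 ≤ b := (hf0 ∅ (Finset.empty_subset _)).trans (hfb ∅ (Finset.empty_subset _))
  have hmean : ∀ I : Fin l → Finset α, (∀ k, I k ⊆ N) →
      0 ≤ sampledUnionValue f I ∧ sampledUnionValue f I ≤ b := by
    intro I hI
    have h := sum_coinUnion hl f I
    have h1 : 0 ≤ ∑ ω : Fin l × α → Fin l, f (coinUnion I ω) :=
      Finset.sum_nonneg fun ω _ => hf0 _ (coinUnion_subset hI ω)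
    have h2 : ∑ ω : Fin l × α → Fin l, f (coinUnion I ω) ≤
        Fintype.card (Fin l × α → Fin l) * b := by
      refine (Finset.sum_le_card_nsmul _ _ b fun ω _ => hfb _ (coinUnion_subset hI ω)).trans_eq ?_
      rw [nsmul_eq_mul, Finset.card_univ]
    rw [h] at h1 h2
    exact ⟨nonneg_of_mul_nonneg_right h1 hΩ', le_of_mul_le_mul_left h2 hΩ'⟩
  -- The deviations are normalized by `b`. For b = 0 the function vanishes on subsets of `N` and
  -- every table is accurate.
  rcases hb0.eq_or_lt with hb | hb
  · have : Finset.univ.filter (fun ω : Fin m → Fin l × α → Fin l =>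
        ¬ Accurate f N (κ * b) ω) = ∅ := by
      refine Finset.filter_eq_empty_iff.2 fun ω _ => not_not.2 fun I hI => ?_
      have h1 : ∀ i, f (coinUnion I (ω i)) = 0 := fun i =>
        le_antisymm (hb ▸ hfb _ (coinUnion_subset hI _)) (hf0 _ (coinUnion_subset hI _))
      have h2 := hmean I hI
      rw [← hb] at h2 ⊢
      simp [empiricalValue, h1, le_antisymm h2.2 h2.1]
    rw [this]
    simp only [Finset.card_empty, Nat.cast_zero]
    positivity
  have hone : ∀ I : Fin l → Finset α, (∀ k, I k ⊆ N) →
      ((Finset.univ.filter fun ω : Fin m → Fin l × α → Fin l =>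
        ¬ |empiricalValue f ω I - sampledUnionValue f I| ≤ κ * b).card : ℝ) ≤
      2 * (Fintype.card (Fin m → Fin l × α → Fin l) * Real.exp (-(m * κ ^ 2 / 2))) := by
    intro I hI
    have hF := hmean I hI
    set F := sampledUnionValue f I with hFdef
    set X : (Fin l × α → Fin l) → ℝ := fun a => (f (coinUnion I a) - F) / b with hX
    have hX1 : ∀ a, -1 ≤ X a := fun a => by
      rw [hX, le_div_iff₀ hb]
      linarith [hf0 _ (coinUnion_subset hI a)]
    have hX2 : ∀ a, X a ≤ 1 := fun a => by
      rw [hX, div_le_one hb]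
      linarith [hfb _ (coinUnion_subset hI a)]
    have hX0 : ∑ a, X a = 0 := by
      rw [hX, ← Finset.sum_div, Finset.sum_sub_distrib, sum_coinUnion hl]
      simp [hFdef]
    have k1 := card_le_of_mean_zero hX1 hX2 hX0 hκ m
    have k2 := card_le_of_mean_zero (X := fun a => -X a) (fun a => by linarith [hX2 a])
      (fun a => by linarith [hX1 a]) (by rw [Finset.sum_neg_distrib, hX0, neg_zero]) hκ m
    have hsub : (Finset.univ.filter fun ω : Fin m → Fin l × α → Fin l =>
        ¬ |empiricalValue f ω I - F| ≤ κ * b) ⊆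
        (Finset.univ.filter fun ω => m * κ ≤ ∑ i, X (ω i)) ∪
          Finset.univ.filter fun ω => m * κ ≤ ∑ i, -X (ω i) := by
      intro ω hω
      have hω' := (Finset.mem_filter.1 hω).2
      rw [not_le, lt_abs] at hω'
      have hsum : ∑ i, X (ω i) = m / b * (empiricalValue f ω I - F) := by
        rw [hX, ← Finset.sum_div, Finset.sum_sub_distrib, empiricalValue]
        simp only [Finset.sum_const, Finset.card_univ, Fintype.card_fin, nsmul_eq_mul]
        field_simp
      have hmb : 0 < m / b := by positivity
      have hk : m * κ = m / b * (κ * b) := by field_simp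
      simp only [Finset.mem_union, Finset.mem_filter, Finset.mem_univ, true_and,
        Finset.sum_neg_distrib, hsum, hk, ← mul_neg]
      rcases hω' with h | h
      · exact Or.inl (mul_le_mul_of_nonneg_left h.le hmb.le)
      · exact Or.inr (mul_le_mul_of_nonneg_left h.le hmb.le)
    have k3 := (Finset.card_le_card hsub).trans (Finset.card_union_le _ _)
    have k4 : ((Finset.univ.filter fun ω : Fin m → Fin l × α → Fin l =>
        ¬ |empiricalValue f ω I - F| ≤ κ * b).card : ℝ) ≤
        ((Finset.univ.filter fun ω : Fin m → Fin l × α → Fin l =>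
          m * κ ≤ ∑ i, X (ω i)).card : ℝ) +
        ((Finset.univ.filter fun ω : Fin m → Fin l × α → Fin l =>
          m * κ ≤ ∑ i, -X (ω i)).card : ℝ) := by exact_mod_cast k3
    linarith
  have hsub : (Finset.univ.filter fun ω : Fin m → Fin l × α → Fin l =>
      ¬ Accurate f N (κ * b) ω) ⊆
      (Finset.univ.filter fun I : Fin l → Finset α => ∀ k, I k ⊆ N).biUnion fun I =>
        Finset.univ.filter fun ω : Fin m → Fin l × α → Fin l =>
          ¬ |empiricalValue f ω I - sampledUnionValue f I| ≤ κ * b := by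
    intro ω hω
    have hω' := (Finset.mem_filter.1 hω).2
    rw [Accurate] at hω'
    push Not at hω'
    obtain ⟨I, hI, h⟩ := hω'
    exact Finset.mem_biUnion.2 ⟨I, by simpa using hI, by simpa using h⟩
  have h1 := (Finset.card_le_card hsub).trans Finset.card_biUnion_le
  have h2 : ((Finset.univ.filter fun ω : Fin m → Fin l × α → Fin l =>
      ¬ Accurate f N (κ * b) ω).card : ℝ) ≤
      ∑ I ∈ Finset.univ.filter (fun I : Fin l → Finset α => ∀ k, I k ⊆ N),
        ((Finset.univ.filter fun ω : Fin m → Fin l × α → Fin l =>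
          ¬ |empiricalValue f ω I - sampledUnionValue f I| ≤ κ * b).card : ℝ) := by
    exact_mod_cast h1
  refine h2.trans ((Finset.sum_le_card_nsmul _ _ _ fun I hI =>
    hone I (Finset.mem_filter.1 hI).2).trans ?_)
  rw [nsmul_eq_mul]
  have h3 : ((Finset.univ.filter fun I : Fin l → Finset α => ∀ k, I k ⊆ N).card : ℝ) ≤
      2 ^ (Fintype.card α * l) := by
    have := Finset.card_le_univ (Finset.univ.filter fun I : Fin l → Finset α => ∀ k, I k ⊆ N)
    rw [Fintype.card_pi_const, Fintype.card_finset, ← pow_mul] at this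
    exact_mod_cast this
  refine (mul_le_mul_of_nonneg_right h3 (by positivity)).trans_eq ?_
  ring

end

/-! ### Measured greedy: invariants of one phase and of the whole run. -/

namespace MeasuredGreedy
open ParallelGreedy Strategy

section
variable {α : Type u} [Fintype α] [DecidableEq α] {l m : ℕ}

/-- The marginal values of the empirical estimate, as a function of the `k`-th set of the family. -/
noncomputable def probe (ω : Fin m → Fin l × α → Fin l) (A : Fin l → Finset α) (k : Fin l) :
    Probe α α where
  val f s S x := if s S x = false then -1
    else empiricalValue f ω (Function.update A k (insert x S)) -
      empiricalValue f ω (Function.update A k S)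
  valueQueries S x :=
    (Finset.univ.image fun i => coinUnion (Function.update A k (insert x S)) (ω i)) ∪
      Finset.univ.image fun i => coinUnion (Function.update A k S) (ω i)
  spanQueries S x := {(S, x)}
  val_congr := by
    intro f f' s s' S x hf hs
    have h1 := hs (S, x) (by simp)
    simp only at h1
    have h2 : ∀ i, f (coinUnion (Function.update A k (insert x S)) (ω i)) =
        f' (coinUnion (Function.update A k (insert x S)) (ω i)) := fun i =>
      hf _ (Finset.mem_union_left _ (Finset.mem_image_of_mem _ (Finset.mem_univ i)))
    have h3 : ∀ i, f (coinUnion (Function.update A k S) (ω i)) =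
        f' (coinUnion (Function.update A k S) (ω i)) := fun i =>
      hf _ (Finset.mem_union_right _ (Finset.mem_image_of_mem
        (fun i => coinUnion (Function.update A k S) (ω i)) (Finset.mem_univ i)))
    simp only [empiricalValue, h1, h2, h3]

/-- The state of the measured greedy algorithm: families of processed and of accepted elements, and
the total weights of accepted and of rejected elements. -/
structure FamilyState (α : Type u) (l : ℕ) where
  A : Fin l → Finset α
  Q : Fin l → Finset α
  c : ℝ
  d : ℝ

/-- The state after the `k`-th phase. -/
def FamilyState.extend (st : FamilyState α l) (k : Fin l) (t : GreedyState α) : FamilyState α l :=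
  ⟨Function.update st.A k t.A, Function.update st.Q k t.Q, st.c + t.c, st.d + t.d⟩

/-- The first `k` phases of the measured greedy algorithm. -/
noncomputable def phases (ω : Fin m → Fin l × α → Fin l) (δ θ : ℝ) (L T : ℕ) :
    ℕ → Strategy α (FamilyState α l)
  | 0 => output ⟨fun _ => ∅, fun _ => ∅, 0, 0⟩
  | k + 1 => (phases ω δ θ L T k).bind fun st =>
      if hk : k < l then
        (greedy (probe ω st.A ⟨k, hk⟩) δ θ L T [Finset.univ]).bind fun t =>
          output (st.extend ⟨k, hk⟩ t)
      else output st

variable {M : Matroid α} {f : Finset α → ℝ} {ω : Fin m → Fin l × α → Fin l}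
  {A : Fin l → Finset α} {k : Fin l}

lemma coinUnion_update_insert (A : Fin l → Finset α) (k : Fin l) (S : Finset α) (x : α)
    (a : Fin l × α → Fin l) :
    coinUnion (Function.update A k (insert x S)) a =
      if (a (k, x)).val = 0 then insert x (coinUnion (Function.update A k S) a)
      else coinUnion (Function.update A k S) a := by
  have := coinUnion_insert (Function.update A k S) k x a
  rwa [Function.update_self, Function.update_idem] at this

lemma empiricalValue_insert_sub (f : Finset α → ℝ) (ω : Fin m → Fin l × α → Fin l)
    (A : Fin l → Finset α) (k : Fin l) (S : Finset α) (x : α) :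
    empiricalValue f ω (Function.update A k (insert x S)) -
      empiricalValue f ω (Function.update A k S) =
      (∑ i, if (ω i (k, x)).val = 0 then f (insert x (coinUnion (Function.update A k S) (ω i))) -
        f (coinUnion (Function.update A k S) (ω i)) else 0) / m := by
  rw [empiricalValue, empiricalValue, ← sub_div, ← Finset.sum_sub_distrib]
  congr 1
  refine Finset.sum_congr rfl fun i _ => ?_
  rw [coinUnion_update_insert]
  split_ifs <;> simp

lemma update_subset_update (A : Fin l → Finset α) (k : Fin l) {S T : Finset α} (h : S ⊆ T)
    (i : Fin l) : Function.update A k S i ⊆ Function.update A k T i := by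
  by_cases hi : i = k
  · subst hi
    simpa using h
  · simp [Function.update_of_ne hi]

/-- For fixed coins the unions grow with the family, so diminishing returns hold exactly and not
just up to the sampling error. If `x` already lies in the larger union, then through another set of
the family, hence also in the smaller one, and both contributions vanish. -/
lemma empirical_marginal_le (hf : IsSubmodular f) {S T : Finset α} {x : α} (hST : S ⊆ T)
    (hx : x ∉ T) :
    empiricalValue f ω (Function.update A k (insert x T)) -
      empiricalValue f ω (Function.update A k T) ≤
    empiricalValue f ω (Function.update A k (insert x S)) -
      empiricalValue f ω (Function.update A k S) := by
  rw [empiricalValue_insert_sub, empiricalValue_insert_sub]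
  refine div_le_div_of_nonneg_right (Finset.sum_le_sum fun i _ => ?_) (Nat.cast_nonneg m)
  split_ifs
  · by_cases h : x ∈ coinUnion (Function.update A k T) (ω i)
    · have h' : x ∈ coinUnion (Function.update A k S) (ω i) := by
        simp only [coinUnion, Finset.mem_filter, Finset.mem_univ, true_and] at h ⊢
        obtain ⟨j, hj, hω⟩ := h
        by_cases hjk : j = k
        · subst hjk
          rw [Function.update_self] at hj
          exact absurd hj hx
        · rw [Function.update_of_ne hjk] at hj
          exact ⟨j, by rwa [Function.update_of_ne hjk], hω⟩
      rw [Finset.insert_eq_of_mem h, Finset.insert_eq_of_mem h']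
      simp
    · exact hf.marginal_le (coinUnion_mono (update_subset_update A k hST) _) h
  · exact le_rfl

lemma val_of_mem_closure (hM : M.E = Set.univ) {S : Finset α} {x : α}
    (h : x ∈ M.closure (S : Set α)) : (probe ω A k).val f (spanOracle M) S x = -1 :=
  if_pos ((spanOracle_eq_false_iff hM).2 h)

lemma val_of_notMem_closure (hM : M.E = Set.univ) {S : Finset α} {x : α}
    (h : x ∉ M.closure (S : Set α)) : (probe ω A k).val f (spanOracle M) S x =
      empiricalValue f ω (Function.update A k (insert x S)) -
        empiricalValue f ω (Function.update A k S) :=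
  if_neg fun h' => h ((spanOracle_eq_false_iff hM).1 h')

lemma notMem_closure_of_nonneg (hM : M.E = Set.univ) {S : Finset α} {x : α}
    (h : 0 ≤ (probe ω A k).val f (spanOracle M) S x) : x ∉ M.closure (S : Set α) := by
  intro hb
  rw [val_of_mem_closure hM hb] at h
  linarith

lemma isDecreasing_val (hM : M.E = Set.univ) (hf : IsSubmodular f) :
    IsDecreasing ((probe ω A k).val f (spanOracle M)) where
  le_of_subset {S T x} h h0 := by
    have hT := notMem_closure_of_nonneg hM h0
    rw [val_of_notMem_closure hM hT,
      val_of_notMem_closure hM fun h' => hT (M.closure_mono_coe h h')]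
    exact empirical_marginal_le hf h fun hx => hT (Matroid.mem_closure_of_mem_of_ground hM hx)
  neg_of_mem {S x} h := by
    rw [val_of_mem_closure hM (Matroid.mem_closure_of_mem_of_ground hM h)]
    norm_num

open scoped Classical in
/-- The elements that are not loops. -/
noncomputable def nonloops (M : Matroid α) : Finset α :=
  Finset.univ.filter fun e => e ∉ M.closure ((∅ : Finset α) : Set α)

lemma mem_nonloops {x : α} : x ∈ nonloops M ↔ x ∉ M.closure ((∅ : Finset α) : Set α) := by
  simp [nonloops]

lemma mem_nonloops_of_notMem_closure {S : Finset α} {x : α} (h : x ∉ M.closure (S : Set α)) :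
    x ∈ nonloops M :=
  mem_nonloops.2 fun h' => h (M.closure_mono_coe (Finset.empty_subset S) h')

lemma le_maxSingleton_of_mem_nonloops (hM : M.E = Set.univ) {x : α} (h : x ∈ nonloops M) :
    f {x} ≤ maxSingleton f (spanOracle M) :=
  le_maxSingleton ((spanOracle_eq_true_iff hM).2 (mem_nonloops.1 h))

lemma le_card_mul_maxSingleton (hM : M.E = Set.univ) (hf : IsSubmodular f) (h0 : f ∅ = 0)
    {S : Finset α} (hS : S ⊆ nonloops M) :
    f S ≤ Fintype.card α * maxSingleton f (spanOracle M) := by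
  refine (hf.le_sum_singleton h0 S).trans ((Finset.sum_le_card_nsmul _ _ _ fun x hx =>
    le_maxSingleton_of_mem_nonloops hM (hS hx)).trans ?_)
  rw [nsmul_eq_mul]
  exact mul_le_mul_of_nonneg_right (by exact_mod_cast Finset.card_le_univ S)
    (maxSingleton_nonneg _ _)

lemma topValue_empty_le (hM : M.E = Set.univ) (hf : IsSubmodular f) (h0 : f ∅ = 0) (θ : ℝ) :
    topValue ((probe ω A k).val f (spanOracle M)) θ ∅ ≤
      max θ (maxSingleton f (spanOracle M)) := by
  have hv := maxSingleton_nonneg f (spanOracle M)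
  refine topValue_le (le_max_left _ _) fun x => le_trans ?_ (le_max_right _ _)
  by_cases hb : x ∈ M.closure ((∅ : Finset α) : Set α)
  · rw [val_of_mem_closure hM hb]
    linarith
  · rw [val_of_notMem_closure hM hb, empiricalValue_insert_sub]
    have hx : f {x} ≤ maxSingleton f (spanOracle M) :=
      le_maxSingleton_of_mem_nonloops hM (mem_nonloops.2 hb)
    rcases Nat.eq_zero_or_pos m with rfl | hm
    · simpa using hv
    rw [div_le_iff₀ (by exact_mod_cast hm)]
    refine (Finset.sum_le_card_nsmul _ _ (maxSingleton f (spanOracle M)) fun i _ => ?_).trans_eq ?_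
    · split_ifs
      · by_cases h : x ∈ coinUnion (Function.update A k ∅) (ω i)
        · rw [Finset.insert_eq_of_mem h]
          simpa using hv
        · have := hf.marginal_le (Finset.empty_subset _) h
          rw [h0, sub_zero] at this
          exact this.trans hx
      · exact hv
    · simp [mul_comm]

/-- The structural invariants of a phase. -/
structure PhaseShape (M : Matroid α) (t : GreedyState α) : Prop where
  subset : t.Q ⊆ t.A
  nonloop : t.A ⊆ nonloops M
  indep : M.Indep (t.Q : Set α)
  nonneg : 0 ≤ t.d

/-- The numerical invariants of a phase. -/
structure PhaseValue (f : Finset α → ℝ) (δ η : ℝ) (st : FamilyState α l) (k : Fin l)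
    (t : GreedyState α) : Prop where
  value_le : sampledUnionValue f (Function.update st.A k t.A) ≤
    sampledUnionValue f (Function.update st.Q k t.Q) + st.d + t.d +
      2 * η * (k * Fintype.card α + t.A.card)
  le_value : sampledUnionValue f st.Q + (1 - δ) * t.c - 2 * η * t.A.card ≤
    sampledUnionValue f (Function.update st.Q k t.Q)

/-- The structural invariants of the algorithm after `k` phases. -/
structure FamilyShape (M : Matroid α) (k : ℕ) (st : FamilyState α l) : Prop where
  empty_A : ∀ i : Fin l, k ≤ i → st.A i = ∅
  empty_Q : ∀ i : Fin l, k ≤ i → st.Q i = ∅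
  subset : ∀ i, st.Q i ⊆ st.A i
  nonloop : ∀ i, st.A i ⊆ nonloops M
  indep : ∀ i, M.Indep (st.Q i : Set α)
  nonneg : 0 ≤ st.d

/-- The numerical invariants of the algorithm after `k` phases. -/
structure FamilyValue (M : Matroid α) (f : Finset α → ℝ) (δ θ η : ℝ) (k : ℕ)
    (st : FamilyState α l) : Prop where
  value_le : sampledUnionValue f st.A ≤
    sampledUnionValue f st.Q + st.d + 2 * η * (k * Fintype.card α)
  le_value : (1 - δ) * st.c ≤ sampledUnionValue f st.Q + 2 * η * (k * Fintype.card α)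
  progress : k * ((1 - δ) / l * (1 - 1 / (l : ℝ)) ^ (k + 1) * optValue M f) -
    k * (Fintype.card α * θ + 6 * η * Fintype.card α) ≤ sampledUnionValue f st.Q + st.d

lemma update_subset_nonloops {st : FamilyState α l} {j : ℕ} (hst : FamilyShape M j st)
    {S : Finset α} (hS : S ⊆ nonloops M) (k i : Fin l) :
    Function.update st.A k S i ⊆ nonloops M := by
  by_cases hi : i = k
  · subst hi
    simpa using hS
  · rw [Function.update_of_ne hi]
    exact hst.nonloop i

lemma abs_marginal_sub_le {st : FamilyState α l} {j : ℕ} (hst : FamilyShape M j st) {η : ℝ}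
    (hacc : Accurate f (nonloops M) η ω) {S : Finset α} (hS : S ⊆ nonloops M) {x : α}
    (hx : x ∈ nonloops M) (k : Fin l) :
    |(empiricalValue f ω (Function.update st.A k (insert x S)) -
        empiricalValue f ω (Function.update st.A k S)) -
      (sampledUnionValue f (Function.update st.A k (insert x S)) -
        sampledUnionValue f (Function.update st.A k S))| ≤ 2 * η := by
  have h1 := abs_le.1 (hacc _ (update_subset_nonloops hst (Finset.insert_subset hx hS) k))
  have h2 := abs_le.1 (hacc _ (update_subset_nonloops hst hS k))
  rw [abs_le]
  constructor <;> linarith [h1.1, h1.2, h2.1, h2.2]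

lemma marginal_eq (f : Finset α → ℝ) (A : Fin l → Finset α) (k : Fin l) {S : Finset α} {x : α}
    (hx : x ∉ S) :
    sampledUnionValue f (Function.update A k (insert x S)) -
      sampledUnionValue f (Function.update A k S) =
      1 / (l : ℝ) * sampledMarginal f (Function.update A k S) x := by
  have := sampledUnionValue_insert_sub f (I := Function.update A k S) (j := k) (x := x)
    (by simpa using hx)
  rwa [Function.update_self, Function.update_idem] at this

lemma preserved_phaseShape (hM : M.E = Set.univ) {δ μ : ℝ} (hδ : δ ≤ 1) (hμ : 0 ≤ μ)
    (A : Fin l → Finset α) (k : Fin l) :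
    Preserved ((probe ω A k).val f (spanOracle M)) δ [Finset.univ] μ (PhaseShape M) := by
  rintro t x ⟨hxA, D, -, B, -, -, -, h0, -⟩ ht
  have hx : x ∈ nonloops M := mem_nonloops_of_notMem_closure (notMem_closure_of_nonneg hM h0)
  unfold GreedyState.add
  split_ifs with hgood
  · have hnb := notMem_closure_of_nonneg hM ((mul_nonneg (by linarith) hμ).trans hgood)
    exact ⟨Finset.insert_subset_insert _ ht.subset, Finset.insert_subset hx ht.nonloop,
      Matroid.indep_insert_of_notMem_closure hM ht.indep ht.subset hnb, ht.nonneg⟩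
  · exact ⟨ht.subset.trans (Finset.subset_insert _ _), Finset.insert_subset hx ht.nonloop,
      ht.indep, add_nonneg ht.nonneg hμ⟩

/-- Every processed element costs an error 2η between empirical and true marginals. For an accepted
one, 2η ≤ (1 - δ)μ ensures that the true marginal at `A` is nonnegative, which is what
`sampledMarginal_anti` needs for the comparison with `Q`. A rejected one has true marginal at most μ
+ 2η. -/
lemma preserved_phase (hM : M.E = Set.univ) (hf : IsSubmodular f) (hl : 2 ≤ l) {δ η μ : ℝ}
    (hδ : δ ≤ 1) (hμ : 0 ≤ μ) (hη : 2 * η ≤ (1 - δ) * μ) {j : ℕ} {st : FamilyState α l}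
    (hst : FamilyShape M j st) (hacc : Accurate f (nonloops M) η ω) (k : Fin l) :
    Preserved ((probe ω st.A k).val f (spanOracle M)) δ [Finset.univ] μ
      fun t => PhaseShape M t ∧ PhaseValue f δ η st k t := by
  rintro t x hadm ⟨ht, hv⟩
  refine ⟨preserved_phaseShape hM hδ hμ st.A k t x hadm ht, ?_⟩
  obtain ⟨hxA, D, -, B, hB, -, -, h0, hle⟩ := hadm
  have hcl := notMem_closure_of_nonneg hM h0
  have hx : x ∈ nonloops M := mem_nonloops_of_notMem_closure hcl
  rw [val_of_notMem_closure hM hcl] at hle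
  have hemp := (empirical_marginal_le (ω := ω) (A := st.A) (k := k) hf hB hxA).trans hle
  have habs := abs_le.1 (abs_marginal_sub_le hst hacc ht.nonloop hx k)
  have hcard : ((insert x t.A).card : ℝ) = t.A.card + 1 := by
    rw [Finset.card_insert_of_notMem hxA]
    push_cast
    rfl
  have hv1 := hv.value_le
  have hv2 := hv.le_value
  have hxQ : x ∉ t.Q := fun h => hxA (ht.subset h)
  unfold GreedyState.add
  split_ifs with hgood
  · have hnb := notMem_closure_of_nonneg hM ((mul_nonneg (by linarith) hμ).trans hgood)
    rw [val_of_notMem_closure hM hnb] at hgood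
    have hl0 : (0 : ℝ) < 1 / l := by
      have : (0 : ℝ) < l := by exact_mod_cast (by omega : 0 < l)
      positivity
    have hpos : 0 ≤ sampledMarginal f (Function.update st.A k t.A) x := by
      refine nonneg_of_mul_nonneg_right ?_ hl0
      rw [← marginal_eq f st.A k hxA]
      linarith [habs.2]
    have hanti := sampledMarginal_anti hf hl (Q := Function.update st.Q k t.Q) (fun i => by
      by_cases hi : i = k
      · subst hi
        simpa using ht.subset
      · rw [Function.update_of_ne hi, Function.update_of_ne hi]
        exact hst.subset i) hpos
    have hcmp := mul_le_mul_of_nonneg_left hanti hl0.le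
    rw [← marginal_eq f st.A k hxA, ← marginal_eq f st.Q k hxQ] at hcmp
    refine ⟨?_, ?_⟩
    · simp only [hcard]
      have hη0 : 0 ≤ 2 * η := (abs_nonneg _).trans (abs_marginal_sub_le hst hacc ht.nonloop hx k)
      linarith
    · simp only [hcard]
      linarith [habs.2]
  · refine ⟨?_, ?_⟩
    · simp only [hcard]
      linarith [habs.1]
    · simp only [hcard]
      have hη0 : 0 ≤ 2 * η := (abs_nonneg _).trans (abs_marginal_sub_le hst hacc ht.nonloop hx k)
      linarith

lemma familyShape_extend {st : FamilyState α l} {k : ℕ} (hk : k < l) (hst : FamilyShape M k st)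
    {t : GreedyState α} (ht : PhaseShape M t) :
    FamilyShape M (k + 1) (st.extend ⟨k, hk⟩ t) := by
  have hne : ∀ i : Fin l, k + 1 ≤ i → i ≠ ⟨k, hk⟩ := fun i hi h => by
    rw [h] at hi
    simp at hi
  refine ⟨fun i hi => ?_, fun i hi => ?_, fun i => ?_, fun i => ?_, fun i => ?_,
    add_nonneg hst.nonneg ht.nonneg⟩
  · simp only [FamilyState.extend]
    rw [Function.update_of_ne (hne i hi)]
    exact hst.empty_A i (by omega)
  · simp only [FamilyState.extend]
    rw [Function.update_of_ne (hne i hi)]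
    exact hst.empty_Q i (by omega)
  all_goals
    simp only [FamilyState.extend]
    by_cases hi : i = ⟨k, hk⟩
    · subst hi
      simp only [Function.update_self]
      first | exact ht.subset | exact ht.nonloop | exact ht.indep
    · simp only [Function.update_of_ne hi]
      first | exact hst.subset i | exact hst.nonloop i | exact hst.indep i

/-- The recursion satisfied by the value of the solution. -/
lemma progress_step {l k : ℕ} (hl : 2 ≤ l) {δ e P P' opt : ℝ} (hδ0 : 0 ≤ δ) (hδ : δ ≤ 1)
    (he : 0 ≤ e) (hopt : 0 ≤ opt)
    (hP : k * ((1 - δ) / l * (1 - 1 / (l : ℝ)) ^ (k + 1) * opt) - k * e ≤ P)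
    (hstep : (1 - δ) / l * ((1 - 1 / (l : ℝ)) ^ (k + 1) * opt - P') - e ≤ P' - P) :
    ((k + 1 : ℕ) : ℝ) * ((1 - δ) / l * (1 - 1 / (l : ℝ)) ^ (k + 1 + 1) * opt) -
      ((k + 1 : ℕ) : ℝ) * e ≤ P' := by
  have hl' : (2 : ℝ) ≤ l := by exact_mod_cast hl
  have hp0 : (0 : ℝ) ≤ 1 / l := by positivity
  have hp1 : 1 / (l : ℝ) ≤ 1 := by
    rw [div_le_one (by linarith)]
    linarith
  set a := 1 - 1 / (l : ℝ) with ha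
  set r := (1 - δ) / l with hr
  have ha0 : 0 ≤ a := by linarith
  have hr0 : 0 ≤ r := div_nonneg (by linarith) (by linarith)
  have hr1 : r ≤ 1 / l := div_le_div_of_nonneg_right (by linarith) (by linarith)
  set Y := ((k : ℝ) + 1) * (r * a ^ (k + 1) * opt) with hY
  set E := ((k : ℝ) + 1) * e with hE
  have hY0 : 0 ≤ Y := by positivity
  have hE0 : 0 ≤ E := by positivity
  have h1 : Y - E ≤ (1 + r) * P' := by
    rw [hY, hE]
    linarith
  -- The recursion bounds the gain by a multiple of X - P' with the new value P', so solving it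
  -- divides by 1 + r. As r ≤ 1/l, this costs no more than the one further factor `a` in the claim.
  have h2 : (1 + r) * a ≤ 1 := by
    rw [ha]
    nlinarith
  have h3 : (1 + r) * (a * Y - E) ≤ Y - E := by
    have := mul_le_mul_of_nonneg_right h2 hY0
    have := mul_nonneg hr0 hE0
    linarith
  have h4 : a * Y - E ≤ P' := le_of_mul_le_mul_left (h3.trans h1) (by linarith)
  refine le_trans (le_of_eq ?_) h4
  rw [hY, hE]
  push_cast
  ring

/-- With `C` optimal, 1/l times the gap (1 - 1/l)^(k+1) OPT - F(A') is at most 1/l times the sum of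
the marginals of `C` at A', which the weight c + d of the phase pays for. Meanwhile F(Q) + d grows
by about (1 - δ)c + d. The potential P is F(Q) + d because this dominates F(A) up to sampling
errors. -/
lemma familyValue_extend (hM : M.E = Set.univ) (hf : IsSubmodular f) (hnn : ∀ S, 0 ≤ f S)
    (hl : 2 ≤ l) {δ θ η : ℝ} (hδ0 : 0 ≤ δ) (hδ : δ ≤ 1) (hθ : 0 ≤ θ) {k : ℕ} (hk : k < l)
    {st : FamilyState α l} (hst : FamilyShape M k st) (hsv : FamilyValue M f δ θ η k st)
    (hacc : Accurate f (nonloops M) η ω) {t : GreedyState α} (ht : PhaseShape M t)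
    (hv : PhaseValue f δ η st ⟨k, hk⟩ t)
    (hcov : ∀ (K : Finset α) (h : α → ℝ),
      (∀ B ⊆ t.A, ∀ K' ⊆ K, (∀ x ∈ K', x ∈ M.closure (B : Set α)) → K'.card ≤ B.card) →
      (∀ B ⊆ t.A, ∀ x ∈ K, x ∉ M.closure (B : Set α) →
        h x ≤ topValue ((probe ω st.A ⟨k, hk⟩).val f (spanOracle M)) θ B) →
      ∑ x ∈ K, h x ≤ t.c + t.d + K.card * θ) :
    FamilyValue M f δ θ η (k + 1) (st.extend ⟨k, hk⟩ t) := by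
  have hl0 : (0 : ℝ) < l := by exact_mod_cast (by omega : 0 < l)
  have hp0 : (0 : ℝ) ≤ 1 / l := by positivity
  have hη : 0 ≤ η := (abs_nonneg _).trans (hacc (fun _ => ∅) fun _ => Finset.empty_subset _)
  have hcard : (t.A.card : ℝ) ≤ Fintype.card α := by exact_mod_cast Finset.card_le_univ _
  have hηc := mul_le_mul_of_nonneg_left hcard (by linarith : 0 ≤ 2 * η)
  have hv1 := hv.value_le
  have hv2 := hv.le_value
  obtain ⟨C, hC, hCopt⟩ := exists_eq_optValue M f
  set A' := Function.update st.A ⟨k, hk⟩ t.A with hA'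
  set Q' := Function.update st.Q ⟨k, hk⟩ t.Q with hQ'
  set n : ℝ := (Fintype.card α : ℝ) with hn
  simp only at hv1
  -- Subtracting 2η turns the true marginal into a lower bound for the empirical one, which is what
  -- the greedy run saw.
  have hsum := hcov C (fun x => 1 / (l : ℝ) * sampledMarginal f A' x - 2 * η) ?_ ?_
  rotate_left
  · intro B _ K' hK' hcl
    exact Matroid.card_le_of_subset_closure (hC.subset (Finset.coe_subset.2 hK')) hcl
  · intro B hB x _ hcl
    rcases lt_or_ge (sampledMarginal f A' x) 0 with hneg | hpos
    · have h1 := hθ.trans (base_le_topValue (u := (probe ω st.A ⟨k, hk⟩).val f (spanOracle M)) θ B)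
      have h2 : 1 / (l : ℝ) * sampledMarginal f A' x ≤ 0 :=
        mul_nonpos_of_nonneg_of_nonpos hp0 hneg.le
      linarith
    · have hanti := sampledMarginal_anti hf hl (Q := Function.update st.A ⟨k, hk⟩ B)
        (update_subset_update st.A ⟨k, hk⟩ hB) hpos
      have hxB : x ∉ B := fun h => hcl (Matroid.mem_closure_of_mem_of_ground hM h)
      have h1 := mul_le_mul_of_nonneg_left hanti hp0
      rw [← marginal_eq f st.A ⟨k, hk⟩ hxB] at h1
      have h2 := (abs_le.1 (abs_marginal_sub_le hst hacc (hB.trans ht.nonloop)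
        (mem_nonloops_of_notMem_closure hcl) ⟨k, hk⟩)).1
      have h3 := le_topValue (u := (probe ω st.A ⟨k, hk⟩).val f (spanOracle M)) θ B x
      rw [val_of_notMem_closure hM hcl] at h3
      linarith
  rw [Finset.sum_sub_distrib, ← Finset.mul_sum, Finset.sum_const, nsmul_eq_mul] at hsum
  have hCcard : (C.card : ℝ) ≤ n := Nat.cast_le.2 (Finset.card_le_univ C)
  have h1 := le_sum_sampledMarginal hf C A'
  have h2 := le_sampledUnionValue_union hf hnn C A' (k + 1)
    (familyShape_extend hk hst ht).empty_A
  rw [hCopt] at h2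
  have h3 := mul_le_mul_of_nonneg_right hCcard hθ
  have h4 := mul_le_mul_of_nonneg_right hCcard (by linarith : 0 ≤ 2 * η)
  have h5 : 1 / (l : ℝ) * ((1 - 1 / (l : ℝ)) ^ (k + 1) * optValue M f -
      sampledUnionValue f A') ≤ t.c + t.d + n * θ + 2 * η * n := by
    have := mul_le_mul_of_nonneg_left (show (1 - 1 / (l : ℝ)) ^ (k + 1) * optValue M f -
      sampledUnionValue f A' ≤ ∑ x ∈ C, sampledMarginal f A' x by linarith) hp0
    linarith
  have hopt0 : 0 ≤ optValue M f := hCopt ▸ hnn C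
  have hvalue : sampledUnionValue f A' ≤ sampledUnionValue f Q' + (st.d + t.d) +
      2 * η * (((k + 1 : ℕ) : ℝ) * n) := by
    push_cast
    linarith
  refine ⟨hvalue, ?_, ?_⟩
  · have := hsv.le_value
    simp only [FamilyState.extend]
    push_cast
    linarith
  · refine progress_step hl hδ0 hδ (e := n * θ + 6 * η * n) (by positivity) hopt0 hsv.progress ?_
    simp only [FamilyState.extend]
    set X := (1 - 1 / (l : ℝ)) ^ (k + 1) * optValue M f
    set P' := sampledUnionValue f Q' + (st.d + t.d) with hP'
    have hkl : ((k + 1 : ℕ) : ℝ) ≤ l := by exact_mod_cast hk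
    -- The error accumulated in F(A') over all phases is divided by l ≥ k + 1 and contributes only
    -- 2ηn. The last 2ηn of the total 6ηn comes from `le_value`.
    have h6 : 1 / (l : ℝ) * (X - P') ≤ t.c + t.d + n * θ + 4 * η * n := by
      have h7 : 1 / (l : ℝ) * (X - P' - 2 * η * (((k + 1 : ℕ) : ℝ) * n)) ≤
          1 / (l : ℝ) * (X - sampledUnionValue f A') :=
        mul_le_mul_of_nonneg_left (by linarith) hp0
      have h8 : 1 / (l : ℝ) * (2 * η * (((k + 1 : ℕ) : ℝ) * n)) ≤ 2 * η * n := by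
        calc 1 / (l : ℝ) * (2 * η * (((k + 1 : ℕ) : ℝ) * n))
            ≤ 1 / (l : ℝ) * (2 * η * (l * n)) := by gcongr
          _ = 2 * η * n := by field_simp
      linarith
    have h9 := mul_le_mul_of_nonneg_left h6 (sub_nonneg.2 hδ)
    have h10 : 0 ≤ δ * (n * θ + 4 * η * n) := by positivity
    have h11 : 0 ≤ δ * t.d := mul_nonneg hδ0 ht.nonneg
    have h12 : (1 - δ) / l * (X - P') = (1 - δ) * (1 / (l : ℝ) * (X - P')) := by ring
    rw [h12]
    linarith

/-- What the measured greedy algorithm achieves, apart from the fraction of rejected elements. -/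
theorem surely_phases (hM : M.E = Set.univ) (hf : IsSubmodular f) (h0 : f ∅ = 0)
    (hnn : ∀ S, 0 ≤ f S) (hl : 2 ≤ l) {δ θ η : ℝ} (hδ0 : 0 ≤ δ) (hδ : δ ≤ 1) (hθ : 0 ≤ θ)
    (hη : 2 * η ≤ (1 - δ) * θ) {L T : ℕ} (hL : (1 - δ) ^ L * Fintype.card α < 1)
    (hT : Fintype.card α ≤ T ∨ (1 - δ) ^ T * max θ (maxSingleton f (spanOracle M)) ≤ θ)
    (k : ℕ) (hk : k ≤ l) :
    (phases ω δ θ L T k).Surely f (spanOracle M) fun st =>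
      FamilyShape M k st ∧ (Accurate f (nonloops M) η ω → FamilyValue M f δ θ η k st) := by
  induction k with
  | zero =>
    refine ⟨⟨fun _ _ => rfl, fun _ _ => rfl, fun _ => subset_rfl,
      fun _ => Finset.empty_subset _, fun _ => by simp, le_rfl⟩, fun _ => ?_⟩
    constructor <;> simp [sampledUnionValue_empty, h0]
  | succ k ih =>
    have hk' : k < l := hk
    refine (ih hk'.le).bind fun st hst => ?_
    rw [dif_pos hk']
    have hI : ∀ μ, θ ≤ μ → Preserved ((probe ω st.A ⟨k, hk'⟩).val f (spanOracle M)) δ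
        [Finset.univ] μ fun t => PhaseShape M t ∧
          (Accurate f (nonloops M) η ω → PhaseValue f δ η st ⟨k, hk'⟩ t) := by
      intro μ hμ t x hadm ht
      refine ⟨preserved_phaseShape hM hδ (hθ.trans hμ) st.A ⟨k, hk'⟩ t x hadm ht.1, fun hacc => ?_⟩
      exact (preserved_phase hM hf hl hδ (hθ.trans hμ) (hη.trans (mul_le_mul_of_nonneg_left hμ
        (sub_nonneg.2 hδ))) hst.1 hacc ⟨k, hk'⟩ t x hadm ⟨ht.1, ht.2 hacc⟩).2
    refine (surely_greedy (isDecreasing_val hM hf) hδ0 hδ hθ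
      (bl := fun B x => x ∈ M.closure (B : Set α)) (fun h hx => M.closure_mono_coe h hx) hI ?_ hL
      (fun x => ⟨Finset.univ, by simp, Finset.mem_univ x⟩) (hT.imp_right fun h =>
        (mul_le_mul_of_nonneg_left (topValue_empty_le hM hf h0 θ)
          (pow_nonneg (by linarith) _)).trans h)).bind fun t ht => ?_
    · refine ⟨⟨subset_rfl, Finset.empty_subset _, by simp, le_rfl⟩, fun hacc => ?_⟩
      have hA : Function.update st.A ⟨k, hk'⟩ ∅ = st.A := by
        rw [← hst.1.empty_A ⟨k, hk'⟩ le_rfl, Function.update_eq_self]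
      have hQ : Function.update st.Q ⟨k, hk'⟩ ∅ = st.Q := by
        rw [← hst.1.empty_Q ⟨k, hk'⟩ le_rfl, Function.update_eq_self]
      have := (hst.2 hacc).value_le
      refine ⟨?_, ?_⟩
      · simp only [hA, hQ, Finset.card_empty]
        push_cast
        linarith
      · simp only [hQ, Finset.card_empty]
        push_cast
        linarith
    · obtain ⟨⟨ht1, ht2⟩, hcov⟩ := ht
      exact ⟨familyShape_extend hk' hst.1 ht1, fun hacc => familyValue_extend hM hf hnn hl hδ0 hδ hθ
        hk' hst.1 (hst.2 hacc) hacc ht1 (ht2 hacc) hcov⟩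

theorem ev_phases_le (hM : M.E = Set.univ) (hf : IsSubmodular f) {δ θ : ℝ} (hδ : δ ≤ 1)
    (hθ : 0 ≤ θ) (L T k : ℕ) :
    (phases ω δ θ L T k).ev f (spanOracle M) (fun st => (1 - δ) * st.d - δ * st.c) ≤ 0 := by
  induction k with
  | zero => simp [phases, ev]
  | succ k ih =>
    rw [phases, ev_bind]
    refine (ev_mono fun st => ?_).trans ih
    split_ifs with hk
    · rw [ev_bind]
      have h1 := ev_greedy_le (isDecreasing_val (ω := ω) (A := st.A) (k := ⟨k, hk⟩) hM hf) hδ hθ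
        L T [Finset.univ]
      have h2 : ∀ t : GreedyState α, (output (st.extend ⟨k, hk⟩ t) : Strategy α _).ev f
          (spanOracle M) (fun st => (1 - δ) * st.d - δ * st.c) =
          ((1 - δ) * st.d - δ * st.c) + ((1 - δ) * t.d - δ * t.c) := fun t => by
        simp only [ev, FamilyState.extend]
        ring
      simp only [h2]
      rw [ev_add, ev_const]
      linarith
    · exact le_rfl

lemma roundsLE_phases (δ θ : ℝ) (L T k : ℕ) :
    (phases ω δ θ L T k).RoundsLE (k * (T * (1 + L * 2))) := by
  induction k with
  | zero => trivial
  | succ k ih =>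
    rw [add_mul, one_mul]
    refine ih.bind fun st => ?_
    split_ifs with hk
    · have := roundsLE_greedy (p := probe ω st.A ⟨k, hk⟩) δ θ L T [Finset.univ]
      rw [List.length_singleton, one_mul] at this
      exact this.bind (r' := 0) (g := fun t => output (st.extend ⟨k, hk⟩ t)) fun _ => trivial
    · trivial

lemma card_queries_le (A : Fin l → Finset α) (k : Fin l) (S : Finset α) (x : α) :
    ((probe ω A k).valueQueries S x).card + ((probe ω A k).spanQueries S x).card ≤
      2 * m + 1 := by
  have h1 : ((probe ω A k).valueQueries S x).card ≤ m + m := by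
    refine (Finset.card_union_le _ _).trans (add_le_add ?_ ?_) <;>
      exact Finset.card_image_le.trans_eq (by simp)
  have h2 : ((probe ω A k).spanQueries S x).card = 1 := Finset.card_singleton _
  omega

lemma queriesLE_phases (δ θ : ℝ) (L T k : ℕ) :
    (phases ω δ θ L T k).QueriesLE
      ((Fintype.card α + 1) * (Fintype.card α * (2 * m + 1)) : ℕ) := by
  induction k with
  | zero => trivial
  | succ k ih =>
    refine ih.bind fun st => ?_
    split_ifs with hk
    · exact (queriesLE_greedy (card_queries_le st.A ⟨k, hk⟩) δ θ L T [Finset.univ]).bind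
        fun _ => trivial
    · trivial

end

end MeasuredGreedy

/-! ### Exponential estimates and averaging over good coins. -/

lemma inv_exp_mul_le_pow {l : ℕ} (hl : 2 ≤ l) :
    (Real.exp 1)⁻¹ * (1 - 2 / l) ≤ (1 - 1 / (l : ℝ)) ^ (l + 1) := by
  obtain ⟨k, rfl⟩ : ∃ k, l = k + 2 := ⟨l - 2, by omega⟩
  have hk : (0 : ℝ) < k + 1 := by positivity
  push_cast
  set a : ℝ := 1 - 1 / (k + 2) with ha
  have hak : a = (k + 1) / (k + 2) := by
    rw [ha]
    field_simp
    ring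
  have ha0 : 0 < a := by
    rw [hak]
    positivity
  have h1 : a⁻¹ ≤ Real.exp (1 / (k + 1)) := by
    have h := Real.add_one_le_exp (1 / ((k : ℝ) + 1))
    rw [hak, inv_div]
    refine le_trans (le_of_eq ?_) h
    field_simp
    ring
  have h2 : (a⁻¹) ^ (k + 1) ≤ Real.exp 1 := by
    refine (pow_le_pow_left₀ (inv_nonneg.2 ha0.le) h1 (k + 1)).trans_eq ?_
    rw [← Real.exp_nat_mul]
    push_cast
    rw [mul_one_div_cancel hk.ne']
  have h3 : (Real.exp 1)⁻¹ ≤ a ^ (k + 1) := by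
    rw [inv_pow] at h2
    exact (inv_le_comm₀ (pow_pos ha0 _) (Real.exp_pos 1)).1 h2
  have h4 : 1 - 2 / ((k : ℝ) + 2) ≤ a ^ 2 := by
    have : a ^ 2 = 1 - 2 / ((k : ℝ) + 2) + (1 / ((k : ℝ) + 2)) ^ 2 := by
      rw [ha]
      ring
    rw [this]
    exact le_add_of_nonneg_right (sq_nonneg _)
  calc (Real.exp 1)⁻¹ * (1 - 2 / ((k : ℝ) + 2)) ≤ (Real.exp 1)⁻¹ * a ^ 2 := by gcongr
    _ ≤ a ^ (k + 1) * a ^ 2 := by gcongr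
    _ = a ^ (k + 2 + 1) := by ring

lemma one_sub_pow_le_exp {δ : ℝ} (h : δ ≤ 1) (k : ℕ) : (1 - δ) ^ k ≤ Real.exp (-(δ * k)) := by
  refine (pow_le_pow_left₀ (sub_nonneg.2 h) (Real.one_sub_le_exp_neg δ) k).trans_eq ?_
  rw [← Real.exp_nat_mul]
  ring_nf

/-- Averaging over a uniformly random element that has a property with high probability. -/
lemma Strategy.le_ev_uniform_bind {α : Type u} [DecidableEq α] {γ : Type v} {ι : Type w} [Fintype ι]
    [Nonempty ι] {f : Finset α → ℝ} {s : Finset α → α → Bool} {p : ι → Prop} [DecidablePred p]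
    {ρ a : ℝ} (hρ : ((Finset.univ.filter fun i => ¬ p i).card : ℝ) ≤ ρ * Fintype.card ι)
    (ha : 0 ≤ a) {g : ι → Strategy α γ} {φ : γ → ℝ} (hφ : ∀ i, 0 ≤ (g i).ev f s φ)
    (h : ∀ i, p i → a ≤ (g i).ev f s φ) : (1 - ρ) * a ≤ ((uniform ι).bind g).ev f s φ := by
  have hc : (0 : ℝ) < Fintype.card ι := by exact_mod_cast Fintype.card_pos
  rw [ev_bind, ev_uniform, le_div_iff₀ hc]
  have h1 := Finset.card_filter_add_card_filter_not (s := (Finset.univ : Finset ι)) p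
  have h2 : ((Finset.univ.filter p).card : ℝ) + (Finset.univ.filter fun i => ¬ p i).card =
      Fintype.card ι := by exact_mod_cast h1
  calc (1 - ρ) * a * Fintype.card ι ≤ (Finset.univ.filter p).card * a := by
        have := mul_le_mul_of_nonneg_right hρ ha
        rw [← h2] at this ⊢
        linarith
    _ = ∑ i ∈ Finset.univ.filter p, a := by rw [Finset.sum_const, nsmul_eq_mul]
    _ ≤ ∑ i ∈ Finset.univ.filter p, (g i).ev f s φ :=
        Finset.sum_le_sum fun i hi => h i (Finset.mem_filter.1 hi).2
    _ ≤ ∑ i, (g i).ev f s φ :=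
        Finset.sum_le_sum_of_subset_of_nonneg (Finset.filter_subset _ _) fun i _ _ => hφ i

/-! ### Guarantees of the measured greedy algorithms. -/

namespace MeasuredGreedy
open Strategy

section
variable {α : Type u} [Fintype α] [DecidableEq α] {l m : ℕ}

/-- The ratio of the smallest threshold to the largest value of a singleton. -/
noncomputable def thresholdRatio (n l : ℕ) (ε : ℝ) : ℝ := ε / (64 * (n * l))

/-- The measured greedy algorithm, run on the empirical estimate that is given by random coins. It
returns the coins, the smallest threshold and the final state. -/
noncomputable def run (α : Type u) [Fintype α] [DecidableEq α] (l m : ℕ) [NeZero l] (ε : ℝ)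
    (L T : ℕ) : Strategy α ((Fin m → Fin l × α → Fin l) × ℝ × FamilyState α l) :=
  (uniform (Fin m → Fin l × α → Fin l)).bind fun ω => askScale.bind fun v =>
    (phases ω (ε / 400) (v * thresholdRatio (Fintype.card α) l ε) L T l).bind fun st =>
      output (ω, v * thresholdRatio (Fintype.card α) l ε, st)

/-- The family of sets found by the measured greedy algorithm. -/
noncomputable def familyAlgorithm (α : Type u) [Fintype α] [DecidableEq α] (l m : ℕ) [NeZero l]
    (ε : ℝ) (L T : ℕ) : Strategy α (Fin l → Finset α) :=
  (run α l m ε L T).bind fun r => output r.2.2.Q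

/-- A lower estimate of the value of the family found by the measured greedy algorithm. -/
noncomputable def valueAlgorithm (α : Type u) [Fintype α] [DecidableEq α] (l m : ℕ) [NeZero l]
    (ε : ℝ) (L T : ℕ) : Strategy α ℝ :=
  (run α l m ε L T).bind fun r => ask (Finset.univ.image fun i => coinUnion r.2.2.Q (r.1 i)) ∅
    fun f _ => output (empiricalValue f r.1 r.2.2.Q - r.2.1 / 4)

/-- Admissible choices of the number of sets, of samples, of passes and of thresholds. -/
structure Admissible (n l m : ℕ) (ε : ℝ) (L T : ℕ) : Prop where
  pos : 0 < ε
  lt_one : ε < 1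
  two_le : 2 ≤ n
  le_mul : 8 ≤ ε * l
  samples_pos : 0 < m
  samples : 2 * 2 ^ (n * l) * Real.exp (-(m * (thresholdRatio n l ε / (4 * n)) ^ 2 / 2)) ≤ ε / 8
  passes : (1 - ε / 400) ^ L * n < 1
  thresholds : n ≤ T ∨ (1 - ε / 400) ^ T ≤ thresholdRatio n l ε

variable {ε : ℝ} {L T : ℕ} {M : Matroid α} {f : Finset α → ℝ}

lemma Admissible.eight_le {n : ℕ} (h : Admissible n l m ε L T) : 8 ≤ l := by
  have h1 := h.le_mul
  have h2 := h.lt_one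
  have h3 : (8 : ℝ) ≤ l := by
    have := mul_le_mul_of_nonneg_right h2.le (Nat.cast_nonneg (α := ℝ) l)
    linarith
  exact_mod_cast h3

lemma Admissible.mul_thresholdRatio {n : ℕ} (h : Admissible n l m ε L T) :
    64 * (n * l) * thresholdRatio n l ε = ε := by
  have h1 : (0 : ℝ) < n := by exact_mod_cast (by linarith [h.two_le] : 0 < n)
  have h2 : (0 : ℝ) < l := by exact_mod_cast (by linarith [h.eight_le] : 0 < l)
  rw [thresholdRatio]
  field_simp

lemma Admissible.thresholdRatio_pos {n : ℕ} (h : Admissible n l m ε L T) :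
    0 < thresholdRatio n l ε := by
  have h1 : (0 : ℝ) < n := by exact_mod_cast (by linarith [h.two_le] : 0 < n)
  have h2 : (0 : ℝ) < l := by exact_mod_cast (by linarith [h.eight_le] : 0 < l)
  have := h.pos
  rw [thresholdRatio]
  positivity

/-- The properties of the result of the measured greedy algorithm on accurate coins. -/
structure Result (M : Matroid α) (f : Finset α → ℝ) (ε : ℝ) (st : FamilyState α l) : Prop where
  le_value : ((Real.exp 1)⁻¹ - 3 / 10 * ε) * optValue M f - st.d ≤ sampledUnionValue f st.Q
  weight_le : (1 - ε / 400) * st.c ≤ (1 + ε / 128) * optValue M f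

/-- Since lnθ ≤ (ε/64) OPT and η = θ/4, the errors of all phases add up to (5/2)(ε/64) OPT < (1/25)ε
OPT. Replacing (1 - δ)(1 - 1/l)^(l+1) by 1/e costs (13/50)ε, and the two make (3/10)ε. The bound on
the weight c uses that the sampled union does not exceed OPT. -/
lemma result_of_familyValue (h : Admissible (Fintype.card α) l m ε L T) (hM : M.E = Set.univ)
    (hf : IsSubmodular f) (h0 : f ∅ = 0) {θ : ℝ}
    (hθ : θ = maxSingleton f (spanOracle M) * thresholdRatio (Fintype.card α) l ε)
    {st : FamilyState α l} (hI : ∀ k, M.Indep (st.Q k : Set α))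
    (hst : FamilyValue M f (ε / 400) θ (θ / 4) l st) : Result M f ε st := by
  have hv : maxSingleton f (spanOracle M) ≤ optValue M f := maxSingleton_le_optValue hM h0
  have hv0 := maxSingleton_nonneg f (spanOracle M)
  have hε := h.pos
  have hε1 := h.lt_one
  have hl8 : (8 : ℝ) ≤ l := by exact_mod_cast h.eight_le
  have hlθ : (l : ℝ) * (Fintype.card α * θ) ≤ ε / 64 * optValue M f := by
    have h1 := h.mul_thresholdRatio
    have h2 : (l : ℝ) * (Fintype.card α * θ) = ε / 64 * maxSingleton f (spanOracle M) := by
      rw [hθ]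
      linear_combination (maxSingleton f (spanOracle M) / 64) * h1
    rw [h2]
    gcongr
  have hopt0 : 0 ≤ optValue M f := hv0.trans hv
  have hle := sampledUnionValue_le_optValue hf (by linarith [h.eight_le] : 0 < l) st.Q hI
  refine ⟨?_, ?_⟩
  · have h1 := hst.progress
    have h2 := inv_exp_mul_le_pow (by linarith [h.eight_le] : 2 ≤ l)
    set e := (Real.exp 1)⁻¹ with he
    have he0 : 0 ≤ e := inv_nonneg.2 (Real.exp_pos 1).le
    have he1 : e ≤ 1 := inv_le_one_of_one_le₀ (Real.one_le_exp zero_le_one)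
    have h3 : (l : ℝ) * ((1 - ε / 400) / l * (1 - 1 / (l : ℝ)) ^ (l + 1) * optValue M f) =
        (1 - ε / 400) * (1 - 1 / (l : ℝ)) ^ (l + 1) * optValue M f := by
      field_simp
    rw [h3] at h1
    have h4 : 2 / (l : ℝ) ≤ ε / 4 := by
      rw [div_le_iff₀ (by linarith)]
      linarith [h.le_mul]
    have h5 : e - ε * (13 / 50) ≤ (1 - ε / 400) * (1 - 1 / (l : ℝ)) ^ (l + 1) := by
      calc e - ε * (13 / 50) ≤ (1 - ε / 400) * (e * (1 - ε / 4)) := by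
            nlinarith [mul_nonneg hε.le (sub_nonneg.2 he1), mul_nonneg he0 (sq_nonneg ε)]
        _ ≤ (1 - ε / 400) * (e * (1 - 2 / l)) := by
            gcongr
            linarith
        _ ≤ _ := by
            gcongr
            linarith
    have h6 := mul_le_mul_of_nonneg_right h5 hopt0
    have h7 := mul_nonneg hε.le hopt0
    linarith
  · have h1 := hst.le_value
    linarith

lemma surely_phases_result (h : Admissible (Fintype.card α) l m ε L T) (hM : M.E = Set.univ)
    (hf : IsSubmodular f) (h0 : f ∅ = 0) (hnn : ∀ S, 0 ≤ f S) {θ : ℝ}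
    (hθ : θ = maxSingleton f (spanOracle M) * thresholdRatio (Fintype.card α) l ε)
    (ω : Fin m → Fin l × α → Fin l) :
    (phases ω (ε / 400) θ L T l).Surely f (spanOracle M) fun st =>
      FamilyShape M l st ∧ (Accurate f (nonloops M) (θ / 4) ω → Result M f ε st) := by
  have hε := h.pos
  have hε1 := h.lt_one
  have hv0 := maxSingleton_nonneg f (spanOracle M)
  have hτ := h.thresholdRatio_pos
  have hτ1 : thresholdRatio (Fintype.card α) l ε ≤ 1 := by
    have h1 := h.mul_thresholdRatio
    have h2 : (1 : ℝ) ≤ Fintype.card α * l := by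
      exact_mod_cast Nat.mul_pos (by linarith [h.two_le]) (by linarith [h.eight_le])
    nlinarith
  have hθ0 : 0 ≤ θ := by
    rw [hθ]
    positivity
  have hmax : max θ (maxSingleton f (spanOracle M)) = maxSingleton f (spanOracle M) := by
    refine max_eq_right ?_
    rw [hθ]
    exact mul_le_of_le_one_right hv0 hτ1
  refine (surely_phases (η := θ / 4) hM hf h0 hnn (by linarith [h.eight_le]) (by positivity)
    (by linarith) hθ0 ?_ h.passes (h.thresholds.imp_right fun hT => ?_) l le_rfl).mono
    fun st hst => ⟨hst.1, fun hacc =>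
      result_of_familyValue h hM hf h0 hθ hst.1.indep (hst.2 hacc)⟩
  · nlinarith
  · rw [hmax, hθ, mul_comm]
    gcongr

/-- The expected weight of the rejected elements is small on accurate coins. -/
lemma ev_phases_rejected_le (h : Admissible (Fintype.card α) l m ε L T) (hM : M.E = Set.univ)
    (hf : IsSubmodular f) (h0 : f ∅ = 0) (hnn : ∀ S, 0 ≤ f S) {θ : ℝ}
    (hθ : θ = maxSingleton f (spanOracle M) * thresholdRatio (Fintype.card α) l ε)
    {ω : Fin m → Fin l × α → Fin l} (hacc : Accurate f (nonloops M) (θ / 4) ω) :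
    (phases ω (ε / 400) θ L T l).ev f (spanOracle M) FamilyState.d ≤
      ε / 300 * optValue M f := by
  have hε := h.pos
  have hε1 := h.lt_one
  have hv0 := maxSingleton_nonneg f (spanOracle M)
  have hv : maxSingleton f (spanOracle M) ≤ optValue M f := maxSingleton_le_optValue hM h0
  have hopt0 : 0 ≤ optValue M f := hv0.trans hv
  have hθ0 : 0 ≤ θ := by
    rw [hθ]
    exact mul_nonneg hv0 h.thresholdRatio_pos.le
  set δ := ε / 400 with hδ
  have h1 := ev_phases_le (ω := ω) hM hf (δ := δ) (by linarith) hθ0 L T l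
  have h2 : (phases ω δ θ L T l).ev f (spanOracle M) (fun st => (1 - δ) * ((1 - δ) * st.d) -
      δ * ((1 + ε / 128) * optValue M f)) ≤ (phases ω δ θ L T l).ev f (spanOracle M)
      (fun st => (1 - δ) * ((1 - δ) * st.d - δ * st.c)) := by
    refine ev_le_ev (surely_phases_result h hM hf h0 hnn hθ ω) fun st hst => ?_
    have := mul_le_mul_of_nonneg_left (hst.2 hacc).weight_le (by positivity : 0 ≤ δ)
    rw [← hδ] at this
    linarith
  rw [ev_const_mul] at h2
  simp only [sub_eq_add_neg (_ * (_ * _)) (δ * _)] at h2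
  rw [ev_add, ev_const_mul, ev_const_mul, ev_const] at h2
  set D := (phases ω δ θ L T l).ev f (spanOracle M) fun st => st.d
  have h3 := mul_nonpos_of_nonneg_of_nonpos (by linarith : 0 ≤ 1 - δ) h1
  -- The supermartingale bounds D by the expectation of c, and c is surely bounded by about OPT.
  -- With δ = ε/400 this leaves room for ε/300.
  have h4 : (1 - δ) * ((1 - δ) * D) ≤ δ * ((1 + ε / 128) * optValue M f) := by linarith
  change D ≤ _
  have h5 : δ * (1 + ε / 128) ≤ (1 - δ) ^ 2 * (ε / 300) := by
    rw [hδ]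
    nlinarith [mul_pos hε hε]
  have h6 := mul_le_mul_of_nonneg_right h5 hopt0
  refine le_of_mul_le_mul_left (a := (1 - δ) ^ 2) ?_ (by
    have : 0 < 1 - δ := by linarith
    positivity)
  linarith

open scoped Classical in
lemma card_not_accurate_le_of_admissible (h : Admissible (Fintype.card α) l m ε L T)
    (hM : M.E = Set.univ) (hf : IsSubmodular f) (h0 : f ∅ = 0) (hnn : ∀ S, 0 ≤ f S) {θ : ℝ}
    (hθ : θ = maxSingleton f (spanOracle M) * thresholdRatio (Fintype.card α) l ε) :
    ((Finset.univ.filter fun ω : Fin m → Fin l × α → Fin l =>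
      ¬ Accurate f (nonloops M) (θ / 4) ω).card : ℝ) ≤
      ε / 8 * Fintype.card (Fin m → Fin l × α → Fin l) := by
  have hn : (0 : ℝ) < Fintype.card α := by
    exact_mod_cast (by linarith [h.two_le] : 0 < Fintype.card α)
  have h1 := card_not_accurate_le (l := l) (m := m) (by linarith [h.eight_le]) (f := f)
    (N := nonloops M) (fun S _ => hnn S) (fun S hS => le_card_mul_maxSingleton hM hf h0 hS)
    (κ := thresholdRatio (Fintype.card α) l ε / (4 * Fintype.card α))
    (div_nonneg h.thresholdRatio_pos.le (by linarith)) h.samples_pos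
  have h2 : thresholdRatio (Fintype.card α) l ε / (4 * Fintype.card α) *
      (Fintype.card α * maxSingleton f (spanOracle M)) = θ / 4 := by
    rw [hθ]
    field_simp
  rw [h2] at h1
  exact h1.trans (mul_le_mul_of_nonneg_right h.samples (Nat.cast_nonneg _))

/-- The expectation of a functional of the result is at least what it is on accurate coins, up to a
factor. -/
lemma le_ev_run [NeZero l] (h : Admissible (Fintype.card α) l m ε L T) (hM : M.E = Set.univ)
    (hf : IsSubmodular f) (h0 : f ∅ = 0) (hnn : ∀ S, 0 ≤ f S) {θ : ℝ}
    (hθ : θ = maxSingleton f (spanOracle M) * thresholdRatio (Fintype.card α) l ε)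
    {φ : (Fin m → Fin l × α → Fin l) × ℝ × FamilyState α l → ℝ} (hφ : ∀ r, 0 ≤ φ r) {a : ℝ}
    (ha : 0 ≤ a) (hacc : ∀ ω, Accurate f (nonloops M) (θ / 4) ω →
      a ≤ (phases ω (ε / 400) θ L T l).ev f (spanOracle M) fun st => φ (ω, θ, st)) :
    (1 - ε / 8) * a ≤ (run α l m ε L T).ev f (spanOracle M) φ := by
  classical
  refine le_ev_uniform_bind (card_not_accurate_le_of_admissible h hM hf h0 hnn hθ) ha
    (fun ω => ?_) fun ω hω => ?_
  · exact (ev_const _ 0).symm.trans_le (ev_mono hφ)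
  · rw [ev_askScale_bind, ev_bind, ← hθ]
    exact hacc ω hω

lemma surely_run [NeZero l] (h : Admissible (Fintype.card α) l m ε L T) (hM : M.E = Set.univ)
    (hf : IsSubmodular f) (h0 : f ∅ = 0) (hnn : ∀ S, 0 ≤ f S) :
    (run α l m ε L T).Surely f (spanOracle M) fun r => ∀ k, M.Indep (r.2.2.Q k : Set α) := by
  refine (surely_uniform (p := fun _ => True) fun _ => trivial).bind fun ω _ => ?_
  rw [surely_askScale_bind]
  exact (surely_phases_result h hM hf h0 hnn rfl ω).bind fun st hst => hst.1.indep

theorem surely_familyAlgorithm [NeZero l] (h : Admissible (Fintype.card α) l m ε L T)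
    (hM : M.E = Set.univ) (hf : IsSubmodular f) (h0 : f ∅ = 0) (hnn : ∀ S, 0 ≤ f S) :
    (familyAlgorithm α l m ε L T).Surely f (spanOracle M) fun I =>
      ∀ k, M.Indep (I k : Set α) :=
  (surely_run h hM hf h0 hnn).bind fun _ hr => hr

lemma sampledUnionValue_nonneg (hnn : ∀ S, 0 ≤ f S) (I : Fin l → Finset α) :
    0 ≤ sampledUnionValue f I := by
  refine le_trans (le_of_eq ?_) (sampledUnionValue_mono hnn I)
  simp [sampledUnionValue]

/-- Makes the guarantee on accurate coins nonnegative, as `le_ev_run` requires. -/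
lemma mul_le_inv_exp_one_of_lt_one (hε : ε < 1) : 31 / 100 * ε ≤ (Real.exp 1)⁻¹ := by
  have h1 : (1 / 3 : ℝ) ≤ (Real.exp 1)⁻¹ := by
    rw [one_div]
    exact inv_anti₀ (Real.exp_pos 1) (by linarith [Real.exp_one_lt_d9])
  linarith

/-- The loss on accurate coins is (3/10)ε plus ε/300 for the rejected weight, hence below (31/100)ε.
Inaccurate coins cost the factor 1 - ε/8, their value being nonnegative. -/
theorem le_ev_familyAlgorithm [NeZero l] (h : Admissible (Fintype.card α) l m ε L T)
    (hM : M.E = Set.univ) (hf : IsSubmodular f) (h0 : f ∅ = 0) (hnn : ∀ S, 0 ≤ f S) :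
    ((Real.exp 1)⁻¹ - ε) * optValue M f ≤
      (familyAlgorithm α l m ε L T).ev f (spanOracle M) (fun I => sampledUnionValue f I) := by
  have hε := h.pos
  have hε1 := h.lt_one
  have hopt0 : 0 ≤ optValue M f :=
    (maxSingleton_nonneg f (spanOracle M)).trans (maxSingleton_le_optValue hM h0)
  have he := mul_le_inv_exp_one_of_lt_one hε1
  have he1 : (Real.exp 1)⁻¹ ≤ 1 := inv_le_one_of_one_le₀ (Real.one_le_exp zero_le_one)
  rw [familyAlgorithm, ev_bind]
  refine le_trans ?_ (le_ev_run h hM hf h0 hnn rfl (φ := fun r => sampledUnionValue f r.2.2.Q)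
    (a := ((Real.exp 1)⁻¹ - 31 / 100 * ε) * optValue M f) (fun r => sampledUnionValue_nonneg hnn _)
    (mul_nonneg (sub_nonneg.2 he) hopt0) fun ω hω => ?_)
  · rw [← mul_assoc]
    refine mul_le_mul_of_nonneg_right ?_ hopt0
    nlinarith [mul_nonneg hε.le (sub_nonneg.2 he1), mul_pos hε hε]
  · have h1 := ev_phases_rejected_le h hM hf h0 hnn rfl hω
    have h2 := ev_le_ev (φ := fun st => ((Real.exp 1)⁻¹ - 3 / 10 * ε) * optValue M f +
      (-1) * st.d) (ψ := fun st => sampledUnionValue f st.Q)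
      (surely_phases_result h hM hf h0 hnn rfl ω) fun st hst => by
        have := (hst.2 hω).le_value
        linarith
    rw [ev_add, ev_const, ev_const_mul] at h2
    refine le_trans ?_ h2
    have h3 : 0 ≤ ε * optValue M f := mul_nonneg hε.le hopt0
    change (phases ω _ _ L T l).ev f (spanOracle M) (fun st => st.d) ≤ _ at h1
    linarith

lemma empiricalValue_mask (ω : Fin m → Fin l × α → Fin l) (I : Fin l → Finset α) :
    empiricalValue (maskValue (Finset.univ.image fun i => coinUnion I (ω i)) f) ω I =
      empiricalValue f ω I := by
  unfold empiricalValue maskValue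
  congr 1
  exact Finset.sum_congr rfl fun i _ => if_pos (Finset.mem_image_of_mem _ (Finset.mem_univ i))

-- Subtracting the accuracy θ/4 makes V a lower bound for F(Q) ≤ OPT. By Markov's inequality the
-- rejected weight exceeds (ε/2) OPT with probability at most (ε/300)/(ε/2) = 1/150. Both this and
-- the accuracy of the coins hold with probability at least (7/8)(149/150) > 2/3.
open scoped Classical in
theorem le_ev_valueAlgorithm [NeZero l] (h : Admissible (Fintype.card α) l m ε L T)
    (hM : M.E = Set.univ) (hf : IsSubmodular f) (h0 : f ∅ = 0) (hnn : ∀ S, 0 ≤ f S) :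
    2 / 3 ≤ (valueAlgorithm α l m ε L T).ev f (spanOracle M) fun V =>
      if V ∈ Set.Icc (((Real.exp 1)⁻¹ - ε) * optValue M f) (optValue M f) then 1 else 0 := by
  have hε := h.pos
  have hε1 := h.lt_one
  have hv0 := maxSingleton_nonneg f (spanOracle M)
  have hv : maxSingleton f (spanOracle M) ≤ optValue M f := maxSingleton_le_optValue hM h0
  have hopt0 : 0 ≤ optValue M f := hv0.trans hv
  set θ := maxSingleton f (spanOracle M) * thresholdRatio (Fintype.card α) l ε with hθ
  have hθε : θ ≤ ε / 64 * optValue M f := by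
    have h1 := h.mul_thresholdRatio
    have h2 : (1 : ℝ) ≤ Fintype.card α * l := by
      exact_mod_cast Nat.mul_pos (by linarith [h.two_le]) (by linarith [h.eight_le])
    have h3 : thresholdRatio (Fintype.card α) l ε ≤ ε / 64 := by
      nlinarith [h.thresholdRatio_pos]
    rw [hθ, mul_comm]
    gcongr
  rw [valueAlgorithm, ev_bind]
  simp only [ev, empiricalValue_mask]
  refine le_trans ?_ (le_ev_run h hM hf h0 hnn hθ (a := 149 / 150)
    (φ := fun r => if empiricalValue f r.1 r.2.2.Q - r.2.1 / 4 ∈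
      Set.Icc (((Real.exp 1)⁻¹ - ε) * optValue M f) (optValue M f) then 1 else 0)
    (fun r => by split_ifs <;> norm_num) (by norm_num) fun ω hω => ?_)
  · linarith
  · have hgood : ∀ st : FamilyState α l, FamilyShape M l st → Result M f ε st →
        st.d ≤ ε / 2 * optValue M f → empiricalValue f ω st.Q - θ / 4 ∈
          Set.Icc (((Real.exp 1)⁻¹ - ε) * optValue M f) (optValue M f) := by
      intro st hs hr hd
      have h1 := abs_le.1 (hω st.Q fun i => (hs.subset i).trans (hs.nonloop i))
      have h2 := sampledUnionValue_le_optValue hf (by linarith [h.eight_le] : 0 < l) st.Q hs.indep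
      have h3 := hr.le_value
      have h4 : 0 ≤ ε * optValue M f := mul_nonneg hε.le hopt0
      constructor <;> linarith [h1.1, h1.2]
    have hs := surely_phases_result h hM hf h0 hnn hθ ω
    have hd := ev_phases_rejected_le h hM hf h0 hnn hθ hω
    change (phases ω _ _ L T l).ev f (spanOracle M) (fun st => st.d) ≤ _ at hd
    -- Markov's inequality needs OPT > 0. For OPT = 0 also θ = 0, and accurate coins give V = 0
    -- exactly.
    rcases hopt0.eq_or_lt with hz | hpos
    · refine le_trans ?_ ((ev_const _ 1).symm.trans_le (ev_le_ev hs fun st hst => ?_))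
      · norm_num
      · rw [← hz, mul_zero] at hθε
        have hθ0 : θ = 0 :=
          le_antisymm hθε (hθ ▸ mul_nonneg hv0 h.thresholdRatio_pos.le)
        have h1 := hω st.Q fun i => (hst.1.subset i).trans (hst.1.nonloop i)
        have h2 := sampledUnionValue_le_optValue hf (by linarith [h.eight_le] : 0 < l) st.Q
          hst.1.indep
        have h3 := sampledUnionValue_nonneg hnn st.Q
        rw [hθ0, zero_div] at h1
        have h4 := abs_nonpos_iff.1 h1
        rw [if_pos]
        rw [hθ0, ← hz, mul_zero]
        constructor <;> linarith
    · have hc : 0 < ε / 2 * optValue M f := by positivity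
      have h1 := ev_le_ev (φ := fun st => 1 + -(1 / (ε / 2 * optValue M f)) * st.d)
        (ψ := fun st => if empiricalValue f ω st.Q - θ / 4 ∈
          Set.Icc (((Real.exp 1)⁻¹ - ε) * optValue M f) (optValue M f) then (1 : ℝ) else 0)
        hs fun st hst => by
          have hd0 := hst.1.nonneg
          by_cases hle : st.d ≤ ε / 2 * optValue M f
          · rw [if_pos (hgood st hst.1 (hst.2 hω) hle)]
            have : 0 ≤ 1 / (ε / 2 * optValue M f) * st.d := by positivity
            linarith
          · have h2 : 1 ≤ 1 / (ε / 2 * optValue M f) * st.d := by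
              rw [one_div, inv_mul_eq_div, one_le_div hc]
              linarith
            refine le_trans (by linarith) (?_ : (0 : ℝ) ≤ _)
            split_ifs <;> norm_num
      rw [ev_add, ev_const, ev_const_mul] at h1
      refine le_trans ?_ h1
      have h2 := mul_le_mul_of_nonneg_left hd (by positivity : 0 ≤ 1 / (ε / 2 * optValue M f))
      have h3 : 1 / (ε / 2 * optValue M f) * (ε / 300 * optValue M f) = 1 / 150 := by
        field_simp
        norm_num
      linarith

lemma roundsLE_run [NeZero l] (ε : ℝ) (L T : ℕ) :
    (run α l m ε L T).RoundsLE (1 + l * (T * (1 + L * 2))) := by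
  refine ((roundsLE_uniform _).bind (r' := 1 + l * (T * (1 + L * 2))) fun ω => ?_).mono (by omega)
  refine roundsLE_askScale.bind fun v => ?_
  exact (roundsLE_phases _ _ L T l).bind (r' := 0) (g := fun st =>
    output (ω, v * thresholdRatio (Fintype.card α) l ε, st)) fun _ => trivial

lemma roundsLE_familyAlgorithm [NeZero l] (ε : ℝ) (L T : ℕ) :
    (familyAlgorithm α l m ε L T).RoundsLE (1 + l * (T * (1 + L * 2))) := by
  rw [familyAlgorithm]
  exact RoundsLE.bind (r' := 0) (roundsLE_run (α := α) (l := l) (m := m) ε L T)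
    (g := fun r => output r.2.2.Q) fun _ => trivial

lemma roundsLE_valueAlgorithm [NeZero l] (ε : ℝ) (L T : ℕ) :
    (valueAlgorithm α l m ε L T).RoundsLE (1 + l * (T * (1 + L * 2)) + 1) := by
  rw [valueAlgorithm]
  exact RoundsLE.bind (roundsLE_run (α := α) (l := l) (m := m) ε L T) fun _ _ _ => trivial

lemma queriesLE_run [NeZero l] (ε : ℝ) (L T : ℕ) :
    (run α l m ε L T).QueriesLE
      ((Fintype.card α + 1) * (Fintype.card α * (2 * m + 1)) + 2 * Fintype.card α + m : ℕ) := by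
  refine (queriesLE_uniform _ _).bind fun ω => (queriesLE_askScale ?_).bind fun v =>
    ((queriesLE_phases _ _ L T l).mono ?_).bind fun st => trivial
  · push_cast
    have : (0 : ℝ) ≤ (Fintype.card α + 1) * (Fintype.card α * (2 * m + 1)) + m := by positivity
    linarith
  · exact_mod_cast (by omega)

lemma queriesLE_familyAlgorithm [NeZero l] (ε : ℝ) (L T : ℕ) :
    (familyAlgorithm α l m ε L T).QueriesLE
      ((Fintype.card α + 1) * (Fintype.card α * (2 * m + 1)) + 2 * Fintype.card α + m : ℕ) :=
  (queriesLE_run ε L T).bind fun _ => trivial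

lemma queriesLE_valueAlgorithm [NeZero l] (ε : ℝ) (L T : ℕ) :
    (valueAlgorithm α l m ε L T).QueriesLE
      ((Fintype.card α + 1) * (Fintype.card α * (2 * m + 1)) + 2 * Fintype.card α + m : ℕ) := by
  refine (queriesLE_run ε L T).bind fun r => ⟨?_, fun _ _ => trivial⟩
  have : (Finset.univ.image fun i => coinUnion r.2.2.Q (r.1 i)).card ≤ m :=
    Finset.card_image_le.trans_eq (by simp)
  rw [Finset.card_empty]
  exact_mod_cast (by omega)

end

end MeasuredGreedy

/-! ### Choice of parameters and counts of rounds and queries. -/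

lemma half_le_log {n : ℕ} (hn : 2 ≤ n) : 1 / 2 ≤ Real.log n := by
  have h1 := Real.log_le_log (by norm_num) (show (2 : ℝ) ≤ n by exact_mod_cast hn)
  linarith [Real.log_two_gt_d9]

/-- `log (c n ^ k) ≤ (a + k) log n` when `c ≤ 2 ^ a`. -/
lemma log_mul_pow_le {n : ℕ} (hn : 2 ≤ n) {c : ℝ} (hc : 0 < c) (a k : ℕ) (h : c ≤ 2 ^ a) :
    Real.log (c * (n : ℝ) ^ k) ≤ (a + k) * Real.log n := by
  have hn' : (2 : ℝ) ≤ n := by exact_mod_cast hn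
  have h1 : c * (n : ℝ) ^ k ≤ (n : ℝ) ^ (a + k) := by
    rw [pow_add]
    gcongr
    exact h.trans (pow_le_pow_left₀ (by norm_num) hn' a)
  refine (Real.log_le_log (by positivity) h1).trans_eq ?_
  rw [Real.log_pow]
  push_cast
  ring

lemma one_sub_pow_mul_lt_one {δ y : ℝ} (hδ : 0 < δ) (hδ1 : δ ≤ 1) (hy : 0 < y) {k : ℕ}
    (hk : Real.log y / δ < k) : (1 - δ) ^ k * y < 1 := by
  rw [div_lt_iff₀ hδ] at hk
  calc (1 - δ) ^ k * y ≤ Real.exp (-(δ * k)) * y :=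
        mul_le_mul_of_nonneg_right (one_sub_pow_le_exp hδ1 k) hy.le
    _ = Real.exp (Real.log y - δ * k) := by
        rw [sub_eq_neg_add, Real.exp_add, Real.exp_log hy]
    _ < 1 := by rw [← Real.exp_zero]; exact Real.exp_lt_exp.2 (by linarith)

lemma exists_admissible_two_sided {n : ℕ} (hn : 2 ≤ n) :
    ∃ L T : ℕ, (9 / 10 : ℝ) ^ L * (2 * n) < 1 ∧ (9 / 10 : ℝ) ^ T * (20 * n) ≤ 1 ∧
      ((1 + T * (1 + 2 * (L * 2)) : ℕ) : ℝ) ≤ 10 ^ 10 * Real.log n ^ 2 := by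
  have hn' : (2 : ℝ) ≤ n := by exact_mod_cast hn
  have hlog := half_le_log hn
  set y := Real.log n
  have h2 : Real.log (2 * n) ≤ 2 * y := by
    have := log_mul_pow_le hn (c := 2) (by norm_num) 1 1 (by norm_num)
    norm_num at this
    exact this
  have h20 : Real.log (20 * n) ≤ 6 * y := by
    have := log_mul_pow_le hn (c := 20) (by norm_num) 5 1 (by norm_num)
    norm_num at this
    exact this
  have h2' : 0 ≤ Real.log (2 * n) := Real.log_nonneg (by linarith)
  have h20' : 0 ≤ Real.log (20 * n) := Real.log_nonneg (by linarith)
  have hL := Nat.floor_le (show 0 ≤ Real.log (2 * n) / (1 / 10) by positivity)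
  have hT := Nat.floor_le (show 0 ≤ Real.log (20 * n) / (1 / 10) by positivity)
  have hL' := Nat.lt_floor_add_one (Real.log (2 * n) / (1 / 10))
  have hT' := Nat.lt_floor_add_one (Real.log (20 * n) / (1 / 10))
  refine ⟨⌊Real.log (2 * n) / (1 / 10)⌋₊ + 1, ⌊Real.log (20 * n) / (1 / 10)⌋₊ + 1, ?_, ?_, ?_⟩
  · have := one_sub_pow_mul_lt_one (δ := 1 / 10) (y := 2 * n) (by norm_num) (by norm_num)
      (by linarith) (k := ⌊Real.log (2 * n) / (1 / 10)⌋₊ + 1) (by exact_mod_cast hL')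
    norm_num at this ⊢
    exact this
  · have := one_sub_pow_mul_lt_one (δ := 1 / 10) (y := 20 * n) (by norm_num) (by norm_num)
      (by linarith) (k := ⌊Real.log (20 * n) / (1 / 10)⌋₊ + 1) (by exact_mod_cast hT')
    norm_num at this ⊢
    exact this.le
  · push_cast
    set a : ℝ := (⌊Real.log (2 * n) / (1 / 10)⌋₊ : ℝ)
    set b : ℝ := (⌊Real.log (20 * n) / (1 / 10)⌋₊ : ℝ)
    have ha0 : 0 ≤ a := Nat.cast_nonneg _
    have ha : a ≤ 20 * y := by linarith
    have hb : b ≤ 60 * y := by linarith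
    calc 1 + (b + 1) * (1 + 2 * ((a + 1) * 2))
        ≤ 4 * y ^ 2 + (60 * y + 2 * y) * (2 * y + 2 * ((20 * y + 2 * y) * 2)) := by
          gcongr
          · nlinarith
          · linarith
          · linarith
          · linarith
      _ ≤ 10 ^ 10 * y ^ 2 := by nlinarith [sq_nonneg y]

/-- There are l = O(1/ε) phases of T = O(log n / ε) stages of L = O(log n / ε) steps. The relative
accuracy κ is of order (ε/n)², so about (n/ε) / κ² samples beat the union bound over 2^(nl)
families, whence the exponent 5. -/
lemma exists_admissible {n : ℕ} (hn : 2 ≤ n) {ε : ℝ} (hε : 0 < ε) (hε1 : ε < 1) :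
    ∃ l m L T : ℕ, MeasuredGreedy.Admissible n l m ε L T ∧ (l : ℝ) ≤ 9 / ε ∧
      (m : ℝ) ≤ 300000000 * (n / ε) ^ 5 ∧
      ((1 + l * (T * (1 + L * 2)) + 1 : ℕ) : ℝ) ≤ 10 ^ 10 * Real.log n ^ 2 / ε ^ 3 := by
  have hn' : (2 : ℝ) ≤ n := by exact_mod_cast hn
  have hn0 : (0 : ℝ) < n := by linarith
  have hlog := half_le_log hn
  have hεi : 1 ≤ 1 / ε := by
    rw [le_div_iff₀ hε]
    linarith
  set l := ⌈8 / ε⌉₊ with hl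
  have hl1 : 8 / ε ≤ l := Nat.le_ceil _
  have hl2 : (l : ℝ) ≤ 9 / ε := by
    have := (Nat.ceil_lt_add_one (show 0 ≤ 8 / ε by positivity)).le
    rw [show 9 / ε = 8 / ε + 1 / ε by ring]
    linarith
  have hl0 : (0 : ℝ) < l := lt_of_lt_of_le (by positivity) hl1
  set τ := MeasuredGreedy.thresholdRatio n l ε with hτ
  have hτ0 : 0 < τ := by
    rw [hτ, MeasuredGreedy.thresholdRatio]
    positivity
  set κ := τ / (4 * n) with hκ
  have hκ0 : 0 < κ := by positivity
  set m := ⌈2 * (n * l + 16 / ε) / κ ^ 2⌉₊ with hm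
  have hm1 : 2 * (n * l + 16 / ε) / κ ^ 2 ≤ m := Nat.le_ceil _
  have hm0 : (0 : ℝ) < m := lt_of_lt_of_le (by positivity) hm1
  have hL := Nat.floor_le (show 0 ≤ Real.log n / (ε / 400) by positivity)
  have hL' := Nat.lt_floor_add_one (Real.log n / (ε / 400))
  set L := ⌊Real.log n / (ε / 400)⌋₊ + 1 with hLdef
  have hLle : (L : ℝ) ≤ 402 * Real.log n / ε := by
    rw [hLdef]
    push_cast
    have h1 : 1 ≤ 2 * Real.log n / ε := by
      rw [le_div_iff₀ hε]
      linarith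
    have h2 : Real.log n / (ε / 400) = 400 * Real.log n / ε := by
      field_simp
    rw [h2] at hL ⊢
    have h3 : 402 * Real.log n / ε = 400 * Real.log n / ε + 2 * Real.log n / ε := by ring
    linarith
  obtain ⟨T, hT, hTle⟩ : ∃ T : ℕ, (n ≤ T ∨ (1 - ε / 400) ^ T ≤ τ) ∧
      (T : ℝ) ≤ 5202 * Real.log n / ε := by
    -- If nε ≥ 1, then 1/τ is polynomial in n alone and O(log n / ε) stages reach the threshold. If
    -- nε < 1, then n ≤ 1/ε stages process everything. The split avoids a term log(1/ε).
    rcases le_or_gt (1 : ℝ) (n * ε) with hbig | hsmall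
    · have hτi : τ⁻¹ ≤ 576 * (n : ℝ) ^ 3 := by
        rw [hτ, MeasuredGreedy.thresholdRatio, inv_div, div_le_iff₀ hε]
        have h1 : (l : ℝ) * ε ≤ 9 := (le_div_iff₀ hε).1 hl2
        have h2 : 64 * (n * l) * (n * ε) ^ 2 ≥ 64 * (n * l) * 1 :=
          mul_le_mul_of_nonneg_left (one_le_pow₀ hbig) (by positivity)
        have h3 : 64 * (n * l) * (n * ε) ^ 2 = 64 * (n : ℝ) ^ 3 * ε * (l * ε) := by ring
        have h4 : 64 * (n : ℝ) ^ 3 * ε * (l * ε) ≤ 64 * (n : ℝ) ^ 3 * ε * 9 := by gcongr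
        linarith
      have hlogτ : Real.log τ⁻¹ ≤ 13 * Real.log n := by
        refine (Real.log_le_log (by positivity) hτi).trans ?_
        have := log_mul_pow_le hn (c := 576) (by norm_num) 10 3 (by norm_num)
        norm_num at this
        exact this
      have hT' := Nat.lt_floor_add_one (13 * Real.log n / (ε / 400))
      have hT := Nat.floor_le (show 0 ≤ 13 * Real.log n / (ε / 400) by positivity)
      refine ⟨⌊13 * Real.log n / (ε / 400)⌋₊ + 1, Or.inr ?_, ?_⟩
      · have := one_sub_pow_mul_lt_one (δ := ε / 400) (y := τ⁻¹) (by positivity) (by linarith)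
          (by positivity) (k := ⌊13 * Real.log n / (ε / 400)⌋₊ + 1) (by
            push_cast
            exact (div_le_div_of_nonneg_right hlogτ (by positivity)).trans_lt hT')
        rw [← div_eq_mul_inv, div_lt_one hτ0] at this
        exact this.le
      · push_cast
        have h1 : 1 ≤ 2 * Real.log n / ε := by
          rw [le_div_iff₀ hε]
          linarith
        have h2 : 13 * Real.log n / (ε / 400) = 5200 * Real.log n / ε := by
          field_simp
          norm_num
        rw [h2] at hT ⊢
        have h3 : 5202 * Real.log n / ε = 5200 * Real.log n / ε + 2 * Real.log n / ε := by ring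
        linarith
    · refine ⟨n, Or.inl le_rfl, ?_⟩
      rw [le_div_iff₀ hε]
      linarith
  refine ⟨l, m, L, T, ⟨hε, hε1, hn, ?_, by exact_mod_cast hm0, ?_, ?_, hT⟩, hl2, ?_, ?_⟩
  · rw [mul_comm]
    exact (div_le_iff₀ hε).1 hl1
  · have h1 : n * l + 16 / ε ≤ m * κ ^ 2 / 2 := by
      rw [div_le_iff₀ (by positivity)] at hm1
      linarith
    have h2 : (2 : ℝ) ^ (n * l) ≤ Real.exp (n * l) := by
      rw [show ((n : ℝ) * l) = ((n * l : ℕ) : ℝ) * 1 by push_cast; ring, Real.exp_nat_mul]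
      exact pow_le_pow_left₀ (by norm_num) (by linarith [Real.exp_one_gt_d9]) _
    have h3 : Real.exp (-(16 / ε)) ≤ ε / 16 := by
      rw [Real.exp_neg]
      refine inv_le_of_inv_le₀ (by positivity) ?_
      rw [inv_div]
      linarith [Real.add_one_le_exp (16 / ε)]
    calc 2 * 2 ^ (n * l) * Real.exp (-(m * κ ^ 2 / 2))
        ≤ 2 * Real.exp (n * l) * Real.exp (-(n * l + 16 / ε)) := by gcongr
      _ = 2 * Real.exp (-(16 / ε)) := by
          rw [mul_assoc, ← Real.exp_add]
          ring_nf
      _ ≤ ε / 8 := by linarith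
  · exact one_sub_pow_mul_lt_one (by positivity) (by linarith) hn0 (by exact_mod_cast hL')
  · have hx : 1 ≤ n / ε := by
      rw [le_div_iff₀ hε]
      linarith
    have h1 : (n : ℝ) * l + 16 / ε ≤ 25 * (n / ε) := by
      have h2 : (n : ℝ) * l ≤ n * (9 / ε) := by gcongr
      have h3 : 16 / ε ≤ 16 * (n / ε) := by
        rw [← mul_div_assoc]
        gcongr
        linarith
      have h4 : (n : ℝ) * (9 / ε) = 9 * (n / ε) := by ring
      linarith
    have h2 : 1 / κ ≤ 2304 * (n / ε) ^ 2 := by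
      rw [hκ, hτ, MeasuredGreedy.thresholdRatio]
      have h3 : 1 / (ε / (64 * (n * l)) / (4 * n)) = 256 * (n : ℝ) ^ 2 * l / ε := by
        field_simp
        norm_num
      rw [h3]
      calc 256 * (n : ℝ) ^ 2 * l / ε ≤ 256 * (n : ℝ) ^ 2 * (9 / ε) / ε := by gcongr
        _ = 2304 * (n / ε) ^ 2 := by
          field_simp
          norm_num
    have h3 : 2 * (n * l + 16 / ε) / κ ^ 2 ≤ 2 * (25 * (n / ε)) * (2304 * (n / ε) ^ 2) ^ 2 := by
      rw [div_eq_mul_one_div, ← one_div_pow]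
      gcongr
    have h4 := (Nat.ceil_lt_add_one (show 0 ≤ 2 * (n * l + 16 / ε) / κ ^ 2 by positivity)).le
    have h5 : 1 ≤ (n / ε) ^ 5 := one_le_pow₀ hx
    rw [← hm] at h4
    calc (m : ℝ) ≤ 2 * (25 * (n / ε)) * (2304 * (n / ε) ^ 2) ^ 2 + (n / ε) ^ 5 := by linarith
      _ = 265420801 * (n / ε) ^ 5 := by ring
      _ ≤ _ := by gcongr; norm_num
  · push_cast
    have h1 : 1 ≤ Real.log n / ε * 2 := by
      rw [div_mul_eq_mul_div, le_div_iff₀ hε]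
      linarith
    set z := Real.log n / ε with hz
    have hz0 : 0 < z := by positivity
    have hL2 : (L : ℝ) ≤ 402 * z := by
      rw [hz, ← mul_div_assoc]
      exact hLle
    have hT2 : (T : ℝ) ≤ 5202 * z := by
      rw [hz, ← mul_div_assoc]
      exact hTle
    calc (1 : ℝ) + l * (T * (1 + L * 2)) + 1 = l * (T * (1 + L * 2)) + 2 := by ring
      _ ≤ 9 / ε * (5202 * z * (2 * z + 402 * z * 2)) + 8 * (1 / ε) * z ^ 2 := by
          gcongr
          · linarith
          · nlinarith
      _ = 37735316 * (1 / ε * z ^ 2) := by ring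
      _ ≤ 10 ^ 10 * (1 / ε * z ^ 2) := by
          gcongr
          norm_num
      _ = _ := by
          rw [hz]
          field_simp

lemma queries_two_sided_le {n : ℕ} (hn : 2 ≤ n) {ε : ℝ} (hε : 0 < ε) (hε1 : ε < 1) :
    (((2 * n + 1) * (2 * n * 3) : ℕ) : ℝ) ≤ 10 ^ 10 * (n / ε) ^ 7 := by
  have hn' : (2 : ℝ) ≤ n := by exact_mod_cast hn
  have hx : (n : ℝ) ≤ n / ε := by
    rw [le_div_iff₀ hε]
    nlinarith
  set x := (n : ℝ) / ε
  have hx1 : 1 ≤ x := by linarith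
  push_cast
  calc (2 * (n : ℝ) + 1) * (2 * n * 3) ≤ (2 * x + x) * (2 * x * 3) := by gcongr
    _ = 18 * x ^ 2 := by ring
    _ ≤ 10 ^ 10 * x ^ 7 := by
        gcongr
        · norm_num
        · norm_num

lemma queries_measured_le {n m : ℕ} (hn : 2 ≤ n) {ε : ℝ} (hε : 0 < ε) (hε1 : ε < 1)
    (hm : (m : ℝ) ≤ 300000000 * (n / ε) ^ 5) :
    (((n + 1) * (n * (2 * m + 1)) + 2 * n + m : ℕ) : ℝ) ≤ 10 ^ 10 * (n / ε) ^ 7 := by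
  have hn' : (2 : ℝ) ≤ n := by exact_mod_cast hn
  have hx : (n : ℝ) ≤ n / ε := by
    rw [le_div_iff₀ hε]
    nlinarith
  set x := (n : ℝ) / ε
  have hx1 : 1 ≤ x := by linarith
  have h5 : 1 ≤ x ^ 5 := one_le_pow₀ hx1
  have h57 : x ^ 5 ≤ x ^ 7 := pow_le_pow_right₀ hx1 (by norm_num)
  have h17 : x ≤ x ^ 7 := le_self_pow₀ hx1 (by norm_num)
  push_cast
  calc ((n : ℝ) + 1) * (n * (2 * m + 1)) + 2 * n + m
      ≤ (x + x) * (x * (2 * (300000000 * x ^ 5) + x ^ 5)) + 2 * x ^ 7 + 300000000 * x ^ 7 := by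
        gcongr
        · exact hx.trans h17
        · linarith
    _ = 1500000004 * x ^ 7 := by ring
    _ ≤ 10 ^ 10 * x ^ 7 := by
        gcongr
        norm_num

lemma three_sub_two_mul_sqrt_two_le : 3 - 2 * Real.sqrt 2 ≤ 19 / 100 := by
  have : 281 / 200 ≤ Real.sqrt 2 := Real.le_sqrt_of_sq_le (by norm_num)
  linarith

lemma Strategy.expectedRounds_toOracleAlg_le_ofReal {α : Type u} [DecidableEq α] {γ : Type v}
    {A : Strategy α γ} (M : Matroid α) (f : Finset α → ℝ) {r : ℕ} {R : ℝ} (h : A.RoundsLE r)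
    (hr : (r : ℝ) ≤ R) : A.toOracleAlg.expectedRounds M f ≤ ENNReal.ofReal R := by
  refine (expectedRounds_toOracleAlg_le M f h).trans ?_
  rw [← ENNReal.ofReal_natCast]
  exact ENNReal.ofReal_le_ofReal hr

theorem mainTheorem2 :
    ∃ (C : ℝ) (d : ℕ), ∀ (α : Type*) [Fintype α] [DecidableEq α] (n : ℕ) (ε : ℝ),
      Fintype.card α = n → 2 ≤ n → 0 < ε → ε < 1 →
      -- an independent set
      (∃ A : OracleAlg α (Finset α),
        A.QueriesPerRoundLE (C * (n / ε) ^ d) ∧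
        ∀ (M : Matroid α) (f : Finset α → ℝ), M.E = Set.univ →
          IsSubmodular f → f ∅ = 0 → (∀ S, 0 ≤ f S) →
          (∀ I ∈ (A.outputLaw M f).support, M.Indep (I : Set α)) ∧
          (1 - ε) * (3 - 2 * Real.sqrt 2) * optValue M f ≤ finExpect (A.outputLaw M f) f ∧
          A.expectedRounds M f ≤ ENNReal.ofReal (C * Real.log n ^ 2 / ε ^ 2)) ∧
      -- a convex combination of few independent sets
      (∃ l : ℕ, 1 ≤ l ∧ (l : ℝ) ≤ C / ε ∧ ∃ A : OracleAlg α (Fin l → Finset α),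
        A.QueriesPerRoundLE (C * (n / ε) ^ d) ∧
        ∀ (M : Matroid α) (f : Finset α → ℝ), M.E = Set.univ →
          IsSubmodular f → f ∅ = 0 → (∀ S, 0 ≤ f S) →
          (∀ I ∈ (A.outputLaw M f).support, ∀ k, M.Indep (I k : Set α)) ∧
          ((Real.exp 1)⁻¹ - ε) * optValue M f ≤
            finExpect (A.outputLaw M f) (fun I => sampledUnionValue f I) ∧
          A.expectedRounds M f ≤ ENNReal.ofReal (C * Real.log n ^ 2 / ε ^ 3)) ∧
      -- an approximation to the optimum value
      (∃ A : OracleAlg α ℝ,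
        A.QueriesPerRoundLE (C * (n / ε) ^ d) ∧
        ∀ (M : Matroid α) (f : Finset α → ℝ), M.E = Set.univ →
          IsSubmodular f → f ∅ = 0 → (∀ S, 0 ≤ f S) →
          2 / 3 ≤ (A.outputLaw M f).toOuterMeasure
            (Set.Icc (((Real.exp 1)⁻¹ - ε) * optValue M f) (optValue M f)) ∧
          A.expectedRounds M f ≤ ENNReal.ofReal (C * Real.log n ^ 2 / ε ^ 3)) := by
  refine ⟨10 ^ 10, 7, fun α _ _ n ε hα hn hε hε1 => ?_⟩
  subst hα
  obtain ⟨l, m, L, T, hadm, hl, hm, hr⟩ := exists_admissible hn hε hε1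
  have hl8 := hadm.eight_le
  have : NeZero l := ⟨by linarith⟩
  refine ⟨?_, ⟨l, by linarith, hl.trans (by gcongr; norm_num), ?_⟩, ?_⟩
  · obtain ⟨L', T', hL, hT, hr'⟩ := exists_admissible_two_sided hn
    refine ⟨(TwoSided.algorithm α L' T').toOracleAlg, Strategy.queriesPerRoundLE_toOracleAlg
      ((TwoSided.queriesLE_algorithm L' T').mono (queries_two_sided_le hn hε hε1)),
      fun M f hM hf h0 hnn => ?_⟩
    have hspec := TwoSided.algorithm_spec hM hf h0 hnn (by linarith) hL hT
    refine ⟨Strategy.surely_of_mem_support_outputLaw hspec.1, ?_,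
      Strategy.expectedRounds_toOracleAlg_le_ofReal M f (TwoSided.roundsLE_algorithm L' T')
        (hr'.trans ?_)⟩
    · rw [Strategy.finExpect_outputLaw]
      refine le_trans (mul_le_mul_of_nonneg_right ?_ (h0 ▸ le_optValue (I := ∅) (by simp) f)) hspec.2
      -- The guarantee 19/100 exceeds 3 - 2√2 outright, so the factor 1 - ε is not needed.
      have h1 := three_sub_two_mul_sqrt_two_le
      nlinarith
    · refine le_div_self (by positivity) (by positivity) (pow_le_one₀ hε.le hε1.le)
  · refine ⟨(MeasuredGreedy.familyAlgorithm α l m ε L T).toOracleAlg,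
      Strategy.queriesPerRoundLE_toOracleAlg ((MeasuredGreedy.queriesLE_familyAlgorithm ε L T).mono
        (queries_measured_le hn hε hε1 hm)), fun M f hM hf h0 hnn => ⟨?_, ?_, ?_⟩⟩
    · exact Strategy.surely_of_mem_support_outputLaw
        (MeasuredGreedy.surely_familyAlgorithm hadm hM hf h0 hnn)
    · rw [Strategy.finExpect_outputLaw]
      exact MeasuredGreedy.le_ev_familyAlgorithm hadm hM hf h0 hnn
    · exact Strategy.expectedRounds_toOracleAlg_le_ofReal M f
        ((MeasuredGreedy.roundsLE_familyAlgorithm ε L T).mono (Nat.le_succ _)) hr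
  · refine ⟨(MeasuredGreedy.valueAlgorithm α l m ε L T).toOracleAlg,
      Strategy.queriesPerRoundLE_toOracleAlg ((MeasuredGreedy.queriesLE_valueAlgorithm ε L T).mono
        (queries_measured_le hn hε hε1 hm)), fun M f hM hf h0 hnn => ⟨?_,
      Strategy.expectedRounds_toOracleAlg_le_ofReal M f
        (MeasuredGreedy.roundsLE_valueAlgorithm ε L T) hr⟩⟩
    have h23 : ENNReal.ofReal (2 / 3) = 2 / 3 := by
      rw [ENNReal.ofReal_div_of_pos (by norm_num)]
      norm_num
    rw [Strategy.toOuterMeasure_outputLaw, ← h23]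
    refine ENNReal.ofReal_le_ofReal ?_
    convert MeasuredGreedy.le_ev_valueAlgorithm hadm hM hf h0 hnn
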